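/- **Setting.** Let $(e_j)_{j\ge1}$ be the trigonometric basis of $L_2[0,1]$: $e_1=1$, $e_{2m}(t)=\sqrt2\cos(2\pi mt)$, $e_{2m+1}(t)=\sqrt2\sin(2\pi mt)$. For a sequence $\theta=(\theta_j)_{j\ge1}$ put $f_\theta=\sum_j\theta_je_j$. For $\beta,L>0$ let $$\mathcal H_\infty(\beta,L)=\{\theta:\max_j j^{2\beta+1}\theta_j^2\le L\},\qquad \mathcal S_\beta(L)=\Big\{\theta:\sum_j j^{2\beta}\theta_j^2\le L\Big\}.$$ We observe $\mathbf x_n=(x_1,\dots,x_n)$ with $x_i=f_0(t_i)+Z_i$, $t_i=i/n$, $Z_i$ i.i.d. $N(0,\sigma^2)$, $\sigma^2>0$ known. The true function is $f_0=f_{\theta_0}$, in one of two settings: * (F) $f_0$ has smoothness $\beta>1/2$ (so that its Fourier series converges absolutely), and $\theta_0$ does not depend on $n$; * (P) the smoothness $\beta>0$ is arbitrary, and for sample size $n$ the true parameter is the projection of $\theta_0$ on the first $n-1$ coordinates (so the true function lies in $\mathrm{span}(e_1,\dots,e_{n-1})$). In this setting $\theta_0$ and $f_0$ below denote the projected parameter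 and function. Write $P^n_{\theta_0}$ (or $P^n_{f_0}$) for the law of the data, and $E^n_{\theta_0}$ for its expectation. *Prior.* Let $g$ be a positive continuous probability density on $\mathbb R$ with $\int e^{s_0|x|^{p^*}}g(x)\,dx<\infty$ for some $s_0>0$, $p^*\ge1$. Under $\Pi(\cdot\mid k)$, $k\ge2$, the coordinates $\theta_1,\dots,\theta_k$ are i.i.d. with density $g$ and $\theta_j=0$ for $j>k$. Let $\Lambda_n=\{k\in\mathbb N:2\le k\le\varepsilon n/\log n\}$, and let $\hat k_n$ be any measurable maximizer over $\Lambda_n$ of the marginal likelihood $k\mapsto\int p^n_\theta(\mathbf x_n)\,d\Pi(\theta\mid k)$ (whenever $\Lambda_n\neq\emptyset$). The empirical Bayes posterior is $\Pi(\cdot\mid\mathbf x_n;\hat k_n)$, the posterior for the prior $\Pi(\cdot\mid k)$ evaluated at $k=\hat k_n$. The hierarchical posterior $\Pi(\cdot\mid\mathbf x_n)$ is the one for the prior $\sum_{k\ge2}\tilde\pi(k)\Pi(\cdot\mid k)$, where $\tilde\pi$ is a probability mass function on $\{2,3,\dots\}$, not depending on $n$, such that for some $c_1,c_2>0$ and $\beta_0\ge0$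 $$k^{-c_2k}\lesssim\tilde\pi(k)\lesssim e^{-c_1k^{1/(1+2\beta_0)}}\qquad(*)$$ (each inequality up to a constant factor, for all large $k$). *Oracle set.* For $K>0$ and $k\in\Lambda_n$ let $\epsilon_n(k)>0$ be the unique solution of $\Pi(\|\theta-\theta_0\|_2\le K\epsilon_n(k)\mid k)=e^{-n\epsilon_n(k)^2}$. For a sequence $m_n\to\infty$ let $$\epsilon_{n,0}^2=\inf\{\epsilon_n(k)^2:k\in\Lambda_n,\ \epsilon_n(k)^2\ge m_n\tfrac{\log n}{n}\}\vee m_n\tfrac{\log n}{n}$$ (read as $m_n\log n/n$ if the set is empty), and $\Lambda_0=\{k\in\Lambda_n:\epsilon_n(k)\le M_n\epsilon_{n,0}\}$. **Proposition.** There is $\varepsilon_0>0$, depending only on $g$ and $\sigma^2$, such that for every $0<\varepsilon\le\varepsilon_0$, every $\hat k_n$ as above and every $L>0$ the following hold, in setting (P), and in setting (F) with the indicated restriction. 1. Let $\beta>0$ [in (F): $\beta>1/2$] and $\theta_0\in\mathcal H_\infty(\beta,L)\cup\mathcal S_\beta(L)$. For every $K>0$ and all sequences $M_n\to\infty$, $m_n\to\infty$,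 $P^n_{\theta_0}(\hat k_n\in\Lambda_0)\to1$. 2. Let $0<\beta_1\le\beta_2<\infty$ [in (F): $\beta_1>1/2$] and $M_n\to\infty$. Then $$\sup_{\beta\in(\beta_1,\beta_2)}\ \sup_{\theta_0\in\mathcal H_\infty(\beta,L)\cup\mathcal S_\beta(L)}E^n_{f_0}\,\Pi\big(f:\|f_0-f\|_2\ge M_n(n/\log n)^{-\beta/(2\beta+1)}\,\big|\,\mathbf x_n;\hat k_n\big)\to0,$$ and the same holds for the hierarchical posterior $\Pi(\cdot\mid\mathbf x_n)$ if $\tilde\pi$ satisfies $(*)$ with some $0\le\beta_0<\beta_1$. 3. Let $\beta>0$ [in (F): $\beta>1/2$]. There is $\theta_0\in\mathcal H_\infty(\beta,L)\cup\mathcal S_\beta(L)$ such that for every sequence $\delta_n\to0$ $$E^n_{f_0}\,\Pi\big(f:\|f_0-f\|_2\le\delta_n(n/\log n)^{-\beta/(2\beta+1)}\,\big|\,\mathbf x_n;\hat k_n\big)\to0,$$ and the same holds for the hierarchical posterior if $\tilde\pi$ satisfies $(*)$ with some $0\le\beta_0<\beta$. -/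

import Mathlib

open MeasureTheory ProbabilityTheory Filter Topology
open scoped NNReal ENNReal

namespace SieveRegression

noncomputable section

/-! Sequences are indexed from `0`: the entry `θ j` is the coefficient number `j + 1`. -/

/-- The trigonometric basis of `L²[0,1]`: `1, √2 cos(2πt), √2 sin(2πt), √2 cos(4πt), …`. -/
def trigBasis (j : ℕ) (t : ℝ) : ℝ :=
  if j = 0 then 1
  else if j % 2 = 1 then √2 * Real.cos (2 * Real.pi * ((j + 1) / 2 : ℕ) * t)
  else √2 * Real.sin (2 * Real.pi * (j / 2 : ℕ) * t)

/-- The function with coefficient sequence `θ`. -/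
def regFun (θ : ℕ → ℝ) (t : ℝ) : ℝ := ∑' j, θ j * trigBasis j t

/-- The `L²[0,1]` distance between the functions with coefficients `θ` and `θ'`. -/
def funDist (θ θ' : ℕ → ℝ) : ℝ := √(∫ t in (0 : ℝ)..1, (regFun θ t - regFun θ' t) ^ 2)

/-- The `ℓ₂` distance between square summable sequences. -/
def seqDist (θ θ' : ℕ → ℝ) : ℝ := √(∑' j, (θ j - θ' j) ^ 2)

/-- The hyperrectangle `{θ : max_i i^(2β+1) θ_i² ≤ L}`. -/
def hyperrect (β L : ℝ) : Set (ℕ → ℝ) :=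
  {θ | ∀ j : ℕ, ((j : ℝ) + 1) ^ (2 * β + 1) * θ j ^ 2 ≤ L}

/-- The Sobolev ball `{θ : ∑_i i^(2β) θ_i² ≤ L}`. -/
def sobolev (β L : ℝ) : Set (ℕ → ℝ) :=
  {θ | Summable (fun j : ℕ => ((j : ℝ) + 1) ^ (2 * β) * θ j ^ 2) ∧
    ∑' j : ℕ, ((j : ℝ) + 1) ^ (2 * β) * θ j ^ 2 ≤ L}

open Classical in
/-- The true parameter for sample size `n`: the sequence `θ₀` itself, or (if `proj` holds) its
projection on the first `n - 1` coordinates, that is on `span(e₁, …, e_{n-1})`. -/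
def truth (proj : Prop) (n : ℕ) (θ₀ : ℕ → ℝ) : ℕ → ℝ :=
  fun j => if proj ∧ n ≤ j + 1 then 0 else θ₀ j

/-- The design point `t_i = i / n`, `i = 1, …, n`. -/
def design (n : ℕ) (i : Fin n) : ℝ := ((i : ℕ) + 1 : ℝ) / n

/-- The law of `(x_1, …, x_n)`, `x_i = f_θ(t_i) + Z_i`, with `Z_i` i.i.d. `N(0, v)`. -/
def dataLaw (v : ℝ≥0) (n : ℕ) (θ : ℕ → ℝ) : Measure (Fin n → ℝ) :=
  Measure.pi fun i => gaussianReal (regFun θ (design n i)) v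

/-- The density of `dataLaw v n θ` at `x` (for `v ≠ 0`). -/
def lik (v : ℝ≥0) (n : ℕ) (x : Fin n → ℝ) (θ : ℕ → ℝ) : ℝ≥0∞ :=
  ∏ i, gaussianPDF (regFun θ (design n i)) v (x i)

/-- The conditions on the density `g` of the coordinates under the sieve prior. -/
structure IsSieveDensity (g : ℝ → ℝ) : Prop where
  pos : ∀ x, 0 < g x
  cont : Continuous g
  integrable : Integrable g
  integral_eq_one : ∫ x, g x = 1
  exp_moment : ∃ s₀ p : ℝ, 0 < s₀ ∧ 1 ≤ p ∧
    Integrable fun x => Real.exp (s₀ * |x| ^ p) * g x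

/-- Extension of a vector of length `k` by zeros. -/
def extendZero (k : ℕ) (u : Fin k → ℝ) : ℕ → ℝ := fun j => if h : j < k then u ⟨j, h⟩ else 0

/-- The sieve prior `Π(· | k)`: the first `k` coordinates are i.i.d. with density `g`, the other
coordinates are zero. -/
def sievePrior (g : ℝ → ℝ) (k : ℕ) : Measure (ℕ → ℝ) :=
  (Measure.pi fun _ : Fin k => volume.withDensity fun x => ENNReal.ofReal (g x)).map (extendZero k)

/-- The hierarchical prior `∑_k π(k) Π(· | k)`. -/
def hierPrior (g : ℝ → ℝ) (π : ℕ → ℝ) : Measure (ℕ → ℝ) :=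
  Measure.sum fun k => ENNReal.ofReal (π k) • sievePrior g k

/-- The marginal density of the data under the prior `Q`. -/
def marginal (v : ℝ≥0) (n : ℕ) (Q : Measure (ℕ → ℝ)) (x : Fin n → ℝ) : ℝ≥0∞ :=
  ∫⁻ θ, lik v n x θ ∂Q

/-- The posterior probability of `B` for the prior `Q` and the data `x` (Bayes' formula). -/
def posteriorProb (v : ℝ≥0) (n : ℕ) (Q : Measure (ℕ → ℝ)) (x : Fin n → ℝ) (B : Set (ℕ → ℝ)) : ℝ≥0∞ :=
  (∫⁻ θ in B, lik v n x θ ∂Q) / marginal v n Q x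

/-- The set `Λ_n = {2, …, ε n / log n}` of truncation levels. -/
def levels (ε : ℝ) (n : ℕ) : Set ℕ := {k | 2 ≤ k ∧ (k : ℝ) ≤ ε * n / Real.log n}

/-- `khat n` is a (measurable) marginal maximum likelihood estimator of `k` over `Λ_n`, for every
`n` (for the finitely many `n` with `Λ_n` empty nothing but measurability is required). -/
def IsMMLE (v : ℝ≥0) (g : ℝ → ℝ) (ε : ℝ) (khat : (n : ℕ) → (Fin n → ℝ) → ℕ) : Prop :=
  ∀ n, Measurable (khat n) ∧ ((levels ε n).Nonempty → ∀ x, khat n x ∈ levels ε n ∧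
    ∀ k ∈ levels ε n, marginal v n (sievePrior g k) x ≤ marginal v n (sievePrior g (khat n x)) x)

/-- `e k = ε_n(k)` is the positive solution of `Π(‖θ - θ₀‖₂ ≤ K ε_n(k) | k) = exp(-n ε_n(k)²)`,
for `k ∈ Λ_n`. The left side is a continuous distribution function of `ε_n(k)` that vanishes at
`0`, so that there is exactly one solution. -/
def IsLevelRate (g : ℝ → ℝ) (ε K : ℝ) (n : ℕ) (θ₀ : ℕ → ℝ) (e : ℕ → ℝ) : Prop :=
  ∀ k ∈ levels ε n, 0 < e k ∧
    sievePrior g k {θ | seqDist θ θ₀ ≤ K * e k} = ENNReal.ofReal (Real.exp (-(n * e k ^ 2)))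

/-- The oracle rate: `ε_{n,0}² = inf {ε_n(k)² : k ∈ Λ_n, ε_n(k)² ≥ m log n / n} ∨ m log n / n`.
If there is no such `k`, this is `m log n / n`, which then exceeds all `ε_n(k)²`. -/
def oracleRate (ε m : ℝ) (n : ℕ) (e : ℕ → ℝ) : ℝ :=
  √(max (sInf {r | ∃ k ∈ levels ε n, r = e k ^ 2 ∧ m * Real.log n / n ≤ e k ^ 2})
    (m * Real.log n / n))

/-- The set `Λ_0 = {k ∈ Λ_n : ε_n(k) ≤ M ε_{n,0}}`. -/
def oracleSet (ε M m : ℝ) (n : ℕ) (e : ℕ → ℝ) : Set ℕ :=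
  {k | k ∈ levels ε n ∧ e k ≤ M * oracleRate ε m n e}

/-- `π` is a probability mass function on `{2, 3, …}` with
`k^(-c₂ k) ≲ π(k) ≲ exp(-c₁ k^(1/(1+2β₀)))` for some `c₁, c₂ > 0`. -/
structure IsHyperPrior (β₀ : ℝ) (π : ℕ → ℝ) : Prop where
  nonneg : ∀ k, 0 ≤ π k
  support : ∀ k, k < 2 → π k = 0
  hasSum : HasSum π 1
  lower : ∃ c₂ C : ℝ, 0 < c₂ ∧ 0 < C ∧ ∀ᶠ k : ℕ in atTop, (k : ℝ) ^ (-(c₂ * k)) ≤ C * π k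
  upper : ∃ c₁ C : ℝ, 0 < c₁ ∧ 0 < C ∧
    ∀ᶠ k : ℕ in atTop, π k ≤ C * Real.exp (-(c₁ * (k : ℝ) ^ (1 / (1 + 2 * β₀))))

/-- The rate `(n / log n)^(-β/(2β+1))`. -/
def rate (β : ℝ) (n : ℕ) : ℝ := ((n : ℝ) / Real.log n) ^ (-(β / (2 * β + 1)))

end

end SieveRegression

open SieveRegression

namespace SieveRegression

noncomputable section

/-! ### Exponential moments of products of Gaussian measures -/

/-! The likelihood ratio of `θ` against the truth `θ₀` is `exp((2⟨d, z⟩ - ‖d‖²) / (2v))`, where `z`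
is the noise and `d` the difference of the two mean vectors. For `θ` in the sieve of dimension `k`
all these `d` lie in one linear space of dimension at most `k + 1`, so the data enter only through
the squared norm of the projection of `z` on that space. This norm has exponential moments of order
`2^(k+1)`, while a prior on `k` coordinates works with exponents of order `k log n`. Hence on a
single event of probability tending to one (`goodEvent`), uniformly in the truth, the projected
noise is at most any prescribed small multiple of `k log n` for all `k ≥ 2` at once. On this event
everything is deterministic, and neither tests nor entropy bounds are needed
(`lik_le_exp_projNoise`, `lik_le_exp_neg`, `exp_neg_le_lik`).

The exponent `‖d‖` has to be compared with `√n` times the `ℓ₂` distance. The first `n - 1` basis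
functions are exactly orthogonal on the design, and the remaining coefficients contribute an
aliasing error that is bounded in `n` when the smoothness exceeds `1/2`
(`norm_evalVec_tailSeq_sq_le`, `exists_isRegular_truth`).

Marginal likelihoods are then read off from prior masses of balls. From above, the ball is split
off: inside it the prior mass is small, outside it the likelihood is small (`marginal_le_of_ball`).
From below, only the ball is kept (`le_marginal_of_subset_ball`). With the balls that define
`ε_n(k)`, both bounds are exponentials of constant multiples of `-n ε_n(k)²`. A maximizer therefore
cannot have a level rate far above the best one, which is the oracle statement
(`tendsto_mmle_mem_oracleSet`).

For the rates let `X = (n / log n)^(1/(2β+1))`. A level near `X` has marginal likelihood at least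
`exp(-C X log n)` relative to the truth, and level `k` has at most `2 exp(-c k log n)` as long as `k
log n ≤ n`; so only `k ≤ T X` matters. A set on whose part in these sieves the likelihood is small
has small posterior mass (`PosteriorControl`). Contraction applies this to the complement of a ball.
Sharpness applies it to a small ball around a truth that no sieve of dimension at most `T X`
approximates better than the rate. For the hierarchical prior the levels with `k log n > n` are also
present; there the expected likelihood ratio is one, and the hyperprior tail beats `exp(C X log n)`
because `β₀ < β₁`. -/

lemma lintegral_pi_prod {ι : Type*} [Fintype ι] (μ : ι → Measure ℝ)
    [∀ i, IsProbabilityMeasure (μ i)] (f : ι → ℝ → ℝ≥0∞) (hf : ∀ i, Measurable (f i)) :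
    ∫⁻ x, ∏ i, f i (x i) ∂(Measure.pi μ) = ∏ i, ∫⁻ t, f i t ∂(μ i) := by
  have h := lintegral_prod_eq_prod_lintegral_of_indepFun (μ := Measure.pi μ) Finset.univ
    (fun i (x : ι → ℝ) => f i (x i)) (iIndepFun_pi fun i => (hf i).aemeasurable)
    (fun i => (hf i).comp (measurable_pi_apply i))
  rw [h]
  refine Finset.prod_congr rfl fun i _ => ?_
  rw [← (measurePreserving_eval μ i).map_eq, lintegral_map (hf i) (measurable_pi_apply i)]

lemma ofReal_exp_sum {ι : Type*} [Fintype ι] (a : ι → ℝ) :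
    ENNReal.ofReal (Real.exp (∑ i, a i)) = ∏ i, ENNReal.ofReal (Real.exp (a i)) := by
  rw [Real.exp_sum, ENNReal.ofReal_prod_of_nonneg fun i _ => (Real.exp_pos _).le]

lemma lintegral_exp_gaussianReal (m : ℝ) (v : ℝ≥0) (w : ℝ) :
    ∫⁻ t, ENNReal.ofReal (Real.exp (w * (t - m))) ∂(gaussianReal m v)
      = ENNReal.ofReal (Real.exp (v * w ^ 2 / 2)) := by
  have hint : Integrable (fun t => Real.exp (w * (t - m))) (gaussianReal m v) := by
    have h := (integrable_exp_mul_gaussianReal (μ := m) (v := v) w).mul_const (Real.exp (-(w * m)))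
    refine h.congr (ae_of_all _ fun t => ?_)
    simp only [← Real.exp_add]
    ring_nf
  rw [← ofReal_integral_eq_lintegral_ofReal hint (ae_of_all _ fun t => (Real.exp_pos _).le)]
  congr 1
  have h := congrFun (mgf_id_gaussianReal (μ := m) (v := v)) w
  simp only [mgf, id] at h
  calc ∫ t, Real.exp (w * (t - m)) ∂(gaussianReal m v)
      = ∫ t, Real.exp (w * t) * Real.exp (-(w * m)) ∂(gaussianReal m v) := by
        congr 1; ext t; rw [← Real.exp_add]; ring_nf
    _ = Real.exp (v * w ^ 2 / 2) := by
        rw [integral_mul_const, h, ← Real.exp_add]; ring_nf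

/-- The vector of the values of `f_θ` at the design points. -/
def evalVec (n : ℕ) (θ : ℕ → ℝ) : EuclideanSpace ℝ (Fin n) :=
  WithLp.toLp 2 fun i => regFun θ (design n i)

/-- The noise vector, if the true parameter is `θ₀`. -/
def noise (n : ℕ) (θ₀ : ℕ → ℝ) (x : Fin n → ℝ) : EuclideanSpace ℝ (Fin n) :=
  WithLp.toLp 2 x - evalVec n θ₀

instance (v : ℝ≥0) (n : ℕ) (θ : ℕ → ℝ) : IsProbabilityMeasure (dataLaw v n θ) := by
  unfold dataLaw; infer_instance

lemma continuous_noise (n : ℕ) (θ₀ : ℕ → ℝ) : Continuous (noise n θ₀) := by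
  unfold noise; fun_prop

lemma lintegral_exp_inner_noise (v : ℝ≥0) (n : ℕ) (θ₀ : ℕ → ℝ) (w : EuclideanSpace ℝ (Fin n)) :
    ∫⁻ x, ENNReal.ofReal (Real.exp (inner ℝ w (noise n θ₀ x))) ∂(dataLaw v n θ₀)
      = ENNReal.ofReal (Real.exp (v * ‖w‖ ^ 2 / 2)) := by
  have h1 : ∀ x : Fin n → ℝ, ENNReal.ofReal (Real.exp (inner ℝ w (noise n θ₀ x)))
      = ∏ i, ENNReal.ofReal (Real.exp (w i * (x i - regFun θ₀ (design n i)))) := fun x => by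
    rw [← ofReal_exp_sum, PiLp.inner_apply]
    congr 2
    refine Finset.sum_congr rfl fun i _ => ?_
    simp [noise, evalVec, mul_comm]
  simp_rw [h1]
  rw [dataLaw, lintegral_pi_prod _
    (fun i t => ENNReal.ofReal (Real.exp (w i * (t - regFun θ₀ (design n i)))))
    (fun i => by fun_prop)]
  simp_rw [lintegral_exp_gaussianReal]
  rw [← ofReal_exp_sum, EuclideanSpace.norm_sq_eq, ← Finset.sum_div, ← Finset.mul_sum]
  simp

/-- The factor `exp(v u² / 2)` turns the density shape `exp(-v u²)` into `exp(-v u² / 2)`, that of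
variance `1/v`. The normalizing constants differ by `√2`, which is rounded up to `2`. -/
lemma lintegral_exp_sq_gaussianReal_le (v : ℝ≥0) (hv : v ≠ 0) :
    ∫⁻ u, ENNReal.ofReal (Real.exp (v * u ^ 2 / 2)) ∂(gaussianReal 0 (1 / (2 * v))) ≤ 2 := by
  have hv' : (0 : ℝ) < v := by positivity
  have h2 : (1 / (2 * v) : ℝ≥0) ≠ 0 := by positivity
  have h3 : (1 / v : ℝ≥0) ≠ 0 := by positivity
  rw [gaussianReal_of_var_ne_zero _ h2, lintegral_withDensity_eq_lintegral_mul _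
    (measurable_gaussianPDF _ _) (by fun_prop)]
  calc _ ≤ ∫⁻ u, 2 * gaussianPDF 0 (1 / v) u := by
        refine lintegral_mono fun u => ?_
        simp only [Pi.mul_apply, gaussianPDF]
        rw [← ENNReal.ofReal_mul (gaussianPDFReal_nonneg _ _ _), ← ENNReal.ofReal_ofNat,
          ← ENNReal.ofReal_mul (by norm_num)]
        refine ENNReal.ofReal_le_ofReal ?_
        simp only [gaussianPDFReal, sub_zero]
        push_cast
        rw [mul_assoc, ← Real.exp_add, ← mul_assoc]
        have e1 : -u ^ 2 / (2 * (1 / (2 * (v : ℝ)))) + v * u ^ 2 / 2 = -u ^ 2 / (2 * (1 / v)) := by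
          field_simp; ring
        rw [e1]
        refine mul_le_mul_of_nonneg_right ?_ (Real.exp_pos _).le
        have h4 : √(2 * Real.pi * (1 / (v : ℝ))) ≤ 2 * √(2 * Real.pi * (1 / (2 * (v : ℝ)))) := by
          rw [show (2 : ℝ) * √(2 * Real.pi * (1 / (2 * (v : ℝ))))
            = √(2 ^ 2 * (2 * Real.pi * (1 / (2 * (v : ℝ))))) by
              rw [Real.sqrt_mul (by norm_num : (0 : ℝ) ≤ 2 ^ 2) _, Real.sqrt_sq (by norm_num : (0 : ℝ) ≤ 2)]]
          refine Real.sqrt_le_sqrt ?_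
          rw [show (2 : ℝ) ^ 2 * (2 * Real.pi * (1 / (2 * (v : ℝ))))
            = 2 * (2 * Real.pi * (1 / (v : ℝ))) by field_simp]
          have : 0 < 2 * Real.pi * (1 / (v : ℝ)) := by positivity
          linarith
        have p1 : 0 < √(2 * Real.pi * (1 / (v : ℝ))) := by positivity
        have p2 : 0 < √(2 * Real.pi * (1 / (2 * (v : ℝ)))) := by positivity
        rw [inv_eq_one_div, ← div_eq_mul_inv, div_le_div_iff₀ p2 p1]
        linarith
    _ = 2 := by
        rw [lintegral_const_mul _ (measurable_gaussianPDF _ _), lintegral_gaussianPDF_eq_one _ h3,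
          mul_one]

lemma norm_starProjection_sq_eq {n : ℕ} (W : Submodule ℝ (EuclideanSpace ℝ (Fin n)))
    (z : EuclideanSpace ℝ (Fin n)) :
    ‖W.starProjection z‖ ^ 2
      = ∑ a, (inner ℝ (stdOrthonormalBasis ℝ W a : EuclideanSpace ℝ (Fin n)) z) ^ 2 := by
  have h := (stdOrthonormalBasis ℝ W).sum_sq_norm_inner_right (W.orthogonalProjectionOnto z)
  have e : ‖W.starProjection z‖ = ‖W.orthogonalProjectionOnto z‖ := rfl
  rw [e, ← h]
  refine Finset.sum_congr rfl fun a _ => ?_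
  rw [Real.norm_eq_abs, sq_abs]
  congr 1
  simp

/-- The squared norm of the projection of Gaussian noise on a subspace has exponential moments of
the size of the exponential of the dimension. -/
lemma lintegral_exp_norm_starProjection_noise_le (v : ℝ≥0) (hv : v ≠ 0) (n : ℕ) (θ₀ : ℕ → ℝ)
    (W : Submodule ℝ (EuclideanSpace ℝ (Fin n))) :
    ∫⁻ x, ENNReal.ofReal (Real.exp (‖W.starProjection (noise n θ₀ x)‖ ^ 2 / (4 * v)))
      ∂(dataLaw v n θ₀) ≤ 2 ^ Module.finrank ℝ W := by
  have hv' : (0 : ℝ) < v := by positivity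
  set b := fun a => (stdOrthonormalBasis ℝ W a : EuclideanSpace ℝ (Fin n)) with hb
  let γ : Measure ℝ := gaussianReal 0 (1 / (2 * v))
  have hon : Orthonormal ℝ b := (stdOrthonormalBasis ℝ W).orthonormal.comp_linearIsometry W.subtypeₗᵢ
  have hnorm : ∀ u : Fin (Module.finrank ℝ W) → ℝ, ‖∑ a, u a • b a‖ ^ 2 = ∑ a, u a ^ 2 := fun u => by
    rw [← real_inner_self_eq_norm_sq, hon.inner_sum]
    simp [sq]
  -- The square is linearized by an auxiliary Gaussian vector: for `u ~ N(0, 1/(2v))` the mean of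
  -- `exp(w u)` is `exp(w² / (4v))`. After exchanging the integrals only linear functionals of the
  -- noise have to be integrated.
  have h1 : ∀ x, ENNReal.ofReal (Real.exp (‖W.starProjection (noise n θ₀ x)‖ ^ 2 / (4 * v)))
      = ∫⁻ u, ENNReal.ofReal (Real.exp (inner ℝ (∑ a, u a • b a) (noise n θ₀ x)))
        ∂(Measure.pi fun _ : Fin (Module.finrank ℝ W) => γ) := fun x => by
    have e : ∀ u : Fin (Module.finrank ℝ W) → ℝ,
        ENNReal.ofReal (Real.exp (inner ℝ (∑ a, u a • b a) (noise n θ₀ x)))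
        = ∏ a, ENNReal.ofReal (Real.exp (inner ℝ (b a) (noise n θ₀ x) * (u a - 0))) := fun u => by
      rw [← ofReal_exp_sum, sum_inner]
      congr 2
      refine Finset.sum_congr rfl fun a _ => ?_
      rw [real_inner_smul_left]; ring
    simp_rw [e]
    rw [lintegral_pi_prod _ (fun a t => ENNReal.ofReal (Real.exp
      (inner ℝ (b a) (noise n θ₀ x) * (t - 0)))) (fun a => by fun_prop)]
    rw [Finset.prod_congr rfl fun a _ => lintegral_exp_gaussianReal 0 (1 / (2 * v)) _,
      ← ofReal_exp_sum, norm_starProjection_sq_eq, Finset.sum_div]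
    congr 3 with a
    push_cast
    field_simp
    ring
  simp_rw [h1]
  rw [lintegral_lintegral_swap]
  · have e1 : ∀ u : Fin (Module.finrank ℝ W) → ℝ,
        ∫⁻ x, ENNReal.ofReal (Real.exp (inner ℝ (∑ a, u a • b a) (noise n θ₀ x))) ∂dataLaw v n θ₀
        = ∏ a, ENNReal.ofReal (Real.exp (v * u a ^ 2 / 2)) := fun u => by
      rw [← ofReal_exp_sum, ← Finset.sum_div, ← Finset.mul_sum, ← hnorm]
      exact lintegral_exp_inner_noise v n θ₀ _
    rw [lintegral_congr e1]
    rw [lintegral_pi_prod _ (fun _ t => ENNReal.ofReal (Real.exp (v * t ^ 2 / 2)))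
      (fun a => by fun_prop)]
    refine (Finset.prod_le_prod' fun a _ => lintegral_exp_sq_gaussianReal_le v hv).trans ?_
    rw [Finset.prod_const, Finset.card_univ, Fintype.card_fin]
  · have := continuous_noise n θ₀
    refine Measurable.aemeasurable (ENNReal.continuous_ofReal.comp ?_).measurable
    fun_prop

/-- Markov's inequality for the exponential moment. A dimension costs only a factor `2`, so for `t`
of order `k log n` the exponential wins, whatever the constant. -/
lemma measure_norm_starProjection_noise_gt_le (v : ℝ≥0) (hv : v ≠ 0) (n : ℕ) (θ₀ : ℕ → ℝ)
    (W : Submodule ℝ (EuclideanSpace ℝ (Fin n))) (t : ℝ) :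
    dataLaw v n θ₀ {x | v * t < ‖W.starProjection (noise n θ₀ x)‖ ^ 2}
      ≤ 2 ^ Module.finrank ℝ W * ENNReal.ofReal (Real.exp (-(t / 4))) := by
  have hv' : (0 : ℝ) < v := by positivity
  have hcont := continuous_noise n θ₀
  have hm := mul_meas_ge_le_lintegral₀ (μ := dataLaw v n θ₀)
    (f := fun x => ENNReal.ofReal (Real.exp (‖W.starProjection (noise n θ₀ x)‖ ^ 2 / (4 * v))))
    (by fun_prop) (ENNReal.ofReal (Real.exp (t / 4)))
  have hsub : {x | v * t < ‖W.starProjection (noise n θ₀ x)‖ ^ 2} ⊆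
      {x | ENNReal.ofReal (Real.exp (t / 4)) ≤
        ENNReal.ofReal (Real.exp (‖W.starProjection (noise n θ₀ x)‖ ^ 2 / (4 * v)))} := by
    intro x hx
    refine ENNReal.ofReal_le_ofReal (Real.exp_le_exp.2 ?_)
    rw [le_div_iff₀ (by positivity)]
    simp only [Set.mem_ofPred_eq] at hx
    linarith
  have h2 := (mul_le_mul_right (measure_mono hsub) _).trans
    (hm.trans (lintegral_exp_norm_starProjection_noise_le v hv n θ₀ W))
  rw [Real.exp_neg, ENNReal.ofReal_inv_of_pos (Real.exp_pos _), ← div_eq_mul_inv,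
    ENNReal.le_div_iff_mul_le (Or.inl (by simp [Real.exp_pos])) (Or.inl ENNReal.ofReal_ne_top),
    mul_comm]
  exact h2

/-! ### The likelihood ratio -/

lemma lik_pos (v : ℝ≥0) (hv : v ≠ 0) (n : ℕ) (x : Fin n → ℝ) (θ : ℕ → ℝ) : lik v n x θ ≠ 0 :=
  Finset.prod_ne_zero_iff.2 fun _ _ => (gaussianPDF_pos _ hv _).ne'

lemma lik_ne_top (v : ℝ≥0) (n : ℕ) (x : Fin n → ℝ) (θ : ℕ → ℝ) : lik v n x θ ≠ ∞ :=
  ENNReal.prod_ne_top fun _ _ => gaussianPDF_ne_top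

lemma lik_eq_mul_exp (v : ℝ≥0) (hv : v ≠ 0) (n : ℕ) (x : Fin n → ℝ) (θ θ₀ : ℕ → ℝ) :
    lik v n x θ = lik v n x θ₀ * ENNReal.ofReal (Real.exp
      ((2 * inner ℝ (evalVec n θ - evalVec n θ₀) (noise n θ₀ x)
        - ‖evalVec n θ - evalVec n θ₀‖ ^ 2) / (2 * v))) := by
  have hv' : (0 : ℝ) < v := by positivity
  have e : (2 * inner ℝ (evalVec n θ - evalVec n θ₀) (noise n θ₀ x)
        - ‖evalVec n θ - evalVec n θ₀‖ ^ 2) / (2 * v)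
      = ∑ i, ((x i - regFun θ₀ (design n i)) ^ 2 - (x i - regFun θ (design n i)) ^ 2) / (2 * v) := by
    rw [← Finset.sum_div, EuclideanSpace.norm_sq_eq, PiLp.inner_apply, Finset.mul_sum,
      ← Finset.sum_sub_distrib]
    congr 1
    refine Finset.sum_congr rfl fun i _ => ?_
    simp [noise, evalVec]
    ring
  rw [e, ofReal_exp_sum, lik, lik, ← Finset.prod_mul_distrib]
  refine Finset.prod_congr rfl fun i _ => ?_
  rw [gaussianPDF, gaussianPDF, ← ENNReal.ofReal_mul (gaussianPDFReal_nonneg _ _ _)]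
  congr 1
  simp only [gaussianPDFReal]
  rw [mul_assoc _ (Real.exp _) (Real.exp _), ← Real.exp_add]
  congr 2
  field_simp
  ring

/-- Change of measure, valid without any relation between the two parameters. It is what remains
available at levels that are too large for the comparison of norms. -/
lemma lintegral_lik_div_lik (v : ℝ≥0) (hv : v ≠ 0) (n : ℕ) (θ θ₀ : ℕ → ℝ) :
    ∫⁻ x, lik v n x θ / lik v n x θ₀ ∂(dataLaw v n θ₀) = 1 := by
  have hv' : (0 : ℝ) < v := by positivity
  set d := evalVec n θ - evalVec n θ₀
  have h1 : ∀ x, lik v n x θ / lik v n x θ₀ =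
      ENNReal.ofReal (Real.exp (-(‖d‖ ^ 2 / (2 * v)))) *
        ENNReal.ofReal (Real.exp (inner ℝ ((v : ℝ)⁻¹ • d) (noise n θ₀ x))) := fun x => by
    rw [lik_eq_mul_exp v hv n x θ θ₀, mul_comm, ENNReal.mul_div_cancel_right (lik_pos v hv n x θ₀)
      (lik_ne_top v n x θ₀), ← ENNReal.ofReal_mul (Real.exp_pos _).le, ← Real.exp_add,
      real_inner_smul_left]
    congr 2
    field_simp
    ring
  simp_rw [h1]
  rw [lintegral_const_mul', lintegral_exp_inner_noise, ← ENNReal.ofReal_mul (Real.exp_pos _).le,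
    ← Real.exp_add, norm_smul]
  · rw [show -(‖d‖ ^ 2 / (2 * v)) + v * (‖(v : ℝ)⁻¹‖ * ‖d‖) ^ 2 / 2 = 0 by
      rw [Real.norm_eq_abs, abs_of_pos (by positivity)]; field_simp; ring]
    simp
  · exact ENNReal.ofReal_ne_top

/-! ### The trigonometric basis -/

lemma trigBasis_zero (t : ℝ) : trigBasis 0 t = 1 := by simp [trigBasis]

lemma trigBasis_two_mul_add_one (a : ℕ) (t : ℝ) :
    trigBasis (2 * a + 1) t = √2 * Real.cos (2 * Real.pi * ((a + 1 : ℕ) : ℝ) * t) := by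
  have h1 : (2 * a + 1) % 2 = 1 := by omega
  have h2 : (2 * a + 1 + 1) / 2 = a + 1 := by omega
  rw [trigBasis, if_neg (by omega), if_pos h1, h2]

lemma trigBasis_two_mul_add_two (a : ℕ) (t : ℝ) :
    trigBasis (2 * a + 2) t = √2 * Real.sin (2 * Real.pi * ((a + 1 : ℕ) : ℝ) * t) := by
  have h1 : ¬ (2 * a + 2) % 2 = 1 := by omega
  have h2 : (2 * a + 2) / 2 = a + 1 := by omega
  rw [trigBasis, if_neg (by omega), if_neg h1, h2]

lemma nat_trig_cases (j : ℕ) : j = 0 ∨ (∃ a, j = 2 * a + 1) ∨ ∃ a, j = 2 * a + 2 := by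
  rcases Nat.even_or_odd' j with ⟨a, h | h⟩
  · rcases a with _ | a
    · left; omega
    · right; right; exact ⟨a, by omega⟩
  · right; left; exact ⟨a, h⟩

lemma abs_trigBasis_le (j : ℕ) (t : ℝ) : |trigBasis j t| ≤ √2 := by
  have h2 : (1 : ℝ) ≤ √2 := Real.one_le_sqrt.2 (by norm_num)
  rcases nat_trig_cases j with rfl | ⟨a, rfl⟩ | ⟨a, rfl⟩
  · simp [trigBasis_zero, h2]
  · rw [trigBasis_two_mul_add_one, abs_mul, abs_of_nonneg (Real.sqrt_nonneg 2)]
    exact mul_le_of_le_one_right (Real.sqrt_nonneg 2) (Real.abs_cos_le_one _)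
  · rw [trigBasis_two_mul_add_two, abs_mul, abs_of_nonneg (Real.sqrt_nonneg 2)]
    exact mul_le_of_le_one_right (Real.sqrt_nonneg 2) (Real.abs_sin_le_one _)

lemma continuous_trigBasis (j : ℕ) : Continuous (trigBasis j) := by
  unfold trigBasis
  split_ifs <;> fun_prop

/-- Orthonormality of the trigonometric basis with respect to any finite measure with the same
trigonometric moments of order below `N` as the uniform distribution. -/
lemma integral_trigBasis_mul (μ : Measure ℝ) [IsFiniteMeasure μ] (N : ℕ)
    (hcos : ∀ f : ℤ, |f| < N → ∫ t, Real.cos (2 * Real.pi * f * t) ∂μ = if f = 0 then 1 else 0)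
    (hsin : ∀ f : ℤ, |f| < N → ∫ t, Real.sin (2 * Real.pi * f * t) ∂μ = 0)
    {j l : ℕ} (hj : j + 1 < N) (hl : l + 1 < N) :
    ∫ t, trigBasis j t * trigBasis l t ∂μ = if j = l then 1 else 0 := by
  have ic : ∀ f : ℤ, Integrable (fun t => Real.cos (2 * Real.pi * f * t)) μ := fun f =>
    Integrable.of_bound (by fun_prop) 1 (ae_of_all _ fun t => by
      simpa using Real.abs_cos_le_one _)
  have is : ∀ f : ℤ, Integrable (fun t => Real.sin (2 * Real.pi * f * t)) μ := fun f =>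
    Integrable.of_bound (by fun_prop) 1 (ae_of_all _ fun t => by
      simpa using Real.abs_sin_le_one _)
  have s2 : √2 * √2 = (2 : ℝ) := Real.mul_self_sqrt (by norm_num)
  rcases nat_trig_cases j with rfl | ⟨a, rfl⟩ | ⟨a, rfl⟩ <;>
    rcases nat_trig_cases l with rfl | ⟨b, rfl⟩ | ⟨b, rfl⟩
  · have := hcos 0 (by simp; omega)
    simpa [trigBasis_zero] using this
  · have h := hcos ((b + 1 : ℕ) : ℤ) (by rw [abs_of_nonneg (by positivity)]; omega)
    rw [if_neg (by omega)] at h ⊢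
    simp only [trigBasis_zero, trigBasis_two_mul_add_one, one_mul, integral_const_mul]
    simp only [Int.cast_natCast] at h
    rw [h, mul_zero]
  · have h := hsin ((b + 1 : ℕ) : ℤ) (by rw [abs_of_nonneg (by positivity)]; omega)
    rw [if_neg (by omega)]
    simp only [trigBasis_zero, trigBasis_two_mul_add_two, one_mul, integral_const_mul]
    simp only [Int.cast_natCast] at h
    rw [h, mul_zero]
  · have h := hcos ((a + 1 : ℕ) : ℤ) (by rw [abs_of_nonneg (by positivity)]; omega)
    rw [if_neg (by omega)] at h ⊢
    simp only [trigBasis_zero, trigBasis_two_mul_add_one, mul_one, integral_const_mul]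
    simp only [Int.cast_natCast] at h
    rw [h, mul_zero]
  -- The product formulas reduce this and the remaining cases to the frequencies `a - b` and `a + b
  -- + 2`. The second one is below `N` because `2a + 2` and `2b + 2` both are.
  · have h1 := hcos ((a : ℤ) - b) (by rw [abs_lt]; constructor <;> omega)
    have h2 := hcos ((a : ℤ) + b + 2) (by rw [abs_lt]; constructor <;> omega)
    rw [if_neg (by omega)] at h2
    have e : ∀ t, trigBasis (2 * a + 1) t * trigBasis (2 * b + 1) t
        = Real.cos (2 * Real.pi * ((a : ℤ) - b : ℤ) * t)
          + Real.cos (2 * Real.pi * ((a : ℤ) + b + 2 : ℤ) * t) := fun t => by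
      rw [trigBasis_two_mul_add_one, trigBasis_two_mul_add_one]
      push_cast
      rw [show 2 * Real.pi * ((a : ℝ) - b) * t = 2 * Real.pi * (a + 1) * t
          - 2 * Real.pi * (b + 1) * t by ring, show 2 * Real.pi * ((a : ℝ) + b + 2) * t =
          2 * Real.pi * (a + 1) * t + 2 * Real.pi * (b + 1) * t by ring, Real.cos_add, Real.cos_sub]
      linear_combination (Real.cos (2 * Real.pi * (a + 1) * t)
        * Real.cos (2 * Real.pi * (b + 1) * t)) * s2
    simp_rw [e]
    rw [integral_add (ic _) (ic _), h1, h2, add_zero]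
    congr 1
    simp only [eq_iff_iff]; omega
  · have h1 := hsin ((a : ℤ) - b) (by rw [abs_lt]; constructor <;> omega)
    have h2 := hsin ((a : ℤ) + b + 2) (by rw [abs_lt]; constructor <;> omega)
    have e : ∀ t, trigBasis (2 * a + 1) t * trigBasis (2 * b + 2) t
        = Real.sin (2 * Real.pi * ((a : ℤ) + b + 2 : ℤ) * t)
          - Real.sin (2 * Real.pi * ((a : ℤ) - b : ℤ) * t) := fun t => by
      rw [trigBasis_two_mul_add_one, trigBasis_two_mul_add_two]
      push_cast
      rw [show 2 * Real.pi * ((a : ℝ) - b) * t = 2 * Real.pi * (a + 1) * t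
          - 2 * Real.pi * (b + 1) * t by ring, show 2 * Real.pi * ((a : ℝ) + b + 2) * t =
          2 * Real.pi * (a + 1) * t + 2 * Real.pi * (b + 1) * t by ring, Real.sin_add, Real.sin_sub]
      linear_combination (Real.cos (2 * Real.pi * (a + 1) * t)
        * Real.sin (2 * Real.pi * (b + 1) * t)) * s2
    simp_rw [e]
    rw [integral_sub (is _) (is _), h1, h2, if_neg (by omega), sub_zero]
  · have h := hsin ((a + 1 : ℕ) : ℤ) (by rw [abs_of_nonneg (by positivity)]; omega)
    rw [if_neg (by omega)]
    simp only [trigBasis_zero, trigBasis_two_mul_add_two, mul_one, integral_const_mul]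
    simp only [Int.cast_natCast] at h
    rw [h, mul_zero]
  · have h1 := hsin ((a : ℤ) - b) (by rw [abs_lt]; constructor <;> omega)
    have h2 := hsin ((a : ℤ) + b + 2) (by rw [abs_lt]; constructor <;> omega)
    have e : ∀ t, trigBasis (2 * a + 2) t * trigBasis (2 * b + 1) t
        = Real.sin (2 * Real.pi * ((a : ℤ) + b + 2 : ℤ) * t)
          + Real.sin (2 * Real.pi * ((a : ℤ) - b : ℤ) * t) := fun t => by
      rw [trigBasis_two_mul_add_one, trigBasis_two_mul_add_two]
      push_cast
      rw [show 2 * Real.pi * ((a : ℝ) - b) * t = 2 * Real.pi * (a + 1) * t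
          - 2 * Real.pi * (b + 1) * t by ring, show 2 * Real.pi * ((a : ℝ) + b + 2) * t =
          2 * Real.pi * (a + 1) * t + 2 * Real.pi * (b + 1) * t by ring, Real.sin_add, Real.sin_sub]
      linear_combination (Real.sin (2 * Real.pi * (a + 1) * t)
        * Real.cos (2 * Real.pi * (b + 1) * t)) * s2
    simp_rw [e]
    rw [integral_add (is _) (is _), h1, h2, if_neg (by omega), add_zero]
  · have h1 := hcos ((a : ℤ) - b) (by rw [abs_lt]; constructor <;> omega)
    have h2 := hcos ((a : ℤ) + b + 2) (by rw [abs_lt]; constructor <;> omega)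
    rw [if_neg (by omega)] at h2
    have e : ∀ t, trigBasis (2 * a + 2) t * trigBasis (2 * b + 2) t
        = Real.cos (2 * Real.pi * ((a : ℤ) - b : ℤ) * t)
          - Real.cos (2 * Real.pi * ((a : ℤ) + b + 2 : ℤ) * t) := fun t => by
      rw [trigBasis_two_mul_add_two, trigBasis_two_mul_add_two]
      push_cast
      rw [show 2 * Real.pi * ((a : ℝ) - b) * t = 2 * Real.pi * (a + 1) * t
          - 2 * Real.pi * (b + 1) * t by ring, show 2 * Real.pi * ((a : ℝ) + b + 2) * t =
          2 * Real.pi * (a + 1) * t + 2 * Real.pi * (b + 1) * t by ring, Real.cos_add, Real.cos_sub]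
      linear_combination (Real.sin (2 * Real.pi * (a + 1) * t)
        * Real.sin (2 * Real.pi * (b + 1) * t)) * s2
    simp_rw [e]
    rw [integral_sub (ic _) (ic _), h1, h2, sub_zero]
    congr 1
    simp only [eq_iff_iff]; omega

lemma sum_exp_range (n : ℕ) (hn : n ≠ 0) (f : ℤ) :
    ∑ i ∈ Finset.range n, Complex.exp (2 * Real.pi * Complex.I * f * i / n)
      = if (n : ℤ) ∣ f then (n : ℂ) else 0 := by
  have hn' : (n : ℂ) ≠ 0 := by exact_mod_cast hn
  have hpi : (2 * Real.pi * Complex.I : ℂ) ≠ 0 := Complex.two_pi_I_ne_zero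
  set r := Complex.exp (2 * Real.pi * Complex.I * f / n) with hr
  have e : ∀ i : ℕ, Complex.exp (2 * Real.pi * Complex.I * f * i / n) = r ^ i := fun i => by
    rw [hr, ← Complex.exp_nat_mul]; congr 1; ring
  simp_rw [e]
  have hiff : r = 1 ↔ (n : ℤ) ∣ f := by
    rw [hr, Complex.exp_eq_one_iff]
    constructor
    · rintro ⟨m, hm⟩
      refine ⟨m, ?_⟩
      have : (f : ℂ) = n * m := by
        field_simp at hm
        linear_combination hm
      exact_mod_cast this
    · rintro ⟨m, rfl⟩
      exact ⟨m, by push_cast; field_simp⟩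
  split_ifs with h
  · rw [hiff.2 h]; simp
  · have h1 : r ≠ 1 := fun h' => h (hiff.1 h')
    rw [geom_sum_eq h1]
    have : r ^ n = 1 := by
      rw [hr, ← Complex.exp_nat_mul, Complex.exp_eq_one_iff]
      exact ⟨f, by field_simp⟩
    rw [this]; simp

lemma sum_exp_design (n : ℕ) (hn : n ≠ 0) (f : ℤ) :
    ∑ i, Complex.exp (((2 * Real.pi * f * design n i : ℝ) : ℂ) * Complex.I)
      = if (n : ℤ) ∣ f then (n : ℂ) else 0 := by
  have hn' : (n : ℂ) ≠ 0 := by exact_mod_cast hn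
  have h := sum_exp_range n hn f
  have e : ∀ i : Fin n, Complex.exp (((2 * Real.pi * f * design n i : ℝ) : ℂ) * Complex.I)
      = Complex.exp (2 * Real.pi * Complex.I * f / n)
        * Complex.exp (2 * Real.pi * Complex.I * f * (i : ℕ) / n) := fun i => by
    rw [← Complex.exp_add]
    congr 1
    simp only [design]
    push_cast
    ring
  simp_rw [e]
  rw [← Finset.mul_sum, Fin.sum_univ_eq_sum_range
    (fun i => Complex.exp (2 * Real.pi * Complex.I * f * (i : ℕ) / n)) n, h]
  split_ifs with hd
  · obtain ⟨m, rfl⟩ := hd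
    have : Complex.exp (2 * Real.pi * Complex.I * ((n * m : ℤ) : ℂ) / n) = 1 := by
      rw [Complex.exp_eq_one_iff]
      exact ⟨m, by push_cast; field_simp⟩
    rw [this, one_mul]
  · rw [mul_zero]

lemma sum_cos_design (n : ℕ) (hn : n ≠ 0) (f : ℤ) :
    ∑ i, Real.cos (2 * Real.pi * f * design n i) = if (n : ℤ) ∣ f then (n : ℝ) else 0 := by
  have h := congrArg Complex.re (sum_exp_design n hn f)
  simp only [Complex.re_sum, Complex.exp_ofReal_mul_I_re] at h
  rw [h]; split_ifs <;> simp

lemma sum_sin_design (n : ℕ) (hn : n ≠ 0) (f : ℤ) :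
    ∑ i, Real.sin (2 * Real.pi * f * design n i) = 0 := by
  have h := congrArg Complex.im (sum_exp_design n hn f)
  simp only [Complex.im_sum, Complex.exp_ofReal_mul_I_im] at h
  rw [h]; split_ifs <;> simp

/-- Discrete orthogonality of the first `n - 1` basis functions. -/
lemma sum_trigBasis_design (n : ℕ) {j l : ℕ} (hj : j + 1 < n) (hl : l + 1 < n) :
    ∑ i, trigBasis j (design n i) * trigBasis l (design n i) = if j = l then (n : ℝ) else 0 := by
  have hn : n ≠ 0 := by omega
  have hn' : (n : ℝ) ≠ 0 := by exact_mod_cast hn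
  -- The empirical measure of the design: its trigonometric moments of order below `n` are those of
  -- the uniform distribution, so the general orthonormality lemma applies.
  set μ : Measure ℝ := ∑ i : Fin n, (n : ℝ≥0∞)⁻¹ • Measure.dirac (design n i) with hμ
  have hfin : ∀ i : Fin n, IsFiniteMeasure ((n : ℝ≥0∞)⁻¹ • Measure.dirac (design n i)) := fun i =>
    Measure.smul_finite _ (by simp [hn])
  have hint : ∀ F : ℝ → ℝ, Continuous F → ∫ t, F t ∂μ = (n : ℝ)⁻¹ * ∑ i, F (design n i) := by
    intro F hF
    rw [hμ, integral_finsetSum_measure]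
    · rw [Finset.mul_sum]
      refine Finset.sum_congr rfl fun i _ => ?_
      rw [integral_smul_measure, integral_dirac]
      simp
    · intro i _
      refine Integrable.smul_measure ?_ (by simp [hn])
      exact integrable_dirac (by simp)
  have hμf : IsFiniteMeasure μ := by
    rw [hμ]
    refine ⟨?_⟩
    simp only [Measure.coe_finsetSum, Finset.sum_apply]
    exact ENNReal.sum_lt_top.2 fun i _ => measure_lt_top _ _
  have hdvd : ∀ f : ℤ, |f| < n → ((n : ℤ) ∣ f ↔ f = 0) := fun f hf =>
    ⟨fun h => Int.eq_zero_of_abs_lt_dvd h hf, fun h => h ▸ dvd_zero _⟩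
  have h := integral_trigBasis_mul μ n
    (fun f hf => by
      rw [hint _ (by fun_prop), sum_cos_design n hn]
      simp only [hdvd f hf]
      split_ifs <;> simp [hn'])
    (fun f hf => by
      rw [hint _ (by fun_prop), sum_sin_design n hn, mul_zero]) hj hl
  rw [hint (fun t => trigBasis j t * trigBasis l t)
    ((continuous_trigBasis j).mul (continuous_trigBasis l))] at h
  rw [inv_mul_eq_iff_eq_mul₀ hn'] at h
  rw [h]; split_ifs <;> simp

lemma integral_trigBasis_mul_unitInterval (j l : ℕ) :
    ∫ t in (0 : ℝ)..1, trigBasis j t * trigBasis l t = if j = l then 1 else 0 := by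
  rw [intervalIntegral.integral_of_le zero_le_one]
  refine integral_trigBasis_mul (volume.restrict (Set.Ioc 0 1)) (j + l + 2) (fun f _ => ?_)
    (fun f _ => ?_) (by omega) (by omega)
  · rw [← intervalIntegral.integral_of_le zero_le_one]
    split_ifs with h
    · simp [h]
    · have hc : (2 * Real.pi * f : ℝ) ≠ 0 := by
        have : (f : ℝ) ≠ 0 := by exact_mod_cast h
        positivity
      rw [intervalIntegral.integral_comp_mul_left (fun t => Real.cos t) hc, integral_cos]
      have : Real.sin (2 * Real.pi * f * 1) = 0 := by
        have := Real.sin_int_mul_pi (2 * f)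
        push_cast at this
        rw [← this]; congr 1; ring
      rw [this]; simp
  · rw [← intervalIntegral.integral_of_le zero_le_one]
    by_cases h : f = 0
    · simp [h]
    · have hc : (2 * Real.pi * f : ℝ) ≠ 0 := by
        have : (f : ℝ) ≠ 0 := by exact_mod_cast h
        positivity
      rw [intervalIntegral.integral_comp_mul_left (fun t => Real.sin t) hc, integral_sin]
      have : Real.cos (2 * Real.pi * f * 1) = 1 := by
        rw [show 2 * Real.pi * f * 1 = f * (2 * Real.pi) by ring, Real.cos_int_mul_two_pi]
      rw [this]; simp

/-! ### Functions with absolutely summable coefficients -/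

lemma summable_mul_trigBasis {c : ℕ → ℝ} (hc : Summable fun j => |c j|) (t : ℝ) :
    Summable fun j => c j * trigBasis j t :=
  Summable.of_norm_bounded (hc.mul_right √2) fun j => by
    rw [Real.norm_eq_abs, abs_mul]
    exact mul_le_mul_of_nonneg_left (abs_trigBasis_le j t) (abs_nonneg _)

lemma summable_sq_of_summable_abs {c : ℕ → ℝ} (hc : Summable fun j => |c j|) :
    Summable fun j => c j ^ 2 := by
  refine Summable.of_nonneg_of_le (fun j => sq_nonneg _) (fun j => ?_) (hc.mul_right (∑' j, |c j|))
  rw [← sq_abs, sq]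
  exact mul_le_mul_of_nonneg_left (hc.le_tsum j fun _ _ => abs_nonneg _) (abs_nonneg _)

lemma summable_abs_of_eventually_zero {c : ℕ → ℝ} {k : ℕ} (hc : ∀ j, k ≤ j → c j = 0) :
    Summable fun j => |c j| :=
  summable_of_ne_finset_zero (s := Finset.range k) fun j hj => by
    rw [hc j (by simpa using hj), abs_zero]

lemma summable_abs_sub {a b : ℕ → ℝ} (ha : Summable fun j => |a j|) (hb : Summable fun j => |b j|) :
    Summable fun j => |(a - b) j| :=
  Summable.of_nonneg_of_le (fun _ => abs_nonneg _) (fun j => abs_sub (a j) (b j)) (ha.add hb)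

lemma regFun_sub {a b : ℕ → ℝ} (ha : Summable fun j => |a j|) (hb : Summable fun j => |b j|)
    (t : ℝ) : regFun (a - b) t = regFun a t - regFun b t := by
  rw [regFun, regFun, regFun, ← (summable_mul_trigBasis ha t).tsum_sub (summable_mul_trigBasis hb t)]
  simp [sub_mul]

lemma evalVec_sub {a b : ℕ → ℝ} (ha : Summable fun j => |a j|) (hb : Summable fun j => |b j|)
    (n : ℕ) : evalVec n (a - b) = evalVec n a - evalVec n b := by
  ext i
  simp [evalVec, regFun_sub ha hb]

lemma continuous_regFun {c : ℕ → ℝ} (hc : Summable fun j => |c j|) : Continuous (regFun c) :=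
  continuous_tsum (fun j => continuous_const.mul (continuous_trigBasis j)) (hc.mul_right √2)
    fun j t => by
      rw [Real.norm_eq_abs, abs_mul]
      exact mul_le_mul_of_nonneg_left (abs_trigBasis_le j t) (abs_nonneg _)

lemma abs_regFun_le {c : ℕ → ℝ} (hc : Summable fun j => |c j|) (t : ℝ) :
    |regFun c t| ≤ ∑' j, |c j| * √2 :=
  tsum_of_norm_bounded (f := fun j => c j * trigBasis j t) (hc.mul_right √2).hasSum fun j => by
    rw [Real.norm_eq_abs, abs_mul]
    exact mul_le_mul_of_nonneg_left (abs_trigBasis_le j t) (abs_nonneg _)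

lemma integral_mul_regFun {c : ℕ → ℝ} (hc : Summable fun j => |c j|) {h : ℝ → ℝ}
    (hh : Continuous h) {C : ℝ} (hC : ∀ t, |h t| ≤ C) :
    ∫ t in (0 : ℝ)..1, h t * regFun c t
      = ∑' j, c j * ∫ t in (0 : ℝ)..1, h t * trigBasis j t := by
  simp_rw [intervalIntegral.integral_of_le (zero_le_one' ℝ)]
  set μ : Measure ℝ := volume.restrict (Set.Ioc 0 1)
  have hμ : μ.real Set.univ = 1 := by simp [μ, Measure.real]
  have hb : ∀ j t, ‖c j * (h t * trigBasis j t)‖ ≤ |c j| * (C * √2) := fun j t => by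
    rw [Real.norm_eq_abs, abs_mul, abs_mul]
    exact mul_le_mul_of_nonneg_left (mul_le_mul (hC t) (abs_trigBasis_le j t) (abs_nonneg _)
      ((abs_nonneg _).trans (hC t))) (abs_nonneg _)
  have hI : ∀ j, Integrable (fun t => c j * (h t * trigBasis j t)) μ := fun j =>
    Integrable.of_bound (by have := continuous_trigBasis j; fun_prop) _ (ae_of_all _ (hb j))
  have key := integral_tsum_of_summable_integral_norm hI (by
    refine Summable.of_nonneg_of_le (fun j => integral_nonneg fun t => norm_nonneg _) (fun j => ?_)
      (hc.mul_right (C * √2))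
    calc ∫ t, ‖c j * (h t * trigBasis j t)‖ ∂μ ≤ ∫ _t, |c j| * (C * √2) ∂μ :=
          integral_mono (hI j).norm (integrable_const _) (hb j)
      _ = |c j| * (C * √2) := by rw [integral_const, hμ, one_smul])
  simp_rw [integral_const_mul] at key
  rw [key]
  congr 1
  ext t
  rw [regFun, ← (summable_mul_trigBasis hc t).tsum_mul_left]
  congr 1; ext j; ring

/-- Parseval's identity. Absolute summability permits integrating termwise twice, so orthonormality
is enough and completeness of the basis plays no role. -/
lemma integral_regFun_sq {c : ℕ → ℝ} (hc : Summable fun j => |c j|) :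
    ∫ t in (0 : ℝ)..1, regFun c t ^ 2 = ∑' j, c j ^ 2 := by
  simp_rw [sq]
  rw [integral_mul_regFun hc (continuous_regFun hc) (abs_regFun_le hc)]
  congr 1
  ext j
  congr 1
  have h := integral_mul_regFun hc (continuous_trigBasis j) (abs_trigBasis_le j)
  simp_rw [integral_trigBasis_mul_unitInterval] at h
  simp_rw [mul_comm (regFun c _), h]
  simp

lemma funDist_eq_seqDist {a b : ℕ → ℝ} (ha : Summable fun j => |a j|)
    (hb : Summable fun j => |b j|) : funDist a b = seqDist a b := by
  rw [funDist, seqDist]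
  simp_rw [← regFun_sub ha hb]
  rw [integral_regFun_sq (summable_abs_sub ha hb)]
  simp

lemma seqDist_comm (a b : ℕ → ℝ) : seqDist a b = seqDist b a := by
  rw [seqDist, seqDist]; congr 2; ext j; ring

/-! ### Sequences supported on the first coordinates -/

lemma extendZero_of_lt {k j : ℕ} (u : Fin k → ℝ) (h : j < k) : extendZero k u j = u ⟨j, h⟩ := by
  simp [extendZero, h]

lemma extendZero_of_le {k j : ℕ} (u : Fin k → ℝ) (h : k ≤ j) : extendZero k u j = 0 := by
  simp [extendZero, not_lt.2 h]

lemma regFun_eq_sum {c : ℕ → ℝ} {k : ℕ} (hc : ∀ j, k ≤ j → c j = 0) (t : ℝ) :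
    regFun c t = ∑ j ∈ Finset.range k, c j * trigBasis j t :=
  tsum_eq_sum fun j hj => by rw [hc j (by simpa using hj), zero_mul]

lemma norm_evalVec_sq (n : ℕ) (c : ℕ → ℝ) :
    ‖evalVec n c‖ ^ 2 = ∑ i, regFun c (design n i) ^ 2 := by
  rw [EuclideanSpace.norm_sq_eq]
  simp [evalVec]

/-- The discrete Parseval identity. The restriction to the first `n - 1` functions is sharp: for
even `n` the next one equals `±√2` at all design points, and its squared norm is `2n`. -/
lemma norm_evalVec_sq_of_support {n : ℕ} {c : ℕ → ℝ} (hc : ∀ j, n ≤ j + 1 → c j = 0) :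
    ‖evalVec n c‖ ^ 2 = n * ∑' j, c j ^ 2 := by
  have hc' : ∀ j, n - 1 ≤ j → c j = 0 := fun j hj => hc j (by omega)
  rw [norm_evalVec_sq, tsum_eq_sum (s := Finset.range (n - 1))
    fun j hj => by rw [hc' j (by simpa using hj)]; norm_num]
  simp_rw [regFun_eq_sum hc', sq, Finset.sum_mul_sum]
  rw [Finset.sum_comm, Finset.mul_sum]
  refine Finset.sum_congr rfl fun j hj => ?_
  rw [Finset.sum_comm]
  calc ∑ l ∈ Finset.range (n - 1), ∑ i, c j * trigBasis j (design n i) *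
        (c l * trigBasis l (design n i))
      = ∑ l ∈ Finset.range (n - 1), c j * c l * (if j = l then (n : ℝ) else 0) := by
        refine Finset.sum_congr rfl fun l hl => ?_
        rw [← sum_trigBasis_design n (by have := Finset.mem_range.1 hj; omega)
          (by have := Finset.mem_range.1 hl; omega), Finset.mul_sum]
        refine Finset.sum_congr rfl fun i _ => by ring
    _ = n * (c j * c j) := by
        simp only [mul_ite, mul_zero, Finset.sum_ite_eq, hj, if_true]; ring

/-! ### The aliasing error at the design points -/

/-- The shifted trigonometric system, in which cosines have even and sines odd indices. -/
def shiftedTrig (m : ℕ) (t : ℝ) : ℝ :=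
  if m % 2 = 0 then √2 * Real.cos (2 * Real.pi * ((m / 2 : ℕ) : ℝ) * t)
  else √2 * Real.sin (2 * Real.pi * ((m / 2 : ℕ) : ℝ) * t)

lemma shiftedTrig_succ {j : ℕ} (hj : j ≠ 0) (t : ℝ) : shiftedTrig (j + 1) t = trigBasis j t := by
  rcases nat_trig_cases j with rfl | ⟨a, rfl⟩ | ⟨a, rfl⟩
  · exact absurd rfl hj
  · rw [trigBasis_two_mul_add_one, shiftedTrig, if_pos (by omega),
      show (2 * a + 1 + 1) / 2 = a + 1 by omega]
  · rw [trigBasis_two_mul_add_two, shiftedTrig, if_neg (by omega),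
      show (2 * a + 2 + 1) / 2 = a + 1 by omega]

/-- A shift of the index by `2nq` raises the frequency by `nq`, which is invisible at points `i /
n`. The shifted numbering makes this aliasing an exact periodicity of the index. -/
lemma shiftedTrig_periodic {n : ℕ} (m q : ℕ) (i : Fin n) :
    shiftedTrig (2 * n * q + m) (design n i) = shiftedTrig m (design n i) := by
  have hn : (n : ℝ) ≠ 0 := by
    have := i.pos
    positivity
  have h1 : (2 * n * q + m) % 2 = m % 2 := by rw [mul_assoc]; omega
  have h2 : (2 * n * q + m) / 2 = n * q + m / 2 := by rw [mul_assoc]; omega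
  have h3 : 2 * Real.pi * ((n * q + m / 2 : ℕ) : ℝ) * design n i
      = 2 * Real.pi * ((m / 2 : ℕ) : ℝ) * design n i
        + ((q * (i + 1) : ℕ) : ℝ) * (2 * Real.pi) := by
    simp only [design, Nat.cast_add, Nat.cast_mul, Nat.cast_one]
    field_simp
    ring
  rw [shiftedTrig, shiftedTrig, h1, h2, h3, Real.cos_add_nat_mul_two_pi,
    Real.sin_add_nat_mul_two_pi]

lemma sum_range_two_mul (F : ℕ → ℝ) (n : ℕ) :
    ∑ s ∈ Finset.range (2 * n), F s = ∑ f ∈ Finset.range n, (F (2 * f) + F (2 * f + 1)) := by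
  induction n with
  | zero => simp
  | succ n ih =>
    rw [show 2 * (n + 1) = 2 * n + 1 + 1 by ring, Finset.sum_range_succ, Finset.sum_range_succ, ih,
      Finset.sum_range_succ, add_assoc]

lemma sum_cos_frequencies {n : ℕ} (i l : Fin n) :
    ∑ f ∈ Finset.range n, Real.cos (2 * Real.pi * f * design n i - 2 * Real.pi * f * design n l)
      = if i = l then (n : ℝ) else 0 := by
  have hn : n ≠ 0 := i.pos.ne'
  have h := congrArg Complex.re (sum_exp_range n hn ((i : ℤ) - l))
  have e : ∀ f : ℕ, (Complex.exp (2 * Real.pi * Complex.I * ((i : ℤ) - l : ℤ) * f / n)).re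
      = Real.cos (2 * Real.pi * f * design n i - 2 * Real.pi * f * design n l) := fun f => by
    rw [← Complex.exp_ofReal_mul_I_re]
    congr 2
    simp only [design]
    push_cast
    ring
  simp only [Complex.re_sum, e] at h
  rw [h]
  have hd : ((n : ℤ) ∣ (i : ℤ) - l) ↔ i = l := by
    constructor
    · intro hd
      have := Int.eq_zero_of_abs_lt_dvd hd (by rw [abs_lt]; constructor <;> omega)
      ext; omega
    · rintro rfl; simp
  simp only [hd]
  split_ifs <;> simp

/-- One full period of the shifted system is a tight frame of `ℝⁿ`: cosine and sine of the same
frequency combine to the cosine of a difference, and the sum over frequencies leaves only the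
diagonal. -/
lemma sum_sq_shiftedTrig {n : ℕ} (w : Fin n → ℝ) :
    ∑ s ∈ Finset.range (2 * n), (∑ i, w i * shiftedTrig s (design n i)) ^ 2
      = 2 * n * ∑ i, w i ^ 2 := by
  have s2 : √2 * √2 = (2 : ℝ) := Real.mul_self_sqrt (by norm_num)
  rw [sum_range_two_mul]
  have e : ∀ f : ℕ, (∑ i, w i * shiftedTrig (2 * f) (design n i)) ^ 2
      + (∑ i, w i * shiftedTrig (2 * f + 1) (design n i)) ^ 2
      = ∑ i, ∑ l, 2 * (w i * w l) * Real.cos (2 * Real.pi * f * design n i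
        - 2 * Real.pi * f * design n l) := fun f => by
    rw [sq, sq, Finset.sum_mul_sum, Finset.sum_mul_sum, ← Finset.sum_add_distrib]
    refine Finset.sum_congr rfl fun i _ => ?_
    rw [← Finset.sum_add_distrib]
    refine Finset.sum_congr rfl fun l _ => ?_
    simp only [shiftedTrig]
    rw [if_pos (by omega), if_pos (by omega), if_neg (by omega), if_neg (by omega),
      show 2 * f / 2 = f by omega, show (2 * f + 1) / 2 = f by omega, Real.cos_sub]
    linear_combination (w i * w l * (Real.cos (2 * Real.pi * f * design n i)
      * Real.cos (2 * Real.pi * f * design n l) + Real.sin (2 * Real.pi * f * design n i)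
      * Real.sin (2 * Real.pi * f * design n l))) * s2
  simp_rw [e]
  rw [Finset.sum_comm, Finset.mul_sum]
  refine Finset.sum_congr rfl fun i _ => ?_
  rw [Finset.sum_comm]
  simp_rw [← Finset.mul_sum, sum_cos_frequencies]
  simp
  ring

/-- The indices are cut into blocks of length `2n`. On block `q` the weight is at most `(q+1)^(-2γ)
/ n`, and the tight frame contributes `2n ‖w‖²`, so the powers of `n` cancel. -/
lemma sum_weighted_sq_shiftedTrig_le {n : ℕ} (hn : n ≠ 0) {γ : ℝ} (hγ : 1 / 2 < γ) (w : Fin n → ℝ)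
    (M : ℕ) :
    ∑ m ∈ Finset.range M, (if n ≤ m then (m : ℝ) ^ (-(2 * γ)) *
        (∑ i, w i * shiftedTrig m (design n i)) ^ 2 else 0)
      ≤ 2 * (∑' q : ℕ, ((q : ℝ) + 1) ^ (-(2 * γ))) * ∑ i, w i ^ 2 := by
  have hn1 : (1 : ℝ) ≤ n := by exact_mod_cast Nat.one_le_iff_ne_zero.2 hn
  set G : ℕ → ℝ := fun m => if n ≤ m then (m : ℝ) ^ (-(2 * γ)) *
        (∑ i, w i * shiftedTrig m (design n i)) ^ 2 else 0 with hG
  have hG0 : ∀ m, 0 ≤ G m := fun m => by simp only [hG]; split_ifs <;> positivity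
  have hsum : Summable fun q : ℕ => ((q : ℝ) + 1) ^ (-(2 * γ)) := by
    have := (summable_nat_add_iff 1).2 (Real.summable_nat_rpow (p := -(2 * γ)) |>.2 (by linarith))
    simpa using this
  have hblock : ∀ q : ℕ, ∑ s ∈ Finset.range (2 * n), G (2 * n * q + s)
      ≤ ((q : ℝ) + 1) ^ (-(2 * γ)) * (2 * ∑ i, w i ^ 2) := fun q => by
    calc ∑ s ∈ Finset.range (2 * n), G (2 * n * q + s)
        ≤ ∑ s ∈ Finset.range (2 * n), ((q : ℝ) + 1) ^ (-(2 * γ)) * (n : ℝ)⁻¹ *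
            (∑ i, w i * shiftedTrig s (design n i)) ^ 2 := by
          refine Finset.sum_le_sum fun s _ => ?_
          simp only [hG, shiftedTrig_periodic]
          split_ifs with h
          · refine mul_le_mul_of_nonneg_right ?_ (sq_nonneg _)
            have h1 : ((q : ℝ) + 1) * n ≤ ((2 * n * q + s : ℕ) : ℝ) := by
              -- In block `0` this is the restriction `n ≤ m`; in the later blocks it follows from
              -- `q + 1 ≤ 2q`.
              have : (q + 1) * n ≤ 2 * n * q + s := by
                rcases q with _ | q
                · omega
                · nlinarith
              exact_mod_cast this
            calc ((2 * n * q + s : ℕ) : ℝ) ^ (-(2 * γ)) ≤ (((q : ℝ) + 1) * n) ^ (-(2 * γ)) :=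
                  Real.rpow_le_rpow_of_nonpos (by positivity) h1 (by linarith)
              _ = ((q : ℝ) + 1) ^ (-(2 * γ)) * (n : ℝ) ^ (-(2 * γ)) :=
                  Real.mul_rpow (by positivity) (by positivity)
              _ ≤ _ := by
                  refine mul_le_mul_of_nonneg_left ?_ (by positivity)
                  rw [← Real.rpow_neg_one]
                  exact Real.rpow_le_rpow_of_exponent_le hn1 (by linarith)
          · positivity
      _ = _ := by
          rw [← Finset.mul_sum, sum_sq_shiftedTrig]
          field_simp
  have hQ : ∀ Q : ℕ, ∑ m ∈ Finset.range (2 * n * Q), G m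
      ≤ ∑ q ∈ Finset.range Q, ((q : ℝ) + 1) ^ (-(2 * γ)) * (2 * ∑ i, w i ^ 2) := fun Q => by
    induction Q with
    | zero => simp
    | succ Q ih =>
      rw [Nat.mul_succ, Finset.sum_range_add, Finset.sum_range_succ]
      exact add_le_add ih (hblock Q)
  have hw : 0 ≤ ∑ i, w i ^ 2 := by positivity
  calc ∑ m ∈ Finset.range M, G m ≤ ∑ m ∈ Finset.range (2 * n * M), G m := by
        refine Finset.sum_le_sum_of_subset_of_nonneg (Finset.range_mono ?_) fun m _ _ => hG0 m
        nlinarith [Nat.one_le_iff_ne_zero.2 hn]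
    _ ≤ _ := hQ M
    _ = (∑ q ∈ Finset.range M, ((q : ℝ) + 1) ^ (-(2 * γ))) * (2 * ∑ i, w i ^ 2) := by
        rw [Finset.sum_mul]
    _ ≤ (∑' q : ℕ, ((q : ℝ) + 1) ^ (-(2 * γ))) * (2 * ∑ i, w i ^ 2) :=
        mul_le_mul_of_nonneg_right (hsum.sum_le_tsum _ fun q _ => by positivity) (by positivity)
    _ = _ := by ring

/-- The part of a sequence that is not identifiable from `n` design points. -/
def tailSeq (n : ℕ) (θ : ℕ → ℝ) : ℕ → ℝ := fun j => if n ≤ j + 1 then θ j else 0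

lemma summable_abs_tailSeq {θ : ℕ → ℝ} (h : Summable fun j => |θ j|) (n : ℕ) :
    Summable fun j => |tailSeq n θ j| :=
  Summable.of_nonneg_of_le (fun _ => abs_nonneg _) (fun j => by
    simp only [tailSeq]; split_ifs <;> simp) h

/-- Aliasing costs only a constant. A pointwise bound of the tail function would give `n^(2-2γ)`,
which need not be bounded. Instead the vector `w` of its values is tested against itself: `‖w‖²` is
the sum of the tail coefficients times the correlations of `w` with the basis functions. Weighted
Cauchy-Schwarz together with the block bound gives `‖w‖² ≤ Z L + ‖w‖² / 2`. -/
lemma norm_evalVec_tailSeq_sq_le {n : ℕ} (hn : 2 ≤ n) {γ : ℝ} (hγ : 1 / 2 < γ) {L : ℝ}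
    {θ : ℕ → ℝ} (habs : Summable fun j => |θ j|) (hθ : θ ∈ sobolev γ L) :
    ‖evalVec n (tailSeq n θ)‖ ^ 2 ≤ 2 * (∑' q : ℕ, ((q : ℝ) + 1) ^ (-(2 * γ))) * L := by
  set w : Fin n → ℝ := fun i => regFun (tailSeq n θ) (design n i) with hw
  set Z := ∑' q : ℕ, ((q : ℝ) + 1) ^ (-(2 * γ)) with hZ
  have hsum : Summable fun q : ℕ => ((q : ℝ) + 1) ^ (-(2 * γ)) := by
    have := (summable_nat_add_iff 1).2 (Real.summable_nat_rpow (p := -(2 * γ)) |>.2 (by linarith))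
    simpa using this
  have hZ1 : 1 ≤ Z := by
    have := hsum.le_tsum 0 fun q _ => by positivity
    simpa using this
  set τ := tailSeq n θ with hτ
  have hτs := summable_abs_tailSeq habs n
  set P : ℕ → ℝ := fun m => ∑ i, w i * shiftedTrig m (design n i) with hP
  have h1 : HasSum (fun j => τ j * P (j + 1)) (∑ i, w i ^ 2) := by
    have h2 : HasSum (fun j => ∑ i, w i * (τ j * trigBasis j (design n i)))
        (∑ i, w i * regFun τ (design n i)) :=
      hasSum_sum fun i _ => ((summable_mul_trigBasis hτs (design n i)).hasSum).mul_left _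
    convert! h2 using 1
    · ext j
      by_cases hj : n ≤ j + 1
      · rw [hP, Finset.mul_sum]
        refine Finset.sum_congr rfl fun i _ => ?_
        rw [shiftedTrig_succ (by omega)]; ring
      · have : τ j = 0 := by rw [hτ, tailSeq, if_neg hj]
        simp [this]
    · refine Finset.sum_congr rfl fun i _ => ?_
      rw [sq]
  rw [norm_evalVec_sq]
  have hpart : ∀ M, ∑ j ∈ Finset.range M, τ j * P (j + 1) ≤ Z * L + (∑ i, w i ^ 2) / 2 := fun M => by
    have hG := sum_weighted_sq_shiftedTrig_le (n := n) (by omega) hγ w (M + 1)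
    rw [Finset.sum_range_succ', if_neg (by omega), add_zero] at hG
    have hS : ∑ j ∈ Finset.range M, ((j : ℝ) + 1) ^ (2 * γ) * θ j ^ 2 ≤ L :=
      (hθ.1.sum_le_tsum _ fun j _ => by positivity).trans hθ.2
    calc ∑ j ∈ Finset.range M, τ j * P (j + 1)
        -- Young's inequality; the weight `(4Z)⁻¹` is chosen such that the block bound `2Z ‖w‖²`
        -- becomes `‖w‖² / 2`, which can be absorbed.
        ≤ ∑ j ∈ Finset.range M, (Z * (((j : ℝ) + 1) ^ (2 * γ) * θ j ^ 2) + (4 * Z)⁻¹ *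
          (if n ≤ j + 1 then ((j + 1 : ℕ) : ℝ) ^ (-(2 * γ)) * P (j + 1) ^ 2 else 0)) := by
          refine Finset.sum_le_sum fun j _ => ?_
          by_cases hj : n ≤ j + 1
          · rw [if_pos hj, hτ, tailSeq, if_pos hj]
            have hx : 0 < ((j : ℝ) + 1) ^ (2 * γ) := by positivity
            rw [Nat.cast_add_one, Real.rpow_neg (by positivity)]
            set X := ((j : ℝ) + 1) ^ (2 * γ)
            have : 0 ≤ (4 * Z * X)⁻¹ * (2 * Z * X * θ j - P (j + 1)) ^ 2 := by positivity
            have e : (4 * Z * X)⁻¹ * (2 * Z * X * θ j - P (j + 1)) ^ 2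
              = Z * (X * θ j ^ 2) + (4 * Z)⁻¹ * (X⁻¹ * P (j + 1) ^ 2) - θ j * P (j + 1) := by
              field_simp
              ring
            linarith
          · have : τ j = 0 := by rw [hτ, tailSeq, if_neg hj]
            rw [this, if_neg hj]
            simp only [zero_mul, mul_zero, add_zero]
            positivity
      _ = Z * (∑ j ∈ Finset.range M, ((j : ℝ) + 1) ^ (2 * γ) * θ j ^ 2) + (4 * Z)⁻¹ *
          ∑ j ∈ Finset.range M, (if n ≤ j + 1 then ((j + 1 : ℕ) : ℝ) ^ (-(2 * γ)) * P (j + 1) ^ 2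
            else 0) := by
          rw [Finset.sum_add_distrib, Finset.mul_sum, Finset.mul_sum]
      _ ≤ Z * L + (4 * Z)⁻¹ * (2 * Z * ∑ i, w i ^ 2) := by gcongr
      _ = _ := by field_simp; ring
  have := le_of_tendsto' h1.tendsto_sum_nat hpart
  linarith

/-! ### Comparison of the empirical and the `ℓ₂` distance -/

/-- The properties of the true sequence that are used for a fixed sample size. -/
structure IsRegular (B A : ℝ) (n : ℕ) (θ : ℕ → ℝ) : Prop where
  bdd : ∀ j, |θ j| ≤ B
  summable : Summable fun j => |θ j|
  dist : ∀ k < n, ∀ u : Fin k → ℝ,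
    |‖evalVec n (extendZero k u) - evalVec n θ‖ - √n * seqDist (extendZero k u) θ| ≤ A

lemma summable_abs_extendZero {k : ℕ} (u : Fin k → ℝ) : Summable fun j => |extendZero k u j| :=
  summable_abs_of_eventually_zero fun _ hj => extendZero_of_le u hj

lemma IsRegular.funDist_eq {B A : ℝ} {n : ℕ} {θ : ℕ → ℝ} (h : IsRegular B A n θ) {k : ℕ}
    (u : Fin k → ℝ) : funDist θ (extendZero k u) = seqDist (extendZero k u) θ := by
  rw [funDist_eq_seqDist h.summable (summable_abs_extendZero u), seqDist_comm]

/-- Let `c` be the difference without its unidentifiable tail `τ`. The discrete Parseval identity is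
exact for `c`, and the squared `ℓ₂` distance is `‖c‖² + ‖τ‖²`. Both norms thus differ from `√n ‖c‖`
by a contribution of `τ` only. -/
lemma abs_norm_sub_seqDist_le {n k : ℕ} (hk : k < n) {θ : ℕ → ℝ} (h : Summable fun j => |θ j|)
    (u : Fin k → ℝ) :
    |‖evalVec n (extendZero k u) - evalVec n θ‖ - √n * seqDist (extendZero k u) θ|
      ≤ ‖evalVec n (tailSeq n θ)‖ + √n * √(∑' j, tailSeq n θ j ^ 2) := by
  set τ := tailSeq n θ with hτ
  have hτs := summable_abs_tailSeq h n
  set c : ℕ → ℝ := extendZero k u - (θ - τ) with hc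
  have hcs : Summable fun j => |c j| :=
    summable_abs_sub (summable_abs_extendZero u) (summable_abs_sub h hτs)
  have hc0 : ∀ j, n ≤ j + 1 → c j = 0 := fun j hj => by
    simp [hc, hτ, tailSeq, hj, extendZero_of_le u (show k ≤ j by omega)]
  have e1 : evalVec n (extendZero k u) - evalVec n θ = evalVec n c - evalVec n τ := by
    rw [hc, evalVec_sub (summable_abs_extendZero u) (summable_abs_sub h hτs), evalVec_sub h hτs]
    abel
  have e2 : ‖evalVec n c‖ = √n * √(∑' j, c j ^ 2) := by
    rw [← Real.sqrt_mul (by positivity), ← norm_evalVec_sq_of_support hc0,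
      Real.sqrt_sq (norm_nonneg _)]
  have e3 : seqDist (extendZero k u) θ = √(∑' j, c j ^ 2 + ∑' j, τ j ^ 2) := by
    rw [seqDist, ← (summable_sq_of_summable_abs hcs).tsum_add (summable_sq_of_summable_abs hτs)]
    congr 2
    ext j
    by_cases hj : n ≤ j + 1
    · rw [hc0 j hj, extendZero_of_le u (show k ≤ j by omega), tailSeq, if_pos hj]
      ring
    · have : τ j = 0 := by rw [hτ, tailSeq, if_neg hj]
      simp [hc, this, tailSeq, hj]
  have hx : 0 ≤ ∑' j, c j ^ 2 := tsum_nonneg fun j => sq_nonneg _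
  have hy : 0 ≤ ∑' j, τ j ^ 2 := tsum_nonneg fun j => sq_nonneg _
  have h4 : √(∑' j, c j ^ 2 + ∑' j, τ j ^ 2) ≤ √(∑' j, c j ^ 2) + √(∑' j, τ j ^ 2) :=
by
    refine Real.sqrt_le_iff.2 ⟨by positivity, ?_⟩
    nlinarith [Real.sq_sqrt hx, Real.sq_sqrt hy, Real.sqrt_nonneg (∑' j, c j ^ 2),
      Real.sqrt_nonneg (∑' j, τ j ^ 2)]
  have h5 : √(∑' j, c j ^ 2) ≤ √(∑' j, c j ^ 2 + ∑' j, τ j ^ 2) := Real.sqrt_le_sqrt (by linarith)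
  have h6 : |‖evalVec n c - evalVec n τ‖ - ‖evalVec n c‖| ≤ ‖evalVec n τ‖ := by
    refine (abs_norm_sub_norm_le _ _).trans ?_
    rw [sub_sub_cancel_left, norm_neg]
  rw [e1, e3]
  rw [e2] at h6
  have hs : 0 ≤ √(n : ℝ) := Real.sqrt_nonneg _
  have h7 := mul_le_mul_of_nonneg_left h4 hs
  have h8 := mul_le_mul_of_nonneg_left h5 hs
  rw [abs_le] at h6 ⊢
  constructor <;> nlinarith [h6.1, h6.2, norm_nonneg (evalVec n τ),
    mul_nonneg hs (Real.sqrt_nonneg (∑' j, τ j ^ 2))]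

/-! ### The smoothness classes -/

lemma abs_truth_le (proj : Prop) (n : ℕ) (θ : ℕ → ℝ) (j : ℕ) : |truth proj n θ j| ≤ |θ j| := by
  unfold truth; split_ifs <;> simp

lemma sq_truth_le (proj : Prop) (n : ℕ) (θ : ℕ → ℝ) (j : ℕ) : truth proj n θ j ^ 2 ≤ θ j ^ 2 :=
  sq_le_sq.2 (abs_truth_le proj n θ j)

lemma truth_mem {β L : ℝ} {θ : ℕ → ℝ} (proj : Prop) (n : ℕ)
    (hθ : θ ∈ hyperrect β L ∪ sobolev β L) :
    truth proj n θ ∈ hyperrect β L ∪ sobolev β L := by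
  have h : ∀ (p : ℝ) (j : ℕ), ((j : ℝ) + 1) ^ p * truth proj n θ j ^ 2 ≤ ((j : ℝ) + 1) ^ p * θ j ^ 2 :=
    fun p j => mul_le_mul_of_nonneg_left (sq_truth_le proj n θ j) (by positivity)
  rcases hθ with hθ | hθ
  · exact Or.inl fun j => (h _ j).trans (hθ j)
  · have hs := Summable.of_nonneg_of_le (fun j => by positivity) (h (2 * β)) hθ.1
    exact Or.inr ⟨hs, (hs.tsum_le_tsum (h _) hθ.1).trans hθ.2⟩

lemma one_le_cast_add_one_rpow (j : ℕ) {p : ℝ} (hp : 0 ≤ p) : 1 ≤ ((j : ℝ) + 1) ^ p :=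
  Real.one_le_rpow (by linarith [Nat.cast_nonneg (α := ℝ) j]) hp

lemma abs_le_sqrt_of_mem {β L : ℝ} (hβ : 0 < β) {θ : ℕ → ℝ}
    (hθ : θ ∈ hyperrect β L ∪ sobolev β L) (j : ℕ) : |θ j| ≤ √L := by
  refine Real.abs_le_sqrt ?_
  have h : ∀ p : ℝ, 0 ≤ p → θ j ^ 2 ≤ ((j : ℝ) + 1) ^ p * θ j ^ 2 := fun p hp =>
    le_mul_of_one_le_left (sq_nonneg _) (one_le_cast_add_one_rpow j hp)
  rcases hθ with hθ | hθ
  · exact (h _ (by linarith)).trans (hθ j)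
  · exact (h _ (by linarith)).trans ((hθ.1.le_tsum j fun i _ => by positivity).trans hθ.2)

lemma summable_cast_add_one_rpow_neg {p : ℝ} (hp : 1 < p) :
    Summable fun q : ℕ => ((q : ℝ) + 1) ^ (-p) := by
  have := (summable_nat_add_iff 1).2 (Real.summable_nat_rpow (p := -p) |>.2 (by linarith))
  simpa using this

/-- A telescoping majorant for the tail of a power series. It follows from `exp y ≥ 1 + y` and `log
r ≤ r - 1` at `r = x / (x + 1)`. -/
lemma mul_rpow_neg_succ_le {p x : ℝ} (hp : 0 < p) (hx : 0 < x) :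
    p * (x + 1) ^ (-(p + 1)) ≤ x ^ (-p) - (x + 1) ^ (-p) := by
  have hx1 : 0 < x + 1 := by linarith
  have hr : 0 < x / (x + 1) := by positivity
  have h1 : 1 + p / (x + 1) ≤ (x / (x + 1)) ^ (-p) := by
    rw [Real.rpow_def_of_pos hr]
    have hl := Real.log_le_sub_one_of_pos hr
    have e : x / (x + 1) - 1 = -(1 / (x + 1)) := by field_simp; ring
    rw [e] at hl
    have h2 := Real.add_one_le_exp (Real.log (x / (x + 1)) * -p)
    have h3 : p / (x + 1) ≤ Real.log (x / (x + 1)) * -p := by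
      rw [div_eq_mul_one_div]; nlinarith
    linarith
  rw [Real.div_rpow hx.le hx1.le, le_div_iff₀ (by positivity)] at h1
  rw [neg_add, Real.rpow_add hx1, Real.rpow_neg_one]
  have : p * ((x + 1) ^ (-p) * (x + 1)⁻¹) = p / (x + 1) * (x + 1) ^ (-p) := by field_simp
  linarith

/-- The squared bias of the sieve. For the hyperrectangle the sum telescopes and gives the constant
`L / (2β)`; for the Sobolev ball the weight is monotone and gives `L`. The sum of the two constants
serves both classes. -/
lemma sum_tail_le {β L : ℝ} (hβ : 0 < β) (hL : 0 < L) {θ : ℕ → ℝ}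
    (hθ : θ ∈ hyperrect β L ∪ sobolev β L) {k : ℕ} (hk : 1 ≤ k) (s : Finset ℕ) :
    ∑ j ∈ s, (if j < k then 0 else θ j ^ 2) ≤ (L + L / (2 * β)) * (k : ℝ) ^ (-(2 * β)) := by
  have hk' : (0 : ℝ) < k := by exact_mod_cast hk
  have hkp : 0 < (k : ℝ) ^ (-(2 * β)) := by positivity
  have hL2 : 0 < L / (2 * β) := by positivity
  rcases hθ with hθ | hθ
  · have h1 : ∀ j, (if j < k then 0 else θ j ^ 2) ≤ L / (2 * β) *
        (if j < k then 0 else (j : ℝ) ^ (-(2 * β)) - ((j : ℝ) + 1) ^ (-(2 * β))) := fun j => by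
      split_ifs with h
      · simp
      · have hj : (0 : ℝ) < j := by exact_mod_cast (by omega : 0 < j)
        have h2 := mul_rpow_neg_succ_le (p := 2 * β) (by linarith) hj
        have h3 := hθ j
        have hp : 0 < ((j : ℝ) + 1) ^ (2 * β + 1) := by positivity
        rw [Real.rpow_neg (x := (j : ℝ) + 1) (by positivity) (2 * β + 1)] at h2
        calc θ j ^ 2 ≤ L * (((j : ℝ) + 1) ^ (2 * β + 1))⁻¹ := by
              rw [← div_eq_mul_inv, le_div_iff₀ hp]; linarith
          _ = L / (2 * β) * (2 * β * (((j : ℝ) + 1) ^ (2 * β + 1))⁻¹) := by field_simp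
          _ ≤ _ := mul_le_mul_of_nonneg_left h2 hL2.le
    have h2 : ∀ M : ℕ, ∑ j ∈ Finset.range M,
        (if j < k then 0 else (j : ℝ) ^ (-(2 * β)) - ((j : ℝ) + 1) ^ (-(2 * β)))
        = if M ≤ k then 0 else (k : ℝ) ^ (-(2 * β)) - (M : ℝ) ^ (-(2 * β)) := fun M => by
      induction M with
      | zero => simp
      | succ M ih =>
        rw [Finset.sum_range_succ, ih]
        rcases lt_trichotomy M k with h | h | h
        · rw [if_pos h.le, if_pos h, if_pos (by omega)]; simp
        · subst h; simp
        · rw [if_neg (by omega), if_neg (by omega), if_neg (by omega)]; push_cast; ring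
    obtain ⟨M, hM⟩ := s.exists_nat_subset_range
    calc ∑ j ∈ s, (if j < k then 0 else θ j ^ 2)
        ≤ ∑ j ∈ Finset.range M, (if j < k then 0 else θ j ^ 2) :=
          Finset.sum_le_sum_of_subset_of_nonneg hM fun j _ _ => by split_ifs <;> positivity
      _ ≤ _ := Finset.sum_le_sum fun j _ => h1 j
      _ = L / (2 * β) * (if M ≤ k then 0 else (k : ℝ) ^ (-(2 * β)) - (M : ℝ) ^ (-(2 * β))) := by
          rw [← Finset.mul_sum, h2]
      _ ≤ L / (2 * β) * (k : ℝ) ^ (-(2 * β)) := by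
          refine mul_le_mul_of_nonneg_left ?_ hL2.le
          have : 0 ≤ (M : ℝ) ^ (-(2 * β)) := by positivity
          split_ifs <;> linarith
      _ ≤ _ := by nlinarith
  · calc ∑ j ∈ s, (if j < k then 0 else θ j ^ 2)
        ≤ ∑ j ∈ s, (k : ℝ) ^ (-(2 * β)) * (((j : ℝ) + 1) ^ (2 * β) * θ j ^ 2) := by
          refine Finset.sum_le_sum fun j _ => ?_
          split_ifs with h
          · positivity
          · rw [← mul_assoc]
            refine le_mul_of_one_le_left (sq_nonneg _) ?_
            rw [Real.rpow_neg hk'.le, ← div_eq_inv_mul, one_le_div (by positivity)]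
            refine Real.rpow_le_rpow hk'.le ?_ (by linarith)
            exact_mod_cast (by omega : k ≤ j + 1)
      _ ≤ (k : ℝ) ^ (-(2 * β)) * L := by
          rw [← Finset.mul_sum]
          exact mul_le_mul_of_nonneg_left ((hθ.1.sum_le_tsum s fun j _ => by positivity).trans hθ.2)
            hkp.le
      _ ≤ _ := by nlinarith

lemma sobolev_anti {γ β L : ℝ} (h : γ ≤ β) : sobolev β L ⊆ sobolev γ L := fun θ hθ => by
  have h1 : ∀ j : ℕ, ((j : ℝ) + 1) ^ (2 * γ) * θ j ^ 2 ≤ ((j : ℝ) + 1) ^ (2 * β) * θ j ^ 2 :=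
    fun j => mul_le_mul_of_nonneg_right (Real.rpow_le_rpow_of_exponent_le
      (by linarith [Nat.cast_nonneg (α := ℝ) j]) (by linarith)) (sq_nonneg _)
  have hs := Summable.of_nonneg_of_le (fun j => by positivity) h1 hθ.1
  exact ⟨hs, (hs.tsum_le_tsum h1 hθ.1).trans hθ.2⟩

/-- An arbitrarily small loss of smoothness puts both classes into a single Sobolev ball, to which
the aliasing bound applies. -/
lemma hyperrect_subset_sobolev {γ β L δ : ℝ} (hδ : 0 < δ) (h : γ + δ ≤ β) :
    hyperrect β L ⊆ sobolev γ (L * ∑' j : ℕ, ((j : ℝ) + 1) ^ (-(1 + 2 * δ))) := fun θ hθ => by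
  have hsum := (summable_cast_add_one_rpow_neg (p := 1 + 2 * δ) (by linarith)).mul_left L
  have h1 : ∀ j : ℕ, ((j : ℝ) + 1) ^ (2 * γ) * θ j ^ 2 ≤ L * ((j : ℝ) + 1) ^ (-(1 + 2 * δ)) :=
    fun j => by
      have hj : (1 : ℝ) ≤ (j : ℝ) + 1 := by linarith [Nat.cast_nonneg (α := ℝ) j]
      calc ((j : ℝ) + 1) ^ (2 * γ) * θ j ^ 2
          ≤ (((j : ℝ) + 1) ^ (-(1 + 2 * δ)) * ((j : ℝ) + 1) ^ (2 * β + 1)) * θ j ^ 2 := by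
            refine mul_le_mul_of_nonneg_right ?_ (sq_nonneg _)
            rw [← Real.rpow_add (by linarith)]
            exact Real.rpow_le_rpow_of_exponent_le hj (by linarith)
        _ = ((j : ℝ) + 1) ^ (-(1 + 2 * δ)) * (((j : ℝ) + 1) ^ (2 * β + 1) * θ j ^ 2) := by ring
        _ ≤ ((j : ℝ) + 1) ^ (-(1 + 2 * δ)) * L :=
            mul_le_mul_of_nonneg_left (hθ j) (by positivity)
        _ = _ := mul_comm _ _
  have hs := Summable.of_nonneg_of_le (fun j => by positivity) h1 hsum
  exact ⟨hs, (hs.tsum_le_tsum h1 hsum).trans_eq tsum_mul_left⟩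

/-- With `X = (j+1)^(2γ)` one has `2|θ_j| ≤ X θ_j² + X⁻¹`, and both terms are summable for `2γ > 1`.
-/
lemma summable_abs_of_mem_sobolev {γ L : ℝ} (hγ : 1 / 2 < γ) {θ : ℕ → ℝ} (hθ : θ ∈ sobolev γ L) :
    Summable fun j => |θ j| := by
  refine Summable.of_nonneg_of_le (fun j => abs_nonneg _) (fun j => ?_)
    (hθ.1.add (summable_cast_add_one_rpow_neg (p := 2 * γ) (by linarith)))
  have hx : 0 < ((j : ℝ) + 1) ^ (2 * γ) := by positivity
  rw [Real.rpow_neg (by positivity)]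
  set X := ((j : ℝ) + 1) ^ (2 * γ)
  rw [← sq_abs]
  have h : 0 ≤ X⁻¹ * (X * |θ j| - 1) ^ 2 := by positivity
  have e : X⁻¹ * (X * |θ j| - 1) ^ 2 = X * |θ j| ^ 2 + X⁻¹ - 2 * |θ j| := by field_simp; ring
  linarith [abs_nonneg (θ j)]

lemma tsum_tailSeq_sq_le {n : ℕ} (hn : 2 ≤ n) {γ L : ℝ} (hγ : 1 / 2 < γ) {θ : ℕ → ℝ}
    (hθ : θ ∈ sobolev γ L) : n * ∑' j, tailSeq n θ j ^ 2 ≤ L := by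
  rw [← tsum_mul_left]
  have hn1 : (1 : ℝ) ≤ n := by exact_mod_cast (by omega : 1 ≤ n)
  have h1 : ∀ j, n * tailSeq n θ j ^ 2 ≤ ((j : ℝ) + 1) ^ (2 * γ) * θ j ^ 2 := fun j => by
    simp only [tailSeq]
    split_ifs with h
    · refine mul_le_mul_of_nonneg_right ?_ (sq_nonneg _)
      calc (n : ℝ) ≤ (j : ℝ) + 1 := by exact_mod_cast h
        _ = ((j : ℝ) + 1) ^ (1 : ℝ) := (Real.rpow_one _).symm
        _ ≤ _ := Real.rpow_le_rpow_of_exponent_le (by linarith [Nat.cast_nonneg (α := ℝ) j])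
          (by linarith)
    · simp; positivity
  have hs := Summable.of_nonneg_of_le (fun j => by positivity) h1 hθ.1
  exact (hs.tsum_le_tsum h1 hθ.1).trans hθ.2

/-- Uniform regularity of the true parameters. -/
lemma exists_isRegular_truth (proj : Prop) {β₁ L : ℝ} (hβ₁ : 0 < β₁) (hL : 0 < L)
    (hproj : proj ∨ 1 / 2 < β₁) :
    ∃ A, 0 ≤ A ∧ ∀ n, 2 ≤ n → ∀ β, β₁ ≤ β → ∀ θ ∈ hyperrect β L ∪ sobolev β L,
      IsRegular √L A n (truth proj n θ) := by
  by_cases hp : proj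
  -- The projected truth has no unidentifiable tail, so the two norms agree exactly and the error
  -- constant is zero.
  · refine ⟨0, le_rfl, fun n hn β hβ θ hθ => ?_⟩
    have h0 : ∀ j, n ≤ j + 1 → truth proj n θ j = 0 := fun j hj => by simp [truth, hp, hj]
    have hs : Summable fun j => |truth proj n θ j| :=
      summable_abs_of_eventually_zero (k := n) fun j hj => h0 j (by omega)
    have ht : tailSeq n (truth proj n θ) = fun _ => 0 := by
      ext j; simp only [tailSeq]; split_ifs with h
      · exact h0 j h
      · rfl
    refine ⟨abs_le_sqrt_of_mem (hβ₁.trans_le hβ) (truth_mem proj n hθ), hs, fun k hk u => ?_⟩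
    refine (abs_norm_sub_seqDist_le hk hs u).trans ?_
    have h1 := norm_evalVec_sq_of_support (n := n) (c := fun _ => 0) fun _ _ => rfl
    have h2 : ‖evalVec n fun _ => 0‖ = 0 := by
      rw [← sq_eq_zero_iff, h1]; simp
    rw [ht, h2]
    simp
  · have hβ' := hproj.resolve_left hp
    -- Half of the surplus over `1/2`: after this loss of smoothness `γ` is still above `1/2`.
    set δ := (β₁ - 1 / 2) / 2 with hδ
    have hδ0 : 0 < δ := by rw [hδ]; linarith
    set γ := β₁ - δ with hγ
    have hγ1 : 1 / 2 < γ := by rw [hγ, hδ]; linarith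
    set L' := max L (L * ∑' j : ℕ, ((j : ℝ) + 1) ^ (-(1 + 2 * δ))) with hL'
    set Z := ∑' q : ℕ, ((q : ℝ) + 1) ^ (-(2 * γ)) with hZ
    refine ⟨√(2 * Z * L') + √L', by positivity, fun n hn β hβ θ hθ => ?_⟩
    have htr : truth proj n θ = θ := by ext j; simp [truth, hp]
    rw [htr]
    have hmem : θ ∈ sobolev γ L' := by
      have hmono : ∀ a b : ℝ, a ≤ b → sobolev γ a ⊆ sobolev γ b := fun a b hab η hη =>
        ⟨hη.1, hη.2.trans hab⟩
      rcases hθ with hθ | hθ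
      · exact hmono _ _ (le_max_right _ _) (hyperrect_subset_sobolev hδ0 (by linarith) hθ)
      · exact hmono _ _ (le_max_left _ _) (sobolev_anti (by linarith) hθ)
    have hs := summable_abs_of_mem_sobolev hγ1 hmem
    refine ⟨abs_le_sqrt_of_mem (hβ₁.trans_le hβ) hθ, hs, fun k hk u => ?_⟩
    refine (abs_norm_sub_seqDist_le hk hs u).trans (add_le_add ?_ ?_)
    · exact Real.le_sqrt_of_sq_le (norm_evalVec_tailSeq_sq_le hn hγ1 hs hmem)
    · rw [← Real.sqrt_mul (by positivity)]
      exact Real.sqrt_le_sqrt (tsum_tailSeq_sq_le hn hγ1 hmem)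

/-! ### The likelihood ratio on a sieve -/

/-- The span of the first `k` basis vectors and of the mean vector. -/
def modelSpace (n k : ℕ) (θ₀ : ℕ → ℝ) : Submodule ℝ (EuclideanSpace ℝ (Fin n)) :=
  Submodule.span ℝ (Set.range fun j : Option (Fin k) => j.elim (evalVec n θ₀) fun j =>
    WithLp.toLp 2 fun i => trigBasis j (design n i))

lemma finrank_modelSpace_le (n k : ℕ) (θ₀ : ℕ → ℝ) :
    Module.finrank ℝ (modelSpace n k θ₀) ≤ k + 1 :=
  (finrank_range_le_card _).trans_eq (by simp)

lemma regFun_extendZero {k : ℕ} (u : Fin k → ℝ) (t : ℝ) :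
    regFun (extendZero k u) t = ∑ j : Fin k, u j * trigBasis j t := by
  rw [regFun_eq_sum fun j hj => extendZero_of_le u hj, Finset.sum_range]
  exact Finset.sum_congr rfl fun j _ => by rw [extendZero_of_lt u j.2]

lemma evalVec_sub_mem_modelSpace (n k : ℕ) (θ₀ : ℕ → ℝ) (u : Fin k → ℝ) :
    evalVec n (extendZero k u) - evalVec n θ₀ ∈ modelSpace n k θ₀ := by
  have e : evalVec n (extendZero k u)
      = ∑ j : Fin k, u j • (WithLp.toLp 2 fun i => trigBasis j (design n i) :
        EuclideanSpace ℝ (Fin n)) := by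
    ext i
    simp [evalVec, regFun_extendZero]
  refine Submodule.sub_mem _ ?_ (Submodule.subset_span ⟨none, rfl⟩)
  rw [e]
  exact Submodule.sum_mem _ fun j _ => Submodule.smul_mem _ _
    (Submodule.subset_span ⟨some j, rfl⟩)

/-- The squared norm of the projection of the noise on `modelSpace`. -/
def projNoise (n k : ℕ) (θ₀ : ℕ → ℝ) (x : Fin n → ℝ) : ℝ :=
  ‖(modelSpace n k θ₀).starProjection (noise n θ₀ x)‖ ^ 2

lemma projNoise_nonneg (n k : ℕ) (θ₀ : ℕ → ℝ) (x : Fin n → ℝ) : 0 ≤ projNoise n k θ₀ x :=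
  sq_nonneg _

/-- The difference of the means lies in the model space, so the noise may be replaced by its
projection before Cauchy-Schwarz is used. The bound is uniform over the whole sieve, and it takes
the place of a maximal inequality. -/
lemma abs_inner_noise_le (n k : ℕ) (θ₀ : ℕ → ℝ) (x : Fin n → ℝ) (u : Fin k → ℝ) :
    |inner ℝ (evalVec n (extendZero k u) - evalVec n θ₀) (noise n θ₀ x)|
      ≤ ‖evalVec n (extendZero k u) - evalVec n θ₀‖ * √(projNoise n k θ₀ x) := by
  set d := evalVec n (extendZero k u) - evalVec n θ₀ with hd
  have h := Submodule.starProjection_eq_self_iff.2 (evalVec_sub_mem_modelSpace n k θ₀ u)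
  rw [← hd] at h
  rw [← h, Submodule.inner_starProjection_left_eq_right, projNoise, Real.sqrt_sq (norm_nonneg _), h]
  exact abs_real_inner_le_norm _ _

/-- The event on which the noise is under control in all model spaces. -/
def goodEvent (v : ℝ≥0) (c : ℝ) (n : ℕ) (θ₀ : ℕ → ℝ) : Set (Fin n → ℝ) :=
  {x | ∀ k : ℕ, 2 ≤ k → projNoise n k θ₀ x ≤ v * (c * (k * Real.log n))}

lemma measurableSet_goodEvent (v : ℝ≥0) (c : ℝ) (n : ℕ) (θ₀ : ℕ → ℝ) :
    MeasurableSet (goodEvent v c n θ₀) := by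
  have hc := continuous_noise n θ₀
  have e : goodEvent v c n θ₀ = ⋂ k : ℕ, ⋂ _ : 2 ≤ k,
      {x | projNoise n k θ₀ x ≤ v * (c * (k * Real.log n))} := by
    ext x; simp [goodEvent]
  rw [e]
  refine MeasurableSet.iInter fun k => MeasurableSet.iInter fun _ => ?_
  refine measurableSet_le (Continuous.measurable ?_) measurable_const
  unfold projNoise
  fun_prop

/-- Union bound over `k ≥ 2`. With `s = n^(-c/4)`, level `k` contributes at most `2^(k+1) s^k`, a
geometric series of ratio `2s`. -/
lemma measure_compl_goodEvent_le (v : ℝ≥0) (hv : v ≠ 0) (c : ℝ) (n : ℕ) (θ₀ : ℕ → ℝ) :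
    dataLaw v n θ₀ (goodEvent v c n θ₀)ᶜ ≤
      8 * ENNReal.ofReal (Real.exp (-(c * Real.log n / 4))) ^ 2 *
        (1 - 2 * ENNReal.ofReal (Real.exp (-(c * Real.log n / 4))))⁻¹ := by
  set s := ENNReal.ofReal (Real.exp (-(c * Real.log n / 4))) with hs
  have hsub : (goodEvent v c n θ₀)ᶜ ⊆ ⋃ k : ℕ,
      {x | v * (c * ((k + 2 : ℕ) * Real.log n)) < projNoise n (k + 2) θ₀ x} := by
    intro x hx
    simp only [goodEvent, Set.mem_compl_iff, Set.mem_ofPred_eq, not_forall, not_le] at hx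
    obtain ⟨k, hk, hx⟩ := hx
    refine Set.mem_iUnion.2 ⟨k - 2, ?_⟩
    simp only [Set.mem_ofPred_eq]
    rwa [show k - 2 + 2 = k by omega]
  calc dataLaw v n θ₀ (goodEvent v c n θ₀)ᶜ
      ≤ ∑' k : ℕ, dataLaw v n θ₀
          {x | v * (c * ((k + 2 : ℕ) * Real.log n)) < projNoise n (k + 2) θ₀ x} :=
        (measure_mono hsub).trans (measure_iUnion_le _)
    _ ≤ ∑' k : ℕ, 8 * s ^ 2 * (2 * s) ^ k := by
        refine ENNReal.tsum_le_tsum fun k => ?_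
        refine (measure_norm_starProjection_noise_gt_le v hv n θ₀ _ _).trans ?_
        have e : ENNReal.ofReal (Real.exp (-(c * ((k + 2 : ℕ) * Real.log n) / 4))) = s ^ (k + 2) := by
          rw [hs, ← ENNReal.ofReal_pow (Real.exp_pos _).le, ← Real.exp_nat_mul]
          congr 2; push_cast; ring
        rw [e]
        calc _ ≤ 2 ^ (k + 2 + 1) * s ^ (k + 2) :=
              mul_le_mul_left (pow_le_pow_right₀ (by norm_num) (finrank_modelSpace_le _ _ _)) _
          _ = _ := by rw [mul_pow]; ring
    _ = _ := by rw [ENNReal.tsum_mul_left, ENNReal.tsum_geometric]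

lemma eventually_measure_compl_goodEvent_le (v : ℝ≥0) (hv : v ≠ 0) {c : ℝ} (hc : 0 < c)
    {δ : ℝ≥0∞} (hδ : δ ≠ 0) :
    ∀ᶠ n : ℕ in atTop, ∀ θ₀ : ℕ → ℝ, dataLaw v n θ₀ (goodEvent v c n θ₀)ᶜ ≤ δ := by
  have hlog : Tendsto (fun n : ℕ => c * Real.log n / 4) atTop atTop :=
    ((Real.tendsto_log_atTop.comp tendsto_natCast_atTop_atTop).const_mul_atTop hc).atTop_div_const
      (by norm_num)
  have hs : Tendsto (fun n : ℕ => ENNReal.ofReal (Real.exp (-(c * Real.log n / 4)))) atTop (𝓝 0) := by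
    have := ENNReal.tendsto_ofReal (Real.tendsto_exp_neg_atTop_nhds_zero.comp hlog)
    simpa using this
  have hs' : Tendsto (fun n : ℕ => 16 * ENNReal.ofReal (Real.exp (-(c * Real.log n / 4)))) atTop
      (𝓝 0) := by
    simpa using ENNReal.Tendsto.const_mul hs (Or.inr (by norm_num : (16 : ℝ≥0∞) ≠ ∞))
  -- Once `s ≤ 1/4` the geometric series is at most `2`, and the whole bound is at most `16 s`.
  have h4 : (0 : ℝ≥0∞) < 4⁻¹ := by simp
  filter_upwards [hs'.eventually_le_const (pos_iff_ne_zero.2 hδ), hs.eventually_le_const h4]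
    with n h1 h2 θ₀
  refine (measure_compl_goodEvent_le v hv c n θ₀).trans (le_trans ?_ h1)
  set s := ENNReal.ofReal (Real.exp (-(c * Real.log n / 4)))
  have h3 : 2 * s ≤ 2⁻¹ := by
    calc 2 * s ≤ 2 * 4⁻¹ := by gcongr
      _ = 2⁻¹ := by
        rw [show (4 : ℝ≥0∞) = 2 * 2 by norm_num, ENNReal.mul_inv (by simp) (by simp), ← mul_assoc,
          ENNReal.mul_inv_cancel (by simp) (by simp), one_mul]
  have h5 : (1 - 2 * s)⁻¹ ≤ 2 := by
    rw [ENNReal.inv_le_iff_inv_le]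
    calc (2 : ℝ≥0∞)⁻¹ = 1 - 2⁻¹ := ENNReal.one_sub_inv_two.symm
      _ ≤ _ := tsub_le_tsub_left h3 1
  have h6 : s ≤ 1 := h2.trans (by simp)
  calc 8 * s ^ 2 * (1 - 2 * s)⁻¹ ≤ 8 * (1 * s) * 2 := by
        rw [sq]; gcongr
    _ = 16 * s := by ring

/-! ### Pointwise bounds for the likelihood ratio given the projected noise -/

section

variable {v : ℝ≥0} {n k : ℕ} {x : Fin n → ℝ} {θ₀ : ℕ → ℝ}

/-- With `D` the norm of the mean difference and `S` that of the projected noise, the exponent is at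
most `(2DS - D²) / (2v)`, whose maximum over `D` is `S² / (2v)`. -/
lemma lik_le_exp_projNoise (hv : v ≠ 0) (u : Fin k → ℝ) :
    lik v n x (extendZero k u) ≤ lik v n x θ₀ *
      ENNReal.ofReal (Real.exp (projNoise n k θ₀ x / (2 * v))) := by
  have hv' : (0 : ℝ) < v := by positivity
  rw [lik_eq_mul_exp v hv n x (extendZero k u) θ₀]
  refine mul_le_mul_right (ENNReal.ofReal_le_ofReal (Real.exp_le_exp.2 ?_)) _
  have h := (le_abs_self _).trans (abs_inner_noise_le n k θ₀ x u)
  have h2 := Real.sq_sqrt (projNoise_nonneg n k θ₀ x)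
  gcongr
  nlinarith [sq_nonneg (‖evalVec n (extendZero k u) - evalVec n θ₀‖ - √(projNoise n k θ₀ x))]

/-- The two smallness conditions say `A ≤ √n R / 2` and `S ≤ √n R / 8`. Hence `D ≥ √n R / 2` and `S
≤ D / 4`, so the quadratic term dominates: `2DS - D² ≤ -D² / 2 ≤ -n R² / 8`. -/
lemma lik_le_exp_neg (hv : v ≠ 0) {B A R : ℝ} (h : IsRegular B A n θ₀) (hk : k < n) (hR : 0 ≤ R)
    (hA : 4 * A ^ 2 ≤ n * R ^ 2) (hS : 64 * projNoise n k θ₀ x ≤ n * R ^ 2) (u : Fin k → ℝ)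
    (hu : R ≤ seqDist (extendZero k u) θ₀) :
    lik v n x (extendZero k u) ≤ lik v n x θ₀ *
      ENNReal.ofReal (Real.exp (-(n * R ^ 2 / (16 * v)))) := by
  have hv' : (0 : ℝ) < v := by positivity
  rw [lik_eq_mul_exp v hv n x (extendZero k u) θ₀]
  refine mul_le_mul_right (ENNReal.ofReal_le_ofReal (Real.exp_le_exp.2 ?_)) _
  have h1 := (le_abs_self _).trans (abs_inner_noise_le n k θ₀ x u)
  have h2 := Real.sq_sqrt (projNoise_nonneg n k θ₀ x)
  have h3 := (abs_le.1 (h.dist k hk u)).1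
  set D := ‖evalVec n (extendZero k u) - evalVec n θ₀‖
  set S := √(projNoise n k θ₀ x)
  have hS0 : 0 ≤ S := Real.sqrt_nonneg _
  have hn : √(n : ℝ) ^ 2 = n := Real.sq_sqrt (Nat.cast_nonneg n)
  have hn0 : 0 ≤ √(n : ℝ) := Real.sqrt_nonneg _
  have h4 : A ≤ √n * R / 2 := by
    refine le_of_abs_le (abs_le_of_sq_le_sq ?_ (by positivity))
    rw [div_pow, mul_pow, hn]; linarith
  have h5 : √n * R / 2 ≤ D := by nlinarith [mul_le_mul_of_nonneg_left hu hn0]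
  have h6 : S ≤ √n * R / 8 := by
    refine le_of_abs_le (abs_le_of_sq_le_sq ?_ (by positivity))
    rw [div_pow, mul_pow, hn, h2]; linarith
  have h7 : S ≤ D / 4 := by linarith
  have hD : 0 ≤ D := norm_nonneg _
  have h8 : n * R ^ 2 / 4 ≤ D ^ 2 := by
    have := pow_le_pow_left₀ (by positivity) h5 2
    rw [div_pow, mul_pow, hn] at this; linarith
  rw [div_le_iff₀ (by positivity)]
  have e : -(n * R ^ 2 / (16 * v)) * (2 * v) = -(n * R ^ 2 / 8) := by field_simp; ring
  rw [e]
  nlinarith [mul_le_mul_of_nonneg_left h7 hD]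

/-- Here `D ≤ 2 √n R`, and `-2DS - D² ≥ -2D² - S²`, which explains the constant `8`. -/
lemma exp_neg_le_lik (hv : v ≠ 0) {B A R : ℝ} (h : IsRegular B A n θ₀) (hk : k < n) (hR : 0 ≤ R)
    (hA : A ^ 2 ≤ n * R ^ 2) (u : Fin k → ℝ) (hu : seqDist (extendZero k u) θ₀ ≤ R) :
    lik v n x θ₀ * ENNReal.ofReal (Real.exp (-((8 * (n * R ^ 2) + projNoise n k θ₀ x) / (2 * v))))
      ≤ lik v n x (extendZero k u) := by
  have hv' : (0 : ℝ) < v := by positivity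
  rw [lik_eq_mul_exp v hv n x (extendZero k u) θ₀]
  refine mul_le_mul_right (ENNReal.ofReal_le_ofReal (Real.exp_le_exp.2 ?_)) _
  have h1 := (neg_abs_le _).trans' (neg_le_neg (abs_inner_noise_le n k θ₀ x u))
  have h2 := Real.sq_sqrt (projNoise_nonneg n k θ₀ x)
  have h3 := (abs_le.1 (h.dist k hk u)).2
  set D := ‖evalVec n (extendZero k u) - evalVec n θ₀‖
  set S := √(projNoise n k θ₀ x)
  have hn : √(n : ℝ) ^ 2 = n := Real.sq_sqrt (Nat.cast_nonneg n)
  have hn0 : 0 ≤ √(n : ℝ) := Real.sqrt_nonneg _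
  have hD : 0 ≤ D := norm_nonneg _
  have h4 : A ≤ √n * R := by
    refine le_of_abs_le (abs_le_of_sq_le_sq ?_ (by positivity))
    rw [mul_pow, hn]; linarith
  have h5 : D ≤ 2 * (√n * R) := by nlinarith [mul_le_mul_of_nonneg_left hu hn0]
  have h8 : D ^ 2 ≤ 4 * (n * R ^ 2) := by
    have := pow_le_pow_left₀ hD h5 2
    rw [mul_pow, mul_pow, hn] at this; linarith
  rw [← neg_div]
  gcongr
  nlinarith [sq_nonneg (D - S)]

end

/-! ### The sieve prior -/

lemma measurable_extendZero (k : ℕ) : Measurable (extendZero k) := by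
  refine measurable_pi_lambda _ fun j => ?_
  by_cases h : j < k
  · simpa [extendZero, h] using measurable_pi_apply _
  · simp [extendZero, h]

/-- An embedding, and not only a measurable map, allows masses and integrals over arbitrary sets and
functions of sequences to be transferred to `ℝᵏ` without measurability conditions. -/
lemma measurableEmbedding_extendZero (k : ℕ) : MeasurableEmbedding (extendZero k) := by
  refine MeasurableEmbedding.of_measurable_inverse (g := fun θ (j : Fin k) => θ j)
    (measurable_extendZero k) ?_ (by fun_prop) fun u => ?_
  · have : Set.range (extendZero k) = ⋂ j : ℕ, ⋂ _ : k ≤ j, {θ | θ j = 0} := by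
      ext θ
      simp only [Set.mem_range, Set.mem_iInter, Set.mem_ofPred_eq]
      constructor
      · rintro ⟨u, rfl⟩ j hj
        exact extendZero_of_le u hj
      · intro h
        refine ⟨fun j => θ j, ?_⟩
        ext j
        by_cases hj : j < k
        · rw [extendZero_of_lt _ hj]
        · rw [extendZero_of_le _ (not_lt.1 hj), h j (not_lt.1 hj)]
    rw [this]
    exact MeasurableSet.iInter fun j => MeasurableSet.iInter fun _ =>
      measurableSet_eq_fun (measurable_pi_apply j) measurable_const
  · ext j
    exact extendZero_of_lt u j.2

/-- The law of one coordinate under the sieve prior. -/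
def coordLaw (g : ℝ → ℝ) : Measure ℝ := volume.withDensity fun x => ENNReal.ofReal (g x)

/-- The law of the first `k` coordinates under the sieve prior. -/
def blockLaw (g : ℝ → ℝ) (k : ℕ) : Measure (Fin k → ℝ) := Measure.pi fun _ => coordLaw g

lemma sievePrior_eq (g : ℝ → ℝ) (k : ℕ) : sievePrior g k = (blockLaw g k).map (extendZero k) := rfl

lemma IsSieveDensity.isProbabilityMeasure_coordLaw {g : ℝ → ℝ} (hg : IsSieveDensity g) :
    IsProbabilityMeasure (coordLaw g) := by
  refine ⟨?_⟩
  rw [coordLaw, withDensity_apply _ MeasurableSet.univ, Measure.restrict_univ,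
    ← ofReal_integral_eq_lintegral_ofReal hg.integrable (ae_of_all _ fun x => (hg.pos x).le),
    hg.integral_eq_one, ENNReal.ofReal_one]

lemma IsSieveDensity.isProbabilityMeasure_blockLaw {g : ℝ → ℝ} (hg : IsSieveDensity g) (k : ℕ) :
    IsProbabilityMeasure (blockLaw g k) := by
  have := hg.isProbabilityMeasure_coordLaw
  unfold blockLaw; infer_instance

lemma IsSieveDensity.isProbabilityMeasure_sievePrior {g : ℝ → ℝ} (hg : IsSieveDensity g) (k : ℕ) :
    IsProbabilityMeasure (sievePrior g k) := by
  have := hg.isProbabilityMeasure_blockLaw k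
  rw [sievePrior_eq]
  exact Measure.isProbabilityMeasure_map (measurable_extendZero k).aemeasurable

lemma sievePrior_apply (g : ℝ → ℝ) (k : ℕ) (B : Set (ℕ → ℝ)) :
    sievePrior g k B = blockLaw g k (extendZero k ⁻¹' B) := by
  rw [sievePrior_eq, (measurableEmbedding_extendZero k).map_apply]

lemma lintegral_sievePrior (g : ℝ → ℝ) (k : ℕ) (f : (ℕ → ℝ) → ℝ≥0∞) :
    ∫⁻ θ, f θ ∂(sievePrior g k) = ∫⁻ u, f (extendZero k u) ∂(blockLaw g k) := by
  rw [sievePrior_eq, (measurableEmbedding_extendZero k).lintegral_map]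

lemma setLIntegral_sievePrior (g : ℝ → ℝ) (k : ℕ) (B : Set (ℕ → ℝ)) (f : (ℕ → ℝ) → ℝ≥0∞) :
    ∫⁻ θ in B, f θ ∂(sievePrior g k)
      = ∫⁻ u in extendZero k ⁻¹' B, f (extendZero k u) ∂(blockLaw g k) := by
  rw [sievePrior_eq, (measurableEmbedding_extendZero k).restrict_map,
    (measurableEmbedding_extendZero k).lintegral_map]

lemma setLIntegral_sievePrior_le (g : ℝ → ℝ) (k : ℕ) {B : Set (ℕ → ℝ)} {f : (ℕ → ℝ) → ℝ≥0∞}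
    {c : ℝ≥0∞} (h : ∀ u, extendZero k u ∈ B → f (extendZero k u) ≤ c) :
    ∫⁻ θ in B, f θ ∂(sievePrior g k) ≤ c * sievePrior g k B := by
  rw [setLIntegral_sievePrior, sievePrior_apply, ← setLIntegral_const]
  exact setLIntegral_mono measurable_const fun u hu => h u hu

/-- The squared distance differs from the constant `∑ θ₀ j²` by a finite sum over the first `k`
coordinates. -/
lemma measurable_seqDist_extendZero (k : ℕ) {θ₀ : ℕ → ℝ} (hθ₀ : Summable fun j => θ₀ j ^ 2) :
    Measurable fun u : Fin k → ℝ => seqDist (extendZero k u) θ₀ := by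
  have e : ∀ u : Fin k → ℝ, seqDist (extendZero k u) θ₀
      = √(∑' j, θ₀ j ^ 2 + ∑ j : Fin k, ((u j - θ₀ j) ^ 2 - θ₀ j ^ 2)) := fun u => by
    have h1 : HasSum (fun j => (extendZero k u j - θ₀ j) ^ 2 - θ₀ j ^ 2)
        (∑ j : Fin k, ((u j - θ₀ j) ^ 2 - θ₀ j ^ 2)) := by
      have : HasSum (fun j => (extendZero k u j - θ₀ j) ^ 2 - θ₀ j ^ 2)
          (∑ j ∈ Finset.range k, ((extendZero k u j - θ₀ j) ^ 2 - θ₀ j ^ 2)) :=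
        hasSum_sum_of_ne_finset_zero fun j hj => by
          rw [extendZero_of_le u (by simpa using hj)]; ring
      rw [Finset.sum_range] at this
      convert! this using 2 with j
      rw [extendZero_of_lt u j.2]
    have h2 := hθ₀.hasSum.add h1
    rw [seqDist, ← h2.tsum_eq]
    congr 2; ext j; ring
  simp_rw [e]
  fun_prop

lemma le_setLIntegral_sievePrior (g : ℝ → ℝ) (k : ℕ) {B : Set (ℕ → ℝ)} {f : (ℕ → ℝ) → ℝ≥0∞}
    {c : ℝ≥0∞} (hB : MeasurableSet (extendZero k ⁻¹' B))
    (h : ∀ u, extendZero k u ∈ B → c ≤ f (extendZero k u)) :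
    c * sievePrior g k B ≤ ∫⁻ θ, f θ ∂(sievePrior g k) := by
  refine le_trans ?_ (setLIntegral_le_lintegral B f)
  rw [setLIntegral_sievePrior, sievePrior_apply, ← setLIntegral_const]
  exact setLIntegral_mono' hB fun u hu => h u hu

lemma IsSieveDensity.exists_le_of_abs_le {g : ℝ → ℝ} (hg : IsSieveDensity g) (R : ℝ) :
    ∃ G, 0 < G ∧ ∀ t, |t| ≤ R → g t ≤ G := by
  obtain ⟨G, hG⟩ := (isCompact_Icc (a := -R) (b := R)).bddAbove_image hg.cont.continuousOn
  exact ⟨max G 1, by positivity, fun t ht =>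
    (hG ⟨t, abs_le.1 ht, rfl⟩).trans (le_max_left _ _)⟩

lemma IsSieveDensity.exists_ge_of_abs_le {g : ℝ → ℝ} (hg : IsSieveDensity g) (R : ℝ) :
    ∃ G, 0 < G ∧ ∀ t, |t| ≤ R → G ≤ g t := by
  by_cases hR : 0 ≤ R
  · obtain ⟨t₀, -, ht₀⟩ := (isCompact_Icc (a := -R) (b := R)).exists_isMinOn
      ⟨0, by simpa using hR⟩ hg.cont.continuousOn
    exact ⟨g t₀, hg.pos _, fun t ht => ht₀ (abs_le.1 ht)⟩
  · exact ⟨1, one_pos, fun t ht => absurd ((abs_nonneg t).trans ht) hR⟩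

lemma lintegral_exp_neg_sq (a : ℝ) {s : ℝ} (hs : 0 < s) :
    ∫⁻ t, ENNReal.ofReal (Real.exp (-(t - a) ^ 2 / (2 * s))) = ENNReal.ofReal √(2 * Real.pi * s) := by
  set s' : ℝ≥0 := ⟨s, hs.le⟩
  have hs' : s' ≠ 0 := fun h => hs.ne' (congrArg NNReal.toReal h)
  have h := lintegral_gaussianPDF_eq_one a hs'
  have e : ∀ t, ENNReal.ofReal (Real.exp (-(t - a) ^ 2 / (2 * s)))
      = ENNReal.ofReal √(2 * Real.pi * s) * gaussianPDF a s' t := fun t => by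
    rw [gaussianPDF, ← ENNReal.ofReal_mul (Real.sqrt_nonneg _), gaussianPDFReal, ← mul_assoc]
    have : √(2 * Real.pi * (s' : ℝ)) ≠ 0 := by
      have : (0 : ℝ) < 2 * Real.pi * s := by positivity
      exact (Real.sqrt_pos.2 this).ne'
    change _ = ENNReal.ofReal (√(2 * Real.pi * (s' : ℝ)) * _ * _)
    rw [mul_inv_cancel₀ this, one_mul]
    rfl
  simp_rw [e]
  rw [lintegral_const_mul _ (measurable_gaussianPDF _ _), h, mul_one]

/-- Upper bound for the prior mass of small balls. -/
lemma blockLaw_ball_le {g : ℝ → ℝ} (hg : IsSieveDensity g) {B R G τ : ℝ} (hR : 0 ≤ R) (hG : 0 < G)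
    (hgG : ∀ t, |t| ≤ B + R → g t ≤ G) (hτ : 0 < τ) {k : ℕ} (hk : 1 ≤ k) (hkτ : k * τ ≤ R ^ 2)
    (a : Fin k → ℝ) (ha : ∀ j, |a j| ≤ B) :
    blockLaw g k {u | ∑ j, (u j - a j) ^ 2 ≤ k * τ}
      ≤ ENNReal.ofReal (G * Real.exp (1 / 2) * √(2 * Real.pi * τ)) ^ k := by
  have := hg.isProbabilityMeasure_coordLaw
  have hk' : (0 : ℝ) < k := by exact_mod_cast hk
  -- The indicator of the ball is dominated by a product of Gaussian factors: on the ball their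
  -- exponents sum to at least `k/2 - k/2 = 0`. The product integrates coordinatewise, which avoids
  -- the volume of a ball. The cutoff to an interval keeps to the region where `g ≤ G`.
  set h : Fin k → ℝ → ℝ≥0∞ := fun j => (Set.Icc (-(B + R)) (B + R)).indicator fun t =>
    ENNReal.ofReal (Real.exp (1 / 2 + -(t - a j) ^ 2 / (2 * τ))) with hh
  have hm : ∀ j, Measurable (h j) := fun j =>
    Measurable.indicator (by fun_prop) measurableSet_Icc
  have h1 : ∀ u ∈ {u : Fin k → ℝ | ∑ j, (u j - a j) ^ 2 ≤ k * τ}, 1 ≤ ∏ j, h j (u j) := by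
    intro u hu
    simp only [Set.mem_ofPred_eq] at hu
    have hmem : ∀ j, u j ∈ Set.Icc (-(B + R)) (B + R) := fun j => by
      have h2 : (u j - a j) ^ 2 ≤ R ^ 2 :=
        (Finset.single_le_sum (f := fun j => (u j - a j) ^ 2) (fun i _ => sq_nonneg _)
          (Finset.mem_univ j)).trans (hu.trans hkτ)
      have h3 := abs_le.1 (abs_le_of_sq_le_sq h2 hR)
      have h4 := abs_le.1 (ha j)
      constructor <;> linarith [h3.1, h3.2, h4.1, h4.2]
    have e : ∏ j, h j (u j) = ENNReal.ofReal (Real.exp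
        (∑ j, (1 / 2 + -(u j - a j) ^ 2 / (2 * τ)))) := by
      rw [ofReal_exp_sum]
      exact Finset.prod_congr rfl fun j _ => Set.indicator_of_mem (hmem j) _
    rw [e, ENNReal.one_le_ofReal]
    refine Real.one_le_exp ?_
    rw [Finset.sum_add_distrib, ← Finset.sum_div _ _ (2 * τ), Finset.sum_neg_distrib]
    simp only [Finset.sum_const, Finset.card_univ, Fintype.card_fin, nsmul_eq_mul]
    have : (∑ j, (u j - a j) ^ 2) / (2 * τ) ≤ k / 2 := by
      rw [div_le_iff₀ (by positivity)]; linarith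
    rw [neg_div]; linarith
  calc blockLaw g k {u | ∑ j, (u j - a j) ^ 2 ≤ k * τ}
      ≤ ∫⁻ u, ∏ j, h j (u j) ∂(blockLaw g k) := by
        have h2 : {u : Fin k → ℝ | ∑ j, (u j - a j) ^ 2 ≤ k * τ} ⊆ {u | 1 ≤ ∏ j, h j (u j)} := h1
        refine (measure_mono h2).trans ?_
        have := mul_meas_ge_le_lintegral₀ (μ := blockLaw g k) (f := fun u => ∏ j, h j (u j))
          (Finset.measurable_prod _ fun j _ => (hm j).comp (measurable_pi_apply j)).aemeasurable 1
        simpa using this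
    _ = ∏ j, ∫⁻ t, h j t ∂(coordLaw g) := lintegral_pi_prod _ _ hm
    _ ≤ ∏ _j : Fin k, ENNReal.ofReal (G * Real.exp (1 / 2) * √(2 * Real.pi * τ)) := by
        refine Finset.prod_le_prod' fun j _ => ?_
        rw [coordLaw, lintegral_withDensity_eq_lintegral_mul _
          hg.cont.measurable.ennreal_ofReal (hm j)]
        calc _ ≤ ∫⁻ t, ENNReal.ofReal (G * Real.exp (1 / 2)) *
              ENNReal.ofReal (Real.exp (-(t - a j) ^ 2 / (2 * τ))) := by
              refine lintegral_mono fun t => ?_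
              simp only [Pi.mul_apply, hh]
              by_cases ht : t ∈ Set.Icc (-(B + R)) (B + R)
              · rw [Set.indicator_of_mem ht, ← ENNReal.ofReal_mul (hg.pos t).le,
                  ← ENNReal.ofReal_mul (by positivity), Real.exp_add, mul_assoc]
                refine ENNReal.ofReal_le_ofReal (mul_le_mul_of_nonneg_right ?_ (by positivity))
                exact hgG t (abs_le.2 ht)
              · rw [Set.indicator_of_notMem ht, mul_zero]; exact zero_le
          _ = _ := by
              rw [lintegral_const_mul' _ _ ENNReal.ofReal_ne_top, lintegral_exp_neg_sq _ hτ,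
                ← ENNReal.ofReal_mul (by positivity)]
    _ = _ := by simp

/-- Lower bound for the prior mass of small cubes. -/
lemma le_blockLaw_cube {g : ℝ → ℝ} (hg : IsSieveDensity g) {B G r : ℝ} (hr : 0 ≤ r) (hr1 : r ≤ 1)
    (hG : 0 < G) (hgG : ∀ t, |t| ≤ B + 1 → G ≤ g t) (k : ℕ) (a : Fin k → ℝ) (ha : ∀ j, |a j| ≤ B) :
    ENNReal.ofReal (2 * G * r) ^ k ≤ blockLaw g k (Metric.closedBall a r) := by
  have := hg.isProbabilityMeasure_coordLaw
  rw [blockLaw, Measure.pi_closedBall _ _ hr]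
  calc ENNReal.ofReal (2 * G * r) ^ k = ∏ _j : Fin k, ENNReal.ofReal (2 * G * r) := by simp
    _ ≤ _ := by
      refine Finset.prod_le_prod' fun j _ => ?_
      rw [coordLaw, withDensity_apply _ measurableSet_closedBall]
      calc ENNReal.ofReal (2 * G * r) = ∫⁻ _t in Metric.closedBall (a j) r, ENNReal.ofReal G := by
            rw [setLIntegral_const, Real.volume_closedBall, ← ENNReal.ofReal_mul hG.le]
            congr 1; ring
        _ ≤ _ := by
            refine setLIntegral_mono' measurableSet_closedBall fun t ht => ?_
            refine ENNReal.ofReal_le_ofReal (hgG t ?_)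
            rw [Metric.mem_closedBall, Real.dist_eq] at ht
            have h3 := abs_le.1 ht
            have h4 := abs_le.1 (ha j)
            rw [abs_le]
            constructor <;> linarith [h3.1, h3.2, h4.1, h4.2]

/-! ### Growth of the effective dimension -/

lemma tendsto_log_natCast : Tendsto (fun n : ℕ => Real.log n) atTop atTop :=
  Real.tendsto_log_atTop.comp tendsto_natCast_atTop_atTop

lemma eventually_mul_log_le_rpow (c : ℝ) {s : ℝ} (hs : 0 < s) :
    ∀ᶠ n : ℕ in atTop, c * Real.log n ≤ (n : ℝ) ^ s := by
  have h := (isLittleO_log_rpow_atTop hs).tendsto_div_nhds_zero.comp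
    (tendsto_natCast_atTop_atTop (R := ℝ))
  have h' : Tendsto (fun n : ℕ => c * (Real.log n / (n : ℝ) ^ s)) atTop (𝓝 0) := by
    simpa using h.const_mul c
  filter_upwards [h'.eventually_le_const one_pos, eventually_gt_atTop 0] with n hn hn0
  have hp : 0 < (n : ℝ) ^ s := by positivity
  rw [← mul_div_assoc, div_le_one hp] at hn
  exact hn

lemma eventually_rpow_half_le_div_log :
    ∀ᶠ n : ℕ in atTop, (n : ℝ) ^ (1 / 2 : ℝ) ≤ n / Real.log n := by
  filter_upwards [eventually_mul_log_le_rpow 1 (by norm_num : (0 : ℝ) < 1 / 2),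
    tendsto_log_natCast.eventually_gt_atTop 0, eventually_gt_atTop 0] with n h1 h2 h3
  have hn : (0 : ℝ) < n := by exact_mod_cast h3
  rw [le_div_iff₀ h2]
  calc (n : ℝ) ^ (1 / 2 : ℝ) * Real.log n ≤ (n : ℝ) ^ (1 / 2 : ℝ) * (n : ℝ) ^ (1 / 2 : ℝ) := by
        gcongr; linarith
    _ = n := by rw [← Real.rpow_add hn]; norm_num

lemma tendsto_div_log : Tendsto (fun n : ℕ => (n : ℝ) / Real.log n) atTop atTop :=
  tendsto_atTop_mono' atTop eventually_rpow_half_le_div_log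
    ((tendsto_rpow_atTop (by norm_num)).comp tendsto_natCast_atTop_atTop)

/-- The order of magnitude of the optimal truncation level. -/
def effDim (β : ℝ) (n : ℕ) : ℝ := ((n : ℝ) / Real.log n) ^ (1 / (2 * β + 1))

lemma rate_nonneg (β : ℝ) (n : ℕ) : 0 ≤ rate β n :=
  Real.rpow_nonneg (div_nonneg (Nat.cast_nonneg n) (Real.log_natCast_nonneg n)) _

/-- With `effDim_rpow` this expresses the balance that defines the rate: at the level `effDim β n`
both the squared bias `k^(-2β)` and the estimation error `k log n / n` equal the squared rate. -/
lemma nat_mul_rate_sq {β : ℝ} (hβ : 0 < β) {n : ℕ} (hn : 0 < Real.log n) :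
    n * rate β n ^ 2 = effDim β n * Real.log n := by
  have hn0 : (0 : ℝ) < n := by
    rcases Nat.eq_zero_or_pos n with rfl | h
    · simp at hn
    · exact_mod_cast h
  have hy : 0 < (n : ℝ) / Real.log n := by positivity
  have e : (n : ℝ) = n / Real.log n * Real.log n := by field_simp
  rw [rate, effDim, ← Real.rpow_mul_natCast hy.le]
  have : (1 : ℝ) / (2 * β + 1) = 1 + -(β / (2 * β + 1)) * (2 : ℕ) := by
    push_cast; field_simp; ring
  rw [this, Real.rpow_add hy, Real.rpow_one, mul_right_comm, ← e]

lemma effDim_rpow {β : ℝ} (hβ : 0 < β) {n : ℕ} : effDim β n ^ (-(2 * β)) = rate β n ^ 2 := by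
  have hy : 0 ≤ (n : ℝ) / Real.log n := div_nonneg (Nat.cast_nonneg n) (Real.log_natCast_nonneg n)
  rw [effDim, rate, ← Real.rpow_mul hy, ← Real.rpow_mul_natCast hy]
  congr 1
  push_cast; field_simp

lemma effDim_le {β₁ β : ℝ} (hβ₁ : 0 < β₁) (h : β₁ ≤ β) {n : ℕ} (hn : 1 ≤ (n : ℝ) / Real.log n) :
    effDim β n ≤ ((n : ℝ) / Real.log n) ^ (1 / (2 * β₁ + 1)) :=
  Real.rpow_le_rpow_of_exponent_le hn (one_div_le_one_div_of_le (by linarith) (by linarith))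

lemma le_effDim {β β₂ : ℝ} (hβ : 0 < β) (h : β ≤ β₂) {n : ℕ} (hn : 1 ≤ (n : ℝ) / Real.log n) :
    ((n : ℝ) / Real.log n) ^ (1 / (2 * β₂ + 1)) ≤ effDim β n :=
  Real.rpow_le_rpow_of_exponent_le hn (one_div_le_one_div_of_le (by linarith) (by linarith))

lemma eventually_le_effDim {β₁ β₂ : ℝ} (hβ₁ : 0 < β₁) (hβ : β₁ ≤ β₂) (K : ℝ) :
    ∀ᶠ n : ℕ in atTop, ∀ β ∈ Set.Icc β₁ β₂, K ≤ effDim β n := by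
  have h := (tendsto_rpow_atTop (y := 1 / (2 * β₂ + 1)) (by
    have : 0 < β₂ := by linarith
    positivity)).comp tendsto_div_log
  filter_upwards [h.eventually_ge_atTop K, tendsto_div_log.eventually_ge_atTop 1] with n h1 h2 β hβ
  exact h1.trans (le_effDim (hβ₁.trans_le hβ.1) hβ.2 h2)

lemma eventually_mul_effDim_le {β₁ : ℝ} (hβ₁ : 0 < β₁) {ε : ℝ} (hε : 0 < ε) (K : ℝ) :
    ∀ᶠ n : ℕ in atTop, ∀ β, β₁ ≤ β → K * effDim β n ≤ ε * (n / Real.log n) := by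
  have hs : 1 / (2 * β₁ + 1) < 1 := by
    rw [div_lt_one (by linarith)]; linarith
  have h := (tendsto_rpow_atTop (y := 1 - 1 / (2 * β₁ + 1)) (by linarith)).comp tendsto_div_log
  filter_upwards [h.eventually_ge_atTop (|K| / ε), tendsto_div_log.eventually_ge_atTop 1]
    with n h1 h2 β hβ
  simp only [Function.comp] at h1
  set y := (n : ℝ) / Real.log n
  have hy : 0 < y := by linarith
  have hX : 0 ≤ effDim β n := Real.rpow_nonneg hy.le _
  calc K * effDim β n ≤ |K| * effDim β n := by gcongr; exact le_abs_self K
    _ ≤ |K| * y ^ (1 / (2 * β₁ + 1)) := by gcongr; exact effDim_le hβ₁ hβ h2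
    _ ≤ (ε * y ^ (1 - 1 / (2 * β₁ + 1))) * y ^ (1 / (2 * β₁ + 1)) := by
        gcongr
        rw [div_le_iff₀ hε] at h1; linarith
    _ = ε * y := by
        rw [mul_assoc, ← Real.rpow_add hy]; simp

/-! ### Small balls and marginal likelihoods -/

lemma sum_sq_le_seqDist_sq {k : ℕ} (u : Fin k → ℝ) {θ₀ : ℕ → ℝ} (h : Summable fun j => |θ₀ j|) :
    ∑ j : Fin k, (u j - θ₀ j) ^ 2 ≤ seqDist (extendZero k u) θ₀ ^ 2 := by
  have hs := summable_sq_of_summable_abs (summable_abs_sub (summable_abs_extendZero u) h)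
  rw [seqDist, Real.sq_sqrt (tsum_nonneg fun _ => sq_nonneg _)]
  refine le_trans (le_of_eq ?_) (hs.sum_le_tsum (Finset.range k) fun j _ => sq_nonneg _)
  rw [Finset.sum_range]
  exact Finset.sum_congr rfl fun j _ => by simp [extendZero_of_lt u j.2]

lemma seqDist_sq_le {k : ℕ} (u : Fin k → ℝ) {θ₀ : ℕ → ℝ} (h : Summable fun j => |θ₀ j|) {T : ℝ}
    (hT : ∀ s : Finset ℕ, ∑ j ∈ s, (if j < k then 0 else θ₀ j ^ 2) ≤ T) :
    seqDist (extendZero k u) θ₀ ^ 2 ≤ ∑ j : Fin k, (u j - θ₀ j) ^ 2 + T := by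
  have hs := summable_sq_of_summable_abs (summable_abs_sub (summable_abs_extendZero u) h)
  rw [seqDist, Real.sq_sqrt (tsum_nonneg fun _ => sq_nonneg _)]
  refine hs.tsum_le_of_sum_le fun s => ?_
  have h1 : ∀ j, (extendZero k u j - θ₀ j) ^ 2 = (if j < k then (extendZero k u j - θ₀ j) ^ 2 else 0)
      + (if j < k then 0 else θ₀ j ^ 2) := fun j => by
    split_ifs with hj
    · ring
    · rw [extendZero_of_le u (not_lt.1 hj)]; ring
  simp only [Pi.sub_apply]
  rw [Finset.sum_congr rfl fun j _ => h1 j, Finset.sum_add_distrib]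
  refine add_le_add ?_ (hT s)
  rw [← Finset.sum_filter]
  calc _ ≤ ∑ j ∈ Finset.range k, (extendZero k u j - θ₀ j) ^ 2 := by
        refine Finset.sum_le_sum_of_subset_of_nonneg (fun j hj => ?_) fun j _ _ => sq_nonneg _
        simpa using (Finset.mem_filter.1 hj).2
    _ = _ := by
        rw [Finset.sum_range]
        exact Finset.sum_congr rfl fun j _ => by simp [extendZero_of_lt u j.2]

/-- Small balls have exponentially small prior mass, uniformly over the truncation levels. -/
lemma eventually_sievePrior_ball_le {g : ℝ → ℝ} (hg : IsSieveDensity g) (B : ℝ) {A : ℝ}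
    (hA : 0 < A) :
    ∀ᶠ n : ℕ in atTop, ∀ θ₀ : ℕ → ℝ, (∀ j, |θ₀ j| ≤ B) → (Summable fun j => |θ₀ j|) →
      ∀ k : ℕ, 1 ≤ k → k * Real.log n ≤ n →
        sievePrior g k {θ | seqDist θ θ₀ ≤ √(A * (k * Real.log n) / n)}
          ≤ ENNReal.ofReal (Real.exp (-(k * Real.log n / 4))) := by
  obtain ⟨G, hG, hgG⟩ := hg.exists_le_of_abs_le (B + √A)
  filter_upwards [eventually_mul_log_le_rpow ((G * Real.exp (1 / 2)) ^ 2 * (2 * Real.pi * A))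
    (by norm_num : (0 : ℝ) < 1 / 2), tendsto_log_natCast.eventually_gt_atTop 0,
    eventually_gt_atTop 0] with n h1 hlog hn θ₀ hB hs k hk hkn
  have hn' : (0 : ℝ) < n := by exact_mod_cast hn
  set τ := A * Real.log n / n with hτ
  have hτ0 : 0 < τ := by positivity
  have e : A * (k * Real.log n) / n = k * τ := by rw [hτ]; ring
  -- Because `k log n ≤ n`, the ball has radius at most `√A`. So one bound for `g` on a fixed
  -- interval serves all levels.
  have hkτ : k * τ ≤ √A ^ 2 := by
    rw [← e, Real.sq_sqrt hA.le, div_le_iff₀ hn']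
    nlinarith
  rw [sievePrior_apply]
  have hsub : extendZero k ⁻¹' {θ | seqDist θ θ₀ ≤ √(A * (k * Real.log n) / n)}
      ⊆ {u | ∑ j, (u j - θ₀ j) ^ 2 ≤ k * τ} := fun u hu => by
    simp only [Set.mem_preimage, Set.mem_ofPred_eq] at hu ⊢
    refine (sum_sq_le_seqDist_sq u hs).trans ?_
    rw [e] at hu
    calc seqDist (extendZero k u) θ₀ ^ 2 ≤ √(k * τ) ^ 2 :=
          pow_le_pow_left₀ (Real.sqrt_nonneg _) hu 2
      _ = _ := Real.sq_sqrt (by positivity)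
  refine (measure_mono hsub).trans ((blockLaw_ball_le hg (Real.sqrt_nonneg A) hG hgG hτ0 hk hkτ _
    fun j => hB j).trans ?_)
  -- Every coordinate costs a factor of order `√(log n / n)`, eventually at most `n^(-1/4)`. The
  -- slack `n^(1/4)` absorbs the logarithm and all constants.
  have h2 : G * Real.exp (1 / 2) * √(2 * Real.pi * τ) ≤ Real.exp (-(Real.log n / 4)) := by
    refine le_of_abs_le (abs_le_of_sq_le_sq ?_ (Real.exp_pos _).le)
    rw [mul_pow, Real.sq_sqrt (by positivity), ← Real.exp_nat_mul]
    have e2 : Real.exp ((2 : ℕ) * -(Real.log n / 4)) = (n : ℝ) ^ (1 / 2 : ℝ) / n := by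
      rw [eq_div_iff hn'.ne', Real.rpow_def_of_pos hn']
      nth_rewrite 2 [← Real.exp_log hn']
      rw [← Real.exp_add]
      congr 1; push_cast; ring
    rw [e2, le_div_iff₀ hn', hτ]
    calc _ = (G * Real.exp (1 / 2)) ^ 2 * (2 * Real.pi * A) * Real.log n := by field_simp
      _ ≤ _ := h1
  calc _ ≤ ENNReal.ofReal (Real.exp (-(Real.log n / 4))) ^ k := by gcongr
    _ = _ := by
      rw [← ENNReal.ofReal_pow (Real.exp_pos _).le, ← Real.exp_nat_mul]
      congr 2; ring

/-- Upper bound for a marginal likelihood by splitting off a neighbourhood of the truth. -/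
lemma marginal_le_of_ball {v : ℝ≥0} (hv : v ≠ 0) {g : ℝ → ℝ} (hg : IsSieveDensity g) {B A R p : ℝ}
    {n k : ℕ} {θ₀ : ℕ → ℝ} {x : Fin n → ℝ} (h : IsRegular B A n θ₀) (hk : k < n) (hR : 0 ≤ R)
    (hA : 4 * A ^ 2 ≤ n * R ^ 2) (hS : 64 * projNoise n k θ₀ x ≤ n * R ^ 2)
    (hp : sievePrior g k {θ | seqDist θ θ₀ ≤ R} ≤ ENNReal.ofReal (Real.exp (-p))) :
    marginal v n (sievePrior g k) x ≤ lik v n x θ₀ * ENNReal.ofReal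
      (Real.exp (projNoise n k θ₀ x / (2 * v) - p) + Real.exp (-(n * R ^ 2 / (16 * v)))) := by
  have := hg.isProbabilityMeasure_sievePrior k
  have huniv : (Set.univ : Set (ℕ → ℝ)) = {θ | seqDist θ θ₀ ≤ R} ∪ {θ | R ≤ seqDist θ θ₀} := by
    ext θ; simpa using le_total _ _
  rw [marginal, ← setLIntegral_univ, huniv, ENNReal.ofReal_add (Real.exp_pos _).le
    (Real.exp_pos _).le, mul_add]
  refine (lintegral_union_le _ _ _).trans (add_le_add ?_ ?_)
  · refine (setLIntegral_sievePrior_le g k fun u _ =>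
      lik_le_exp_projNoise (θ₀ := θ₀) hv u).trans ?_
    rw [mul_assoc, sub_eq_add_neg, Real.exp_add, ENNReal.ofReal_mul (Real.exp_pos _).le]
    gcongr
  · refine (setLIntegral_sievePrior_le g k fun u hu => lik_le_exp_neg hv h hk hR hA hS u hu).trans ?_
    exact mul_le_of_le_one_right' prob_le_one

/-- The constant in `goodEvent` for the given noise variance. -/
def noiseConst (v : ℝ≥0) : ℝ := min (1 / 4) (1 / (64 * v))

lemma noiseConst_pos {v : ℝ≥0} (hv : v ≠ 0) : 0 < noiseConst v := by
  have : (0 : ℝ) < v := by positivity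
  exact lt_min (by norm_num) (by positivity)

lemma mul_noiseConst_le {v : ℝ≥0} (hv : v ≠ 0) : 64 * (v * noiseConst v) ≤ 1 := by
  have hv' : (0 : ℝ) < v := by positivity
  have := min_le_right (1 / 4) (1 / (64 * (v : ℝ)))
  rw [← noiseConst, le_div_iff₀ (by positivity)] at this
  linarith

/-- The exponent in the upper bound for the marginal likelihoods. -/
def decayConst (v : ℝ≥0) : ℝ := min (1 / 8) (1 / (16 * v))

lemma decayConst_pos {v : ℝ≥0} (hv : v ≠ 0) : 0 < decayConst v := by
  have : (0 : ℝ) < v := by positivity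
  exact lt_min (by norm_num) (by positivity)

lemma lt_of_mul_log_le {n k : ℕ} (hlog : 1 < Real.log n) (hk : 0 < k) (h : k * Real.log n ≤ n) :
    k < n := by
  have : (0 : ℝ) < k := by exact_mod_cast hk
  have : (k : ℝ) < n := by nlinarith
  exact_mod_cast this

/-- The radius is chosen with `n R² = k log n`. The ball has prior mass at most `exp(-k log n / 4)`,
of which the noise can use up `k log n / 8`. Outside the ball the likelihood ratio is at most
`exp(-k log n / (16v))`. These two exponents are the entries of `decayConst`, and the two entries of
`noiseConst` are what the two parts need. -/
lemma eventually_marginal_le {v : ℝ≥0} (hv : v ≠ 0) {g : ℝ → ℝ} (hg : IsSieveDensity g) (B A : ℝ) :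
    ∀ᶠ n : ℕ in atTop, ∀ θ₀ : ℕ → ℝ, IsRegular B A n θ₀ →
      ∀ x ∈ goodEvent v (noiseConst v) n θ₀, ∀ k : ℕ, 2 ≤ k → k * Real.log n ≤ n →
        marginal v n (sievePrior g k) x ≤ lik v n x θ₀ *
          ENNReal.ofReal (2 * Real.exp (-(decayConst v * (k * Real.log n)))) := by
  have hv' : (0 : ℝ) < v := by positivity
  filter_upwards [eventually_sievePrior_ball_le hg B one_pos,
    tendsto_log_natCast.eventually_gt_atTop 1, tendsto_log_natCast.eventually_ge_atTop (4 * A ^ 2),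
    eventually_gt_atTop 0] with n h1 hlog hlogA hn θ₀ hreg x hx k hk hkn
  have hn' : (0 : ℝ) < n := by exact_mod_cast hn
  have hk' : (2 : ℝ) ≤ k := by exact_mod_cast hk
  have hkl : 0 < k * Real.log n := by positivity
  set R := √(1 * (k * Real.log n) / n) with hR
  have hnR : n * R ^ 2 = k * Real.log n := by
    rw [hR, Real.sq_sqrt (by positivity)]; field_simp
  have hS := hx k hk
  have hnc := mul_noiseConst_le hv
  have hS' : 64 * projNoise n k θ₀ x ≤ k * Real.log n := by nlinarith
  have h2 := marginal_le_of_ball hv hg (x := x) hreg (lt_of_mul_log_le hlog (by omega) hkn)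
    (Real.sqrt_nonneg _) (by rw [hnR]; nlinarith) (by rw [hnR]; exact hS')
    (h1 θ₀ hreg.bdd hreg.summable k (by omega) hkn)
  refine h2.trans (mul_le_mul_right (ENNReal.ofReal_le_ofReal ?_) _)
  rw [two_mul (Real.exp _), hnR]
  have hq : projNoise n k θ₀ x / (2 * v) ≤ k * Real.log n / 8 := by
    rw [div_le_iff₀ (by positivity)]
    have : noiseConst v ≤ 1 / 4 := min_le_left _ _
    have h3 : (v : ℝ) * (noiseConst v * (k * Real.log n)) ≤ v * (1 / 4 * (k * Real.log n)) := by
      gcongr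
    linarith
  have d1 : decayConst v * (k * Real.log n) ≤ 1 / 8 * (k * Real.log n) :=
    mul_le_mul_of_nonneg_right (min_le_left _ _) hkl.le
  have d2 : decayConst v * (k * Real.log n) ≤ 1 / (16 * v) * (k * Real.log n) :=
    mul_le_mul_of_nonneg_right (min_le_right _ _) hkl.le
  have e : k * Real.log n / (16 * v) = 1 / (16 * v) * (k * Real.log n) := by ring
  exact add_le_add (Real.exp_le_exp.2 (by linarith)) (Real.exp_le_exp.2 (by linarith))

/-- Lower bound for a marginal likelihood in terms of the prior mass of a neighbourhood. -/
lemma le_marginal_of_subset_ball {v : ℝ≥0} (hv : v ≠ 0) (g : ℝ → ℝ) {B A R : ℝ} {n k : ℕ}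
    {θ₀ : ℕ → ℝ} (x : Fin n → ℝ) (h : IsRegular B A n θ₀) (hk : k < n) (hR : 0 ≤ R)
    (hA : A ^ 2 ≤ n * R ^ 2) {N : Set (ℕ → ℝ)} (hN : MeasurableSet (extendZero k ⁻¹' N))
    (hNR : ∀ u : Fin k → ℝ, extendZero k u ∈ N → seqDist (extendZero k u) θ₀ ≤ R) :
    lik v n x θ₀ * ENNReal.ofReal (Real.exp (-((8 * (n * R ^ 2) + projNoise n k θ₀ x) / (2 * v))))
      * sievePrior g k N ≤ marginal v n (sievePrior g k) x :=
  le_setLIntegral_sievePrior g k hN fun u hu => exp_neg_le_lik hv h hk hR hA u (hNR u hu)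

/-- For `k` of the order of `X = effDim β n`, a cube of half side `rate / √k` around the first `k`
true coefficients lies within a constant times the rate of the truth: the coordinates contribute
`rate²` and the bias `D rate²`. Its prior mass is at least `n^(-k) ≥ exp(-2 X log n)`, and the
likelihood ratio on it is at least `exp(-const · X log n)`. -/
lemma exists_le_marginal {v : ℝ≥0} (hv : v ≠ 0) {g : ℝ → ℝ} (hg : IsSieveDensity g)
    {β₁ β₂ L : ℝ} (A : ℝ) (hβ₁ : 0 < β₁) (hβ : β₁ ≤ β₂) (hL : 0 < L) :
    ∃ C, 0 < C ∧ ∀ᶠ n : ℕ in atTop, ∀ β ∈ Set.Icc β₁ β₂, ∀ θ₀ ∈ hyperrect β L ∪ sobolev β L,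
      IsRegular √L A n θ₀ → ∀ x ∈ goodEvent v (noiseConst v) n θ₀, ∀ k : ℕ, 2 ≤ k →
        effDim β n ≤ k → k ≤ 2 * effDim β n → k * Real.log n ≤ n →
        lik v n x θ₀ * ENNReal.ofReal (Real.exp (-(C * (effDim β n * Real.log n))))
          ≤ marginal v n (sievePrior g k) x := by
  have hv' : (0 : ℝ) < v := by positivity
  obtain ⟨G, hG, hgG⟩ := hg.exists_ge_of_abs_le (√L + 1)
  obtain ⟨D, hD⟩ : ∃ D : ℝ, D = L + L / (2 * β₁) := ⟨_, rfl⟩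
  have hD0 : 0 < D := by rw [hD]; positivity
  have hnc := noiseConst_pos hv
  -- The fraction bounds the exponent of the likelihood ratio on the cube, with `n R² = (1 + D) X
  -- log n` and `k ≤ 2X`; the last `2` is the exponent of the prior mass.
  obtain ⟨C, hC⟩ : ∃ C : ℝ, C = (8 * (1 + D) + 2 * (v * noiseConst v)) / (2 * v) + 2 := ⟨_, rfl⟩
  refine ⟨C, by rw [hC]; positivity, ?_⟩
  have hlin : Tendsto (fun n : ℕ => 2 * G ^ 2 * (n : ℝ)) atTop atTop :=
    tendsto_natCast_atTop_atTop.const_mul_atTop (by positivity)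
  filter_upwards [hlin.eventually_ge_atTop 1, tendsto_log_natCast.eventually_gt_atTop 1,
    tendsto_log_natCast.eventually_ge_atTop (A ^ 2), eventually_gt_atTop 0,
    eventually_le_effDim hβ₁ hβ 1]
    with n hGn hlog hlogA hn hX1 β hβm θ₀ hθ₀ hreg x hx k hk hXk hkX hkn
  have hβ0 : 0 < β := hβ₁.trans_le hβm.1
  have hn' : (0 : ℝ) < n := by exact_mod_cast hn
  have hk' : (2 : ℝ) ≤ k := by exact_mod_cast hk
  have hk0 : (0 : ℝ) < k := by linarith
  have hX := hX1 β hβm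
  set X := effDim β n with hXdef
  have hrate := nat_mul_rate_sq hβ0 (n := n) (by linarith)
  have hρ0 : 0 ≤ rate β n := rate_nonneg β n
  set ρ := rate β n with hρ
  rw [← hXdef] at hrate
  have hρ2 : ρ ^ 2 = X * Real.log n / n := by rw [eq_div_iff hn'.ne', ← hrate]; ring
  obtain ⟨r, hr⟩ : ∃ r : ℝ, r = ρ / √k := ⟨_, rfl⟩
  have hr0 : 0 ≤ r := by rw [hr]; positivity
  have hr2 : r ^ 2 = X * Real.log n / n / k := by
    rw [hr, div_pow, Real.sq_sqrt hk0.le, hρ2]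
  have hr1 : r ≤ 1 := by
    refine le_of_abs_le (abs_le_of_sq_le_sq ?_ zero_le_one)
    rw [hr2, div_le_iff₀ hk0, div_le_iff₀ hn']
    nlinarith
  -- Since `k ≤ 2X`, the half side satisfies `r² ≥ log n / (2n)`, so a coordinate has mass of order
  -- at least `n^(-1/2)`; the cruder `1/n` also absorbs `G`.
  have hrn : Real.exp (-Real.log n) ≤ 2 * G * r := by
    refine le_of_abs_le (abs_le_of_sq_le_sq ?_ (by positivity))
    have h1 : Real.log n / (2 * n) ≤ r ^ 2 := by
      rw [hr2, div_div, div_le_div_iff₀ (by positivity) (by positivity)]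
      have : k * (n * Real.log n) ≤ 2 * X * (n * Real.log n) := by gcongr
      nlinarith
    rw [Real.exp_neg, Real.exp_log hn', mul_pow, inv_pow]
    calc ((n : ℝ) ^ 2)⁻¹ ≤ (2 * G) ^ 2 * (Real.log n / (2 * n)) := by
          rw [inv_le_iff_one_le_mul₀ (by positivity)]
          have : (2 * G) ^ 2 * (Real.log n / (2 * n)) * n ^ 2 = 2 * G ^ 2 * n * Real.log n := by
            field_simp
          rw [this]; nlinarith
      _ ≤ _ := by gcongr
  set N : Set (ℕ → ℝ) := {θ | ∀ j : Fin k, |θ j - θ₀ j| ≤ r} with hN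
  have hpre : extendZero k ⁻¹' N = Metric.closedBall (fun j : Fin k => θ₀ j) r := by
    ext u
    simp only [hN, Set.mem_preimage, Set.mem_ofPred_eq, Metric.mem_closedBall, dist_pi_le_iff hr0,
      Real.dist_eq]
    exact forall_congr' fun j => by rw [extendZero_of_lt u j.2]
  obtain ⟨R, hR⟩ : ∃ R : ℝ, R = √(1 + D) * ρ := ⟨_, rfl⟩
  have hR2 : n * R ^ 2 = (1 + D) * (X * Real.log n) := by
    rw [hR, mul_pow, Real.sq_sqrt (by positivity), ← hrate]; ring
  have hR0 : 0 ≤ R := by rw [hR]; positivity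
  have hNR : ∀ u : Fin k → ℝ, extendZero k u ∈ N → seqDist (extendZero k u) θ₀ ≤ R := by
    intro u hu
    refine le_of_abs_le (abs_le_of_sq_le_sq ?_ hR0)
    have h1 : (L + L / (2 * β)) * (k : ℝ) ^ (-(2 * β)) ≤ D * ρ ^ 2 := by
      rw [hρ, ← effDim_rpow hβ0, hD]
      refine mul_le_mul (add_le_add le_rfl (div_le_div_of_nonneg_left hL.le (by linarith)
        (by linarith [hβm.1]))) (Real.rpow_le_rpow_of_nonpos (by linarith) hXk (by linarith))
        (by positivity) (hD ▸ hD0.le)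
    have h2 := seqDist_sq_le u hreg.summable
      (fun s => (sum_tail_le hβ0 hL hθ₀ (by omega : 1 ≤ k) s).trans h1)
    have h3 : ∑ j : Fin k, (u j - θ₀ j) ^ 2 ≤ ρ ^ 2 := by
      calc ∑ j : Fin k, (u j - θ₀ j) ^ 2 ≤ ∑ _j : Fin k, r ^ 2 := by
            refine Finset.sum_le_sum fun j _ => ?_
            have := hu j
            rw [extendZero_of_lt u j.2] at this
            exact sq_le_sq' (by linarith [(abs_le.1 this).1]) (abs_le.1 this).2
        _ = k * r ^ 2 := by simp
        _ = ρ ^ 2 := by rw [hr, div_pow, Real.sq_sqrt hk0.le]; field_simp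
    rw [hR, mul_pow, Real.sq_sqrt (by positivity)]
    linarith
  have hXl : 0 < X * Real.log n := by positivity
  have hXl1 : Real.log n ≤ X * Real.log n := le_mul_of_one_le_left (by linarith) hX
  have hDX : X * Real.log n ≤ (1 + D) * (X * Real.log n) :=
    le_mul_of_one_le_left hXl.le (by linarith)
  have hlow := le_marginal_of_subset_ball hv g x hreg (lt_of_mul_log_le hlog (by omega) hkn)
    hR0 (by rw [hR2]; linarith) (by rw [hpre]; exact measurableSet_closedBall) hNR
  refine le_trans ?_ hlow
  have hmass : ENNReal.ofReal (Real.exp (-(2 * (X * Real.log n)))) ≤ sievePrior g k N := by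
    rw [sievePrior_apply, hpre]
    refine le_trans ?_ (le_blockLaw_cube hg hr0 hr1 hG hgG k _ fun j => hreg.bdd j)
    calc _ ≤ ENNReal.ofReal (Real.exp (-Real.log n) ^ k) := by
          rw [← Real.exp_nat_mul]
          refine ENNReal.ofReal_le_ofReal (Real.exp_le_exp.2 ?_)
          nlinarith
      _ ≤ _ := by
          rw [ENNReal.ofReal_pow (Real.exp_pos _).le]
          gcongr
  rw [mul_assoc]
  refine mul_le_mul_right ?_ _
  calc ENNReal.ofReal (Real.exp (-(C * (X * Real.log n))))
      ≤ ENNReal.ofReal (Real.exp (-((8 * (n * R ^ 2) + projNoise n k θ₀ x) / (2 * v))))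
        * ENNReal.ofReal (Real.exp (-(2 * (X * Real.log n)))) := by
        rw [← ENNReal.ofReal_mul (Real.exp_pos _).le, ← Real.exp_add]
        refine ENNReal.ofReal_le_ofReal (Real.exp_le_exp.2 ?_)
        have h1 : (8 * (n * R ^ 2) + projNoise n k θ₀ x) / (2 * v)
            ≤ (8 * (1 + D) + 2 * (v * noiseConst v)) / (2 * v) * (X * Real.log n) := by
          rw [div_mul_eq_mul_div]
          refine div_le_div_of_nonneg_right ?_ (by linarith)
          rw [hR2]
          have h2 := hx k hk
          have h3 : (v : ℝ) * (noiseConst v * (k * Real.log n))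
              ≤ v * (noiseConst v * (2 * X * Real.log n)) :=
            mul_le_mul_of_nonneg_left (mul_le_mul_of_nonneg_left
              (mul_le_mul_of_nonneg_right hkX (by linarith)) hnc.le) hv'.le
          linarith
        rw [hC]; linarith
    _ ≤ _ := mul_le_mul_right hmass _

/-! ### The marginal maximum likelihood estimator and the oracle -/

lemma levels_mul_log_le {ε : ℝ} (hε : ε ≤ 1) {n k : ℕ} (hlog : 0 < Real.log n)
    (hk : k ∈ levels ε n) : k * Real.log n ≤ n := by
  have h := hk.2
  rw [le_div_iff₀ hlog] at h
  nlinarith [Nat.cast_nonneg (α := ℝ) n]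

lemma finite_levels (ε : ℝ) (n : ℕ) : (levels ε n).Finite := by
  obtain ⟨N, hN⟩ := exists_nat_ge (ε * n / Real.log n)
  exact (Set.finite_Iic N).subset fun k hk => by
    have := hk.2.trans hN
    exact_mod_cast this

/-- The level rates are at least of the order of the estimation error. -/
lemma eventually_le_levelRate {g : ℝ → ℝ} (hg : IsSieveDensity g) (B : ℝ) {ε K : ℝ} (hε : ε ≤ 1)
    (hK : 0 < K) :
    ∀ᶠ n : ℕ in atTop, ∀ θ₀ : ℕ → ℝ, (∀ j, |θ₀ j| ≤ B) → (Summable fun j => |θ₀ j|) →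
      ∀ e : ℕ → ℝ, IsLevelRate g ε K n θ₀ e → ∀ k ∈ levels ε n,
        k * Real.log n / 4 ≤ n * e k ^ 2 := by
  -- With this constant, `n ε_n(k)² < k log n / 4` would put the ball of radius `K ε_n(k)` inside
  -- the ball of the small ball estimate. Its mass `exp(-n ε_n(k)²)` would then be at most `exp(-k
  -- log n / 4)`, a contradiction.
  have hA : 0 < K ^ 2 / 4 := by positivity
  filter_upwards [eventually_sievePrior_ball_le hg B hA, tendsto_log_natCast.eventually_gt_atTop 0,
    eventually_gt_atTop 0] with n h1 hlog hn θ₀ hB hs e he k hk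
  have hn' : (0 : ℝ) < n := by exact_mod_cast hn
  obtain ⟨hpos, heq⟩ := he k hk
  by_contra! hlt
  have hk1 : 1 ≤ k := by have := hk.1; omega
  have h2 := h1 θ₀ hB hs k hk1 (levels_mul_log_le hε hlog hk)
  have h3 : {θ | seqDist θ θ₀ ≤ K * e k} ⊆
      {θ | seqDist θ θ₀ ≤ √(K ^ 2 / 4 * (k * Real.log n) / n)} := fun θ hθ => by
    simp only [Set.mem_ofPred_eq] at hθ ⊢
    refine hθ.trans (Real.le_sqrt_of_sq_le ?_)
    rw [le_div_iff₀ hn']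
    have := mul_le_mul_of_nonneg_left hlt.le (sq_nonneg K)
    nlinarith
  have h4 := (measure_mono h3).trans h2
  rw [heq, ENNReal.ofReal_le_ofReal_iff (Real.exp_pos _).le, Real.exp_le_exp] at h4
  linarith

lemma lt_of_lik_mul_lt {v : ℝ≥0} (hv : v ≠ 0) {n : ℕ} {x : Fin n → ℝ} {θ₀ : ℕ → ℝ} {a b : ℝ}
    (h : lik v n x θ₀ * ENNReal.ofReal a ≤ lik v n x θ₀ * ENNReal.ofReal b) (hb : 0 ≤ b) :
    a ≤ b := by
  rw [ENNReal.mul_le_mul_iff_right (lik_pos v hv n x θ₀) (lik_ne_top v n x θ₀)] at h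
  exact (ENNReal.ofReal_le_ofReal_iff hb).1 h

/-- The oracle rate is either attained or dominates all level rates. -/
lemma oracleRate_cases (ε m : ℝ) (n : ℕ) (e : ℕ → ℝ) :
    (∃ k₀ ∈ levels ε n, e k₀ ≤ oracleRate ε m n e) ∨ ∀ k ∈ levels ε n, e k ≤ oracleRate ε m n e := by
  set S := {r | ∃ k ∈ levels ε n, r = e k ^ 2 ∧ m * Real.log n / n ≤ e k ^ 2} with hS
  by_cases hne : S.Nonempty
  · left
    have hfin : S.Finite := ((finite_levels ε n).image fun k => e k ^ 2).subset fun r hr => by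
      obtain ⟨k, hk, rfl, -⟩ := hr
      exact ⟨k, hk, rfl⟩
    obtain ⟨k, hk, hk2, -⟩ := hne.csInf_mem hfin
    exact ⟨k, hk, Real.le_sqrt_of_sq_le ((hk2.ge).trans (le_max_left _ _))⟩
  · right
    intro k hk
    -- Only the second entry of the maximum is used, so the value of `sInf` at the empty set is
    -- irrelevant.
    refine Real.le_sqrt_of_sq_le (le_trans ?_ (le_max_right _ _))
    by_contra! hlt
    exact hne ⟨e k ^ 2, k, hk, rfl, hlt.le⟩

/-- A gap of one in the exponent absorbs the factor `2`, because `exp w > w + 1 ≥ 2`. -/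
lemma two_mul_exp_lt {a b w : ℝ} (hab : b + 1 ≤ a) (hw : 1 ≤ w) :
    2 * Real.exp (-(a * w)) < Real.exp (-(b * w)) := by
  have h1 : Real.exp (-(b * w)) = Real.exp (-((b + 1) * w)) * Real.exp w := by
    rw [← Real.exp_add]; congr 1; ring
  have h2 : Real.exp (-(a * w)) ≤ Real.exp (-((b + 1) * w)) := Real.exp_le_exp.2 (by nlinarith)
  have h3 : w + 1 < Real.exp w := Real.add_one_lt_exp (by linarith)
  rw [h1]
  nlinarith [Real.exp_pos (-((b + 1) * w))]

/-- On the good event the marginal likelihood at every level, relative to the truth, lies between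
`exp(-b n ε_n(k)²)` and `2 exp(-a n ε_n(k)²)`. If the maximizer had a level rate above `M` times
that of a level `k₀` below the oracle rate, then maximality would contradict `a M ≥ b + 1`. If no
such `k₀` exists, all level rates are below the oracle rate, and `M ≥ 1` suffices. -/
lemma tendsto_mmle_mem_oracleSet {v : ℝ≥0} (hv : v ≠ 0) {g : ℝ → ℝ} (hg : IsSieveDensity g)
    {ε : ℝ} (hε0 : 0 < ε) (hε : ε ≤ 1) {khat : (n : ℕ) → (Fin n → ℝ) → ℕ}
    (hk : IsMMLE v g ε khat) {B A : ℝ} {θ : ℕ → ℕ → ℝ}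
    (hreg : ∀ᶠ n in atTop, IsRegular B A n (θ n)) {K : ℝ} (hK : 0 < K) {e : ℕ → ℕ → ℝ}
    (he : ∀ n, IsLevelRate g ε K n (θ n) (e n)) {M m : ℕ → ℝ} (hM : Tendsto M atTop atTop) :
    Tendsto (fun n => dataLaw v n (θ n) {x | khat n x ∈ oracleSet ε (M n) (m n) n (e n)})
      atTop (𝓝 1) := by
  have hv' : (0 : ℝ) < v := by positivity
  -- The projected noise is at most `4 v c n ε_n(k)²`, by the lower bound on the level rates. The
  -- first entry leaves half of the prior exponent; the second ensures that the noise is negligible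
  -- outside the ball of radius `K ε_n(k)`.
  obtain ⟨c, hc⟩ : ∃ c : ℝ, c = min (1 / 4) (K ^ 2 / (256 * v)) := ⟨_, rfl⟩
  have hc0 : 0 < c := by rw [hc]; exact lt_min (by norm_num) (by positivity)
  have hc1 : c ≤ 1 / 4 := by rw [hc]; exact min_le_left _ _
  have hc2 : 256 * (v * c) ≤ K ^ 2 := by
    have : c ≤ K ^ 2 / (256 * v) := by rw [hc]; exact min_le_right _ _
    rw [le_div_iff₀ (by positivity)] at this; linarith
  obtain ⟨a, ha⟩ : ∃ a : ℝ, a = min (1 / 2) (K ^ 2 / (16 * v)) := ⟨_, rfl⟩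
  have ha0 : 0 < a := by rw [ha]; exact lt_min (by norm_num) (by positivity)
  -- The fraction comes from the likelihood ratio on the ball of radius `K ε_n(k)`, and the `1` from
  -- its prior mass.
  obtain ⟨b, hb⟩ : ∃ b : ℝ, b = (8 * K ^ 2 + 4 * (v * c)) / (2 * v) + 1 := ⟨_, rfl⟩
  have hsub : ∀ᶠ n in atTop, goodEvent v c n (θ n)
      ⊆ {x | khat n x ∈ oracleSet ε (M n) (m n) n (e n)} := by
    have hMa : Tendsto (fun n => a * M n) atTop atTop := hM.const_mul_atTop ha0
    filter_upwards [hreg, eventually_le_levelRate hg B hε hK,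
      tendsto_log_natCast.eventually_gt_atTop 2,
      tendsto_log_natCast.eventually_ge_atTop (8 * A ^ 2 / K ^ 2),
      hM.eventually_ge_atTop 1, hMa.eventually_ge_atTop (b + 1), eventually_gt_atTop 0,
      tendsto_div_log.eventually_ge_atTop (2 / ε)]
      with n hreg hrate hlog hlogA hM1 hMb hn hy x hx
    have hn' : (0 : ℝ) < n := by exact_mod_cast hn
    have hrate := hrate (θ n) hreg.bdd hreg.summable (e n) (he n)
    rw [div_le_iff₀ (by positivity)] at hlogA
    have hne : (levels ε n).Nonempty := by
      refine ⟨2, le_rfl, ?_⟩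
      rw [div_le_iff₀ hε0] at hy
      push_cast
      rw [mul_div_assoc]; linarith
    obtain ⟨hmem, hmax⟩ := (hk n).2 hne x
    have key : ∀ k ∈ levels ε n, 1 ≤ n * e n k ^ 2 ∧ 4 * A ^ 2 ≤ n * (K * e n k) ^ 2 ∧
        projNoise n k (θ n) x ≤ 4 * (v * c) * (n * e n k ^ 2) ∧ k < n := by
      intro k hkl
      have h1 := hrate k hkl
      have hk2 : (2 : ℝ) ≤ k := by exact_mod_cast hkl.1
      have h2 : Real.log n / 2 ≤ n * e n k ^ 2 := by nlinarith
      refine ⟨by linarith, ?_, ?_, lt_of_mul_log_le (by linarith) (by have := hkl.1; omega)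
        (levels_mul_log_le hε (by linarith) hkl)⟩
      · have := mul_le_mul_of_nonneg_left h2 (sq_nonneg K)
        nlinarith
      · have h3 := hx k hkl.1
        have h4 : v * c * (k * Real.log n / 4) ≤ v * c * (n * e n k ^ 2) := by gcongr
        linarith
    have hup : ∀ k ∈ levels ε n, marginal v n (sievePrior g k) x
        ≤ lik v n x (θ n) * ENNReal.ofReal (2 * Real.exp (-(a * (n * e n k ^ 2)))) := by
      intro k hkl
      obtain ⟨h1, h2, h3, h4⟩ := key k hkl
      obtain ⟨hpos, heq⟩ := he n k hkl
      have hw : 0 < n * e n k ^ 2 := by linarith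
      have h5 : n * (K * e n k) ^ 2 = K ^ 2 * (n * e n k ^ 2) := by ring
      have h6 := marginal_le_of_ball hv hg hreg h4 (by positivity : 0 ≤ K * e n k) h2
        (by rw [h5]; nlinarith) heq.le
      refine h6.trans (mul_le_mul_right (ENNReal.ofReal_le_ofReal ?_) _)
      rw [two_mul (Real.exp _)]
      refine add_le_add (Real.exp_le_exp.2 ?_) (Real.exp_le_exp.2 ?_)
      · have h7 : projNoise n k (θ n) x / (2 * v) ≤ n * e n k ^ 2 / 2 := by
          rw [div_le_iff₀ (by positivity)]
          have : 4 * (v * c) * (n * e n k ^ 2) ≤ v * (n * e n k ^ 2) := by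
            refine mul_le_mul_of_nonneg_right ?_ hw.le
            nlinarith
          linarith
        have h8 : a * (n * e n k ^ 2) ≤ 1 / 2 * (n * e n k ^ 2) :=
          mul_le_mul_of_nonneg_right (by rw [ha]; exact min_le_left _ _) hw.le
        linarith
      · have h8 : a * (n * e n k ^ 2) ≤ K ^ 2 / (16 * v) * (n * e n k ^ 2) :=
          mul_le_mul_of_nonneg_right (by rw [ha]; exact min_le_right _ _) hw.le
        rw [h5, mul_div_right_comm]
        linarith
    have hlow : ∀ k ∈ levels ε n, lik v n x (θ n) *
        ENNReal.ofReal (Real.exp (-(b * (n * e n k ^ 2)))) ≤ marginal v n (sievePrior g k) x := by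
      intro k hkl
      obtain ⟨h1, h2, h3, h4⟩ := key k hkl
      obtain ⟨hpos, heq⟩ := he n k hkl
      have hmeas : MeasurableSet (extendZero k ⁻¹' {η | seqDist η (θ n) ≤ K * e n k}) :=
        measurableSet_le (measurable_seqDist_extendZero k (summable_sq_of_summable_abs hreg.summable))
          measurable_const
      have h5 := le_marginal_of_subset_ball hv g x hreg h4 (by positivity : 0 ≤ K * e n k)
        (by nlinarith [sq_nonneg A]) hmeas fun u hu => hu
      refine le_trans ?_ h5
      rw [heq, mul_assoc, ← ENNReal.ofReal_mul (Real.exp_pos _).le, ← Real.exp_add]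
      refine mul_le_mul_right (ENNReal.ofReal_le_ofReal (Real.exp_le_exp.2 ?_)) _
      have h6 : (8 * (n * (K * e n k) ^ 2) + projNoise n k (θ n) x) / (2 * v)
          ≤ (8 * K ^ 2 + 4 * (v * c)) / (2 * v) * (n * e n k ^ 2) := by
        rw [div_mul_eq_mul_div]
        refine div_le_div_of_nonneg_right ?_ (by positivity)
        linarith
      rw [hb]; linarith
    refine ⟨hmem, ?_⟩
    rcases oracleRate_cases ε (m n) n (e n) with ⟨k₀, hk₀, hle⟩ | hall
    · by_contra! hlt
      have hpos₀ := (he n k₀ hk₀).1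
      have h1 := ((hlow k₀ hk₀).trans (hmax k₀ hk₀)).trans (hup _ hmem)
      have h2 := lt_of_lik_mul_lt hv h1 (by positivity)
      have h3 : M n * e n k₀ ≤ e n (khat n x) :=
        (mul_le_mul_of_nonneg_left hle (by linarith)).trans hlt.le
      -- Squaring yields the factor `M²`; for `M ≥ 1` the weaker factor `M` is sufficient, as it
      -- also tends to infinity.
      have h4 : M n * (n * e n k₀ ^ 2) ≤ n * e n (khat n x) ^ 2 := by
        have h5 := pow_le_pow_left₀ (by positivity) h3 2
        rw [mul_pow] at h5
        have h6 : M n ≤ M n ^ 2 := by nlinarith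
        have h7 : M n * e n k₀ ^ 2 ≤ M n ^ 2 * e n k₀ ^ 2 := by gcongr
        calc M n * (n * e n k₀ ^ 2) = n * (M n * e n k₀ ^ 2) := by ring
          _ ≤ n * e n (khat n x) ^ 2 := mul_le_mul_of_nonneg_left (h7.trans h5) hn'.le
      have h5 := two_mul_exp_lt hMb (key k₀ hk₀).1
      have h6 : Real.exp (-(a * (n * e n (khat n x) ^ 2)))
          ≤ Real.exp (-(a * M n * (n * e n k₀ ^ 2))) := by
        refine Real.exp_le_exp.2 (neg_le_neg ?_)
        rw [mul_assoc]
        exact mul_le_mul_of_nonneg_left h4 ha0.le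
      linarith
    · have h1 := hall _ hmem
      have h2 := (he n _ hmem).1
      nlinarith
  have hgood : Tendsto (fun n => dataLaw v n (θ n) (goodEvent v c n (θ n))ᶜ) atTop (𝓝 0) := by
    rw [ENNReal.tendsto_nhds_zero]
    intro δ hδ
    filter_upwards [eventually_measure_compl_goodEvent_le v hv hc0 hδ.ne'] with n hn
    exact hn _
  have hgood' : Tendsto (fun n => 1 - dataLaw v n (θ n) (goodEvent v c n (θ n))ᶜ) atTop (𝓝 1) := by
    simpa using ENNReal.Tendsto.sub tendsto_const_nhds hgood (Or.inl ENNReal.one_ne_top)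
  refine tendsto_of_tendsto_of_tendsto_of_le_of_le' hgood' tendsto_const_nhds ?_
    (Eventually.of_forall fun n => prob_le_one)
  filter_upwards [hsub] with n hn
  refine le_trans ?_ (measure_mono hn)
  rw [← prob_compl_eq_one_sub (measurableSet_goodEvent _ _ _ _).compl, compl_compl]

/-! ### Control of posterior probabilities -/

lemma posteriorProb_le_one (v : ℝ≥0) (n : ℕ) (Q : Measure (ℕ → ℝ)) (x : Fin n → ℝ)
    (B : Set (ℕ → ℝ)) : posteriorProb v n Q x B ≤ 1 := by
  rw [posteriorProb, marginal]
  exact (ENNReal.div_le_div_right (setLIntegral_le_lintegral _ _) _).trans ENNReal.div_self_le_one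

/-- Only the event has to be measurable. This matters because the posterior probability of an
arbitrary set need not be a measurable function of the data. -/
lemma lintegral_le_measure_compl_add {α : Type*} [MeasurableSpace α] (P : Measure α)
    {f h : α → ℝ≥0∞} {G : Set α} (hG : MeasurableSet G) (h1 : ∀ x, f x ≤ 1)
    (hf : ∀ x ∈ G, f x ≤ h x) : ∫⁻ x, f x ∂P ≤ P Gᶜ + ∫⁻ x, h x ∂P := by
  calc ∫⁻ x, f x ∂P ≤ ∫⁻ x, (Gᶜ.indicator 1 x + h x) ∂P := by
        refine lintegral_mono fun x => ?_
        by_cases hx : x ∈ G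
        · exact (hf x hx).trans le_add_self
        · have : Gᶜ.indicator (1 : α → ℝ≥0∞) x = 1 := Set.indicator_of_mem hx _
          simp only [this]
          exact (h1 x).trans le_self_add
    _ = _ := by
        rw [lintegral_add_left (measurable_one.indicator hG.compl), lintegral_indicator_one hG.compl]

/-- The common content of contraction and sharpness: a set whose likelihood is small on the sieves
of moderate dimension has small posterior probability. -/
def PosteriorControl (v : ℝ≥0) (proj : Prop) (L β₁ β₂ : ℝ)
    (post : (n : ℕ) → (Fin n → ℝ) → Set (ℕ → ℝ) → ℝ≥0∞) : Prop :=
  ∃ T C : ℝ, 0 < T ∧ 0 < C ∧ ∀ δ : ℝ, 0 < δ → ∀ᶠ n : ℕ in atTop, ∀ β ∈ Set.Icc β₁ β₂,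
    ∀ θ ∈ hyperrect β L ∪ sobolev β L, ∀ (B : Set (ℕ → ℝ)) (η : ℝ), 0 ≤ η →
      (∀ x ∈ goodEvent v (noiseConst v) n (truth proj n θ), ∀ k : ℕ, 2 ≤ k →
        (k : ℝ) ≤ T * effDim β n → ∀ u : Fin k → ℝ, extendZero k u ∈ B →
          lik v n x (extendZero k u) ≤ lik v n x (truth proj n θ) * ENNReal.ofReal η) →
      η * Real.exp (C * (effDim β n * Real.log n)) ≤ δ →
      ∫⁻ x, post n x B ∂(dataLaw v n (truth proj n θ)) ≤ ENNReal.ofReal (4 * δ)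

/-- A level of the order of the effective dimension whose marginal likelihood is large, and the
decay of the marginal likelihoods at large levels. -/
lemma exists_marginal_bounds {v : ℝ≥0} (hv : v ≠ 0) {g : ℝ → ℝ} (hg : IsSieveDensity g)
    {β₁ β₂ L ε : ℝ} (proj : Prop) (hβ₁ : 0 < β₁) (hβ : β₁ ≤ β₂) (hL : 0 < L)
    (hproj : proj ∨ 1 / 2 < β₁) (hε0 : 0 < ε) (hε : ε ≤ 1) :
    ∃ C, 0 < C ∧ ∀ᶠ n : ℕ in atTop, ∀ β ∈ Set.Icc β₁ β₂, ∀ θ ∈ hyperrect β L ∪ sobolev β L,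
      ∀ x ∈ goodEvent v (noiseConst v) n (truth proj n θ),
        (∃ k ∈ levels ε n, effDim β n ≤ k ∧ k ≤ 2 * effDim β n ∧
          lik v n x (truth proj n θ) *
            ENNReal.ofReal (Real.exp (-(C * (effDim β n * Real.log n))))
            ≤ marginal v n (sievePrior g k) x) ∧
        ∀ k : ℕ, 2 ≤ k → k * Real.log n ≤ n → marginal v n (sievePrior g k) x ≤
          lik v n x (truth proj n θ) *
            ENNReal.ofReal (2 * Real.exp (-(decayConst v * (k * Real.log n)))) := by
  obtain ⟨A, -, hreg⟩ := exists_isRegular_truth proj hβ₁ hL hproj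
  obtain ⟨C, hC, hlow⟩ := exists_le_marginal hv hg A hβ₁ hβ hL
  refine ⟨C, hC, ?_⟩
  filter_upwards [hlow, eventually_marginal_le hv hg √L A, eventually_le_effDim hβ₁ hβ 2,
    eventually_mul_effDim_le hβ₁ hε0 2, eventually_ge_atTop 2,
    tendsto_log_natCast.eventually_gt_atTop 0] with n h1 h2 h3 h4 hn hlog β hβm θ hθ x hx
  have hr := hreg n hn β hβm.1 θ hθ
  refine ⟨?_, fun k hk hkn => h2 _ hr x hx k hk hkn⟩
  have hX := h3 β hβm
  have hXk := Nat.le_ceil (effDim β n)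
  have hkX : ((⌈effDim β n⌉₊ : ℕ) : ℝ) ≤ 2 * effDim β n := by
    have := Nat.ceil_lt_add_one (by linarith : 0 ≤ effDim β n)
    linarith
  have hk2 : 2 ≤ ⌈effDim β n⌉₊ := by
    have : (2 : ℝ) ≤ (⌈effDim β n⌉₊ : ℕ) := hX.trans hXk
    exact_mod_cast this
  have hmem : ⌈effDim β n⌉₊ ∈ levels ε n := ⟨hk2, by
    rw [mul_div_assoc]; exact hkX.trans (h4 β hβm.1)⟩
  exact ⟨_, hmem, hXk, hkX, h1 β hβm _ (truth_mem proj n hθ) hr x hx _ hk2 hXk hkX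
    (levels_mul_log_le hε hlog hmem)⟩

lemma lik_mul_div_lik_mul {v : ℝ≥0} (hv : v ≠ 0) {n : ℕ} (x : Fin n → ℝ) (θ₀ : ℕ → ℝ) (a : ℝ≥0∞)
    (q : ℝ) : (lik v n x θ₀ * a) / (lik v n x θ₀ * ENNReal.ofReal (Real.exp (-q)))
      = a * ENNReal.ofReal (Real.exp q) := by
  rw [ENNReal.mul_div_mul_left _ _ (lik_pos v hv n x θ₀) (lik_ne_top v n x θ₀), div_eq_mul_inv,
    ← ENNReal.ofReal_inv_of_pos (Real.exp_pos _), ← Real.exp_neg, neg_neg]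

/-- By maximality the selected marginal likelihood is at least that of a level near `X = effDim β
n`. Comparison with the decay at large levels forces the selected level below `T X`, so the
numerator is controlled by `η`. The denominator costs `exp(C X log n)`. -/
lemma posteriorControl_mmle {v : ℝ≥0} (hv : v ≠ 0) {g : ℝ → ℝ} (hg : IsSieveDensity g)
    {β₁ β₂ L ε : ℝ} (proj : Prop) (hβ₁ : 0 < β₁) (hβ : β₁ ≤ β₂) (hL : 0 < L)
    (hproj : proj ∨ 1 / 2 < β₁) (hε0 : 0 < ε) (hε : ε ≤ 1) {khat : (n : ℕ) → (Fin n → ℝ) → ℕ}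
    (hk : IsMMLE v g ε khat) :
    PosteriorControl v proj L β₁ β₂ fun n x => posteriorProb v n (sievePrior g (khat n x)) x := by
  obtain ⟨C, hC, hbd⟩ := exists_marginal_bounds hv hg proj hβ₁ hβ hL hproj hε0 hε
  have ha := decayConst_pos hv
  -- Beyond this multiple of `X` the upper bound `2 exp(-decayConst · k log n)` falls below `exp(-C
  -- X log n)`.
  refine ⟨(C + 1) / decayConst v, C, by positivity, hC, fun δ hδ => ?_⟩
  filter_upwards [hbd, eventually_measure_compl_goodEvent_le v hv (noiseConst_pos hv)
    (ENNReal.ofReal_pos.2 hδ).ne', eventually_le_effDim hβ₁ hβ 1,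
    tendsto_log_natCast.eventually_gt_atTop 1] with n hbd hgood hX1 hlog β hβm θ hθ B η hη hB hηδ
  set θ₀ := truth proj n θ
  have hX := hX1 β hβm
  set X := effDim β n
  have hXl : 1 ≤ X * Real.log n := by nlinarith
  have hpost : ∀ x ∈ goodEvent v (noiseConst v) n θ₀,
      posteriorProb v n (sievePrior g (khat n x)) x B ≤ ENNReal.ofReal δ := by
    intro x hx
    obtain ⟨⟨k, hkl, -, -, hlow⟩, hup⟩ := hbd β hβm θ hθ x hx
    obtain ⟨hmem, hmax⟩ := (hk n).2 ⟨k, hkl⟩ x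
    have hlow' := hlow.trans (hmax k hkl)
    have hkn := levels_mul_log_le hε (by linarith) hmem
    have hsmall : (khat n x : ℝ) ≤ (C + 1) / decayConst v * X := by
      by_contra! hlt
      have h1 := lt_of_lik_mul_lt hv (hlow'.trans (hup _ hmem.1 hkn)) (by positivity)
      have h2 : Real.exp (-(decayConst v * (khat n x * Real.log n)))
          ≤ Real.exp (-((C + 1) * (X * Real.log n))) := by
        refine Real.exp_le_exp.2 (neg_le_neg ?_)
        rw [div_mul_eq_mul_div, div_lt_iff₀ ha] at hlt
        nlinarith
      have h3 := two_mul_exp_lt (le_refl (C + 1)) hXl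
      linarith
    have := hg.isProbabilityMeasure_sievePrior (khat n x)
    have hnum := (setLIntegral_sievePrior_le g (khat n x) fun u hu =>
      hB x hx _ hmem.1 hsmall u hu).trans (mul_le_of_le_one_right' prob_le_one)
    calc posteriorProb v n (sievePrior g (khat n x)) x B
        ≤ (lik v n x θ₀ * ENNReal.ofReal η)
          / (lik v n x θ₀ * ENNReal.ofReal (Real.exp (-(C * (X * Real.log n))))) :=
          ENNReal.div_le_div hnum hlow'
      _ = ENNReal.ofReal (η * Real.exp (C * (X * Real.log n))) := by
          rw [lik_mul_div_lik_mul hv, ENNReal.ofReal_mul hη]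
      _ ≤ ENNReal.ofReal δ := ENNReal.ofReal_le_ofReal hηδ
  calc ∫⁻ x, posteriorProb v n (sievePrior g (khat n x)) x B ∂(dataLaw v n θ₀)
      ≤ dataLaw v n θ₀ (goodEvent v (noiseConst v) n θ₀)ᶜ
        + ∫⁻ _x, ENNReal.ofReal δ ∂(dataLaw v n θ₀) :=
        lintegral_le_measure_compl_add _ (measurableSet_goodEvent _ _ _ _)
          (fun x => posteriorProb_le_one _ _ _ _ _) hpost
    _ ≤ ENNReal.ofReal δ + ENNReal.ofReal δ := by
        refine add_le_add (hgood θ₀) ?_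
        simp
    _ ≤ ENNReal.ofReal (4 * δ) := by
        rw [← ENNReal.ofReal_add hδ.le hδ.le]
        exact ENNReal.ofReal_le_ofReal (by linarith)

/-! ### The hierarchical prior -/

lemma setLIntegral_hierPrior (g : ℝ → ℝ) (π : ℕ → ℝ) (B : Set (ℕ → ℝ)) (f : (ℕ → ℝ) → ℝ≥0∞) :
    ∫⁻ θ in B, f θ ∂(hierPrior g π)
      = ∑' k, ENNReal.ofReal (π k) * ∫⁻ θ in B, f θ ∂(sievePrior g k) := by
  rw [hierPrior, Measure.restrict_sum_of_countable, lintegral_sum_measure]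
  congr 1
  ext k
  rw [Measure.restrict_smul, lintegral_smul_measure, smul_eq_mul]

lemma le_marginal_hierPrior (v : ℝ≥0) (n : ℕ) (g : ℝ → ℝ) (π : ℕ → ℝ) (x : Fin n → ℝ) (k : ℕ) :
    ENNReal.ofReal (π k) * marginal v n (sievePrior g k) x ≤ marginal v n (hierPrior g π) x := by
  have h := setLIntegral_hierPrior g π Set.univ (lik v n x)
  simp only [Measure.restrict_univ] at h
  simp only [marginal]
  rw [h]
  exact ENNReal.le_tsum k

lemma measurable_lik_extendZero (v : ℝ≥0) (n k : ℕ) :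
    Measurable fun p : (Fin n → ℝ) × (Fin k → ℝ) => lik v n p.1 (extendZero k p.2) := by
  unfold lik gaussianPDF gaussianPDFReal
  simp_rw [regFun_extendZero]
  fun_prop

/-- Fubini and the unit mean of the likelihood ratio. This holds for every `k`, in particular for
those where the norms on the design and in `ℓ₂` are not comparable. -/
lemma lintegral_marginal_div_lik {v : ℝ≥0} (hv : v ≠ 0) {g : ℝ → ℝ} (hg : IsSieveDensity g)
    (n k : ℕ) (θ₀ : ℕ → ℝ) :
    ∫⁻ x, marginal v n (sievePrior g k) x / lik v n x θ₀ ∂(dataLaw v n θ₀) = 1 := by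
  have := hg.isProbabilityMeasure_blockLaw k
  have hm := measurable_lik_extendZero v n k
  have hm₀ : Measurable fun x : Fin n → ℝ => lik v n x θ₀ := by
    unfold lik gaussianPDF gaussianPDFReal
    fun_prop
  have e : ∀ x, marginal v n (sievePrior g k) x / lik v n x θ₀
      = ∫⁻ u, lik v n x (extendZero k u) / lik v n x θ₀ ∂(blockLaw g k) := fun x => by
    simp only [marginal, lintegral_sievePrior, div_eq_mul_inv]
    rw [lintegral_mul_const']
    exact ENNReal.inv_ne_top.2 (lik_pos v hv n x θ₀)
  simp_rw [e]
  rw [lintegral_lintegral_swap]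
  · simp_rw [lintegral_lik_div_lik v hv]
    simp
  · exact (hm.div (hm₀.comp measurable_fst)).aemeasurable

lemma measurable_marginal (v : ℝ≥0) {g : ℝ → ℝ} (hg : IsSieveDensity g) (n k : ℕ) :
    Measurable fun x => marginal v n (sievePrior g k) x := by
  have := hg.isProbabilityMeasure_blockLaw k
  simp only [marginal, lintegral_sievePrior]
  exact (measurable_lik_extendZero v n k).lintegral_prod_right'

lemma IsHyperPrior.tsum_ofReal {β₀ : ℝ} {π : ℕ → ℝ} (h : IsHyperPrior β₀ π) :
    ∑' k, ENNReal.ofReal (π k) = 1 := by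
  rw [← ENNReal.ofReal_tsum_of_nonneg h.nonneg h.hasSum.summable, h.hasSum.tsum_eq,
    ENNReal.ofReal_one]

/-- The hyperprior mass of the levels of the order of the effective dimension. -/
lemma IsHyperPrior.exists_le {β₀ : ℝ} {π : ℕ → ℝ} (h : IsHyperPrior β₀ π) {β₁ β₂ : ℝ}
    (hβ₁ : 0 < β₁) (hβ : β₁ ≤ β₂) :
    ∃ c, 0 < c ∧ ∀ᶠ n : ℕ in atTop, ∀ β ∈ Set.Icc β₁ β₂, ∀ k : ℕ, effDim β n ≤ k →
      k ≤ 2 * effDim β n → k ≤ n → Real.exp (-(c * (effDim β n * Real.log n))) ≤ π k := by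
  obtain ⟨c₂, C, hc₂, hC, hlow⟩ := h.lower
  obtain ⟨K, hK⟩ := eventually_atTop.1 hlow
  -- For `k ≤ 2X` and `k ≤ n` the lower bound is at least `exp(-2 c₂ X log n)`; the additional `1`
  -- absorbs the constant `C`.
  refine ⟨2 * c₂ + 1, by positivity, ?_⟩
  filter_upwards [eventually_le_effDim hβ₁ hβ (max K 1), tendsto_log_natCast.eventually_gt_atTop 0,
    tendsto_log_natCast.eventually_ge_atTop (Real.log C)] with n hX hlog hlogC β hβm k hXk hkX hkn
  have hXK := hX β hβm
  set X := effDim β n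
  have hX1 : 1 ≤ X := (le_max_right _ _).trans hXK
  have hkK : K ≤ k := by
    have : (K : ℝ) ≤ k := (le_max_left _ _).trans (hXK.trans hXk)
    exact_mod_cast this
  have hk1 : (1 : ℝ) ≤ k := hX1.trans hXk
  have hk0 : (0 : ℝ) < k := by linarith
  have h1 := hK k hkK
  rw [Real.rpow_def_of_pos hk0] at h1
  have h2 : Real.log k ≤ Real.log n := Real.log_le_log hk0 (by exact_mod_cast hkn)
  have h3 : Real.log k * (k : ℝ) ≤ Real.log n * (2 * X) :=
    mul_le_mul h2 hkX hk0.le hlog.le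
  have h4 : Real.exp (-(2 * c₂ * (X * Real.log n))) ≤ Real.exp (Real.log k * -(c₂ * k)) := by
    refine Real.exp_le_exp.2 ?_
    nlinarith
  have h5 : C * Real.exp (-(X * Real.log n)) ≤ 1 := by
    rw [← Real.exp_log hC, ← Real.exp_add]
    refine Real.exp_le_one_iff.2 ?_
    nlinarith
  have h6 : Real.exp (-((2 * c₂ + 1) * (X * Real.log n)))
      = Real.exp (-(2 * c₂ * (X * Real.log n))) * Real.exp (-(X * Real.log n)) := by
    rw [← Real.exp_add]; congr 1; ring
  rw [h6]
  have hπ := h.nonneg k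
  calc _ ≤ C * π k * Real.exp (-(X * Real.log n)) :=
        mul_le_mul_of_nonneg_right (h4.trans h1) (Real.exp_pos _).le
    _ = π k * (C * Real.exp (-(X * Real.log n))) := by ring
    _ ≤ π k * 1 := mul_le_mul_of_nonneg_left h5 hπ
    _ = π k := mul_one _

/-- The hyperprior mass of the levels that are too large to be identifiable. -/
lemma IsHyperPrior.eventually_tail_le {β₀ : ℝ} {π : ℕ → ℝ} (h : IsHyperPrior β₀ π) (hβ₀ : 0 ≤ β₀)
    {β₁ : ℝ} (hβ₁ : β₀ < β₁) {C : ℝ} (hC : 0 < C) {δ : ℝ} (hδ : 0 < δ) :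
    ∀ᶠ n : ℕ in atTop, ∀ β, β₁ ≤ β →
      ENNReal.ofReal (Real.exp (C * (effDim β n * Real.log n))) *
        ∑' k : ℕ, (if (n : ℝ) < k * Real.log n then ENNReal.ofReal (π k) else 0)
        ≤ ENNReal.ofReal δ := by
  obtain ⟨c₁, Cπ, hc₁, hCπ, hup⟩ := h.upper
  have hβ₁' : 0 < β₁ := by linarith
  obtain ⟨s, hs⟩ : ∃ s : ℝ, s = 1 / (1 + 2 * β₀) := ⟨_, rfl⟩
  obtain ⟨s₁, hs₁⟩ : ∃ s₁ : ℝ, s₁ = 1 / (2 * β₁ + 1) := ⟨_, rfl⟩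
  have hs0 : 0 < s := by rw [hs]; positivity
  have hss : s₁ < s := by
    rw [hs, hs₁]; exact one_div_lt_one_div_of_lt (by linarith) (by linarith)
  have hs₁0 : 0 < s₁ := by rw [hs₁]; positivity
  rw [← hs] at hup
  obtain ⟨K, hK⟩ := eventually_atTop.1
    -- Half of the exponent `c₁ k^s` is spent on a summable factor `k^(-2)`; the other half remains
    -- as `exp(-(c₁/2) y^s)`, with `y = n / log n < k`.
    (hup.and (eventually_mul_log_le_rpow (4 / c₁) hs0))
  have hZ : Summable fun k : ℕ => (k : ℝ) ^ (-2 : ℝ) := Real.summable_nat_rpow.2 (by norm_num)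
  obtain ⟨Z, hZdef⟩ : ∃ Z : ℝ, Z = ∑' k : ℕ, (k : ℝ) ^ (-2 : ℝ) := ⟨_, rfl⟩
  have hZ0 : 0 ≤ Z := by rw [hZdef]; exact tsum_nonneg fun k => by positivity
  have hlin : Tendsto (fun n : ℕ => δ * (n : ℝ)) atTop atTop :=
    tendsto_natCast_atTop_atTop.const_mul_atTop hδ
  filter_upwards [tendsto_div_log.eventually_ge_atTop (max K 1),
    tendsto_log_natCast.eventually_gt_atTop 0, eventually_gt_atTop 0,
    eventually_rpow_half_le_div_log, hlin.eventually_ge_atTop (Cπ * Z),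
    eventually_mul_log_le_rpow (2 / c₁ * (C + 1)) (by linarith : 0 < (s - s₁) / 2)]
    with n hy hlog hn hhalf hlin hexp β hβ
  have hn' : (0 : ℝ) < n := by exact_mod_cast hn
  obtain ⟨y, hydef⟩ : ∃ y : ℝ, y = (n : ℝ) / Real.log n := ⟨_, rfl⟩
  rw [← hydef] at hy hhalf
  have hy1 : 1 ≤ y := (le_max_right _ _).trans hy
  have hy0 : 0 < y := by linarith
  have hterm : ∀ k : ℕ, (if (n : ℝ) < k * Real.log n then ENNReal.ofReal (π k) else 0)
      ≤ ENNReal.ofReal (Cπ * Real.exp (-(c₁ / 2 * y ^ s)) * (k : ℝ) ^ (-2 : ℝ)) := fun k => by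
    split_ifs with hk
    · have hyk : y < k := by rwa [hydef, div_lt_iff₀ hlog]
      have hkK : K ≤ k := by
        have : (K : ℝ) ≤ k := (le_max_left _ _).trans (hy.trans hyk.le)
        exact_mod_cast this
      have hk0 : (0 : ℝ) < k := hy0.trans hyk
      obtain ⟨h1, h2⟩ := hK k hkK
      refine ENNReal.ofReal_le_ofReal (h1.trans ?_)
      rw [mul_assoc, Real.rpow_def_of_pos hk0 (-2), ← Real.exp_add]
      refine mul_le_mul_of_nonneg_left (Real.exp_le_exp.2 ?_) hCπ.le
      have h3 : y ^ s ≤ (k : ℝ) ^ s := Real.rpow_le_rpow hy0.le hyk.le hs0.le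
      have h4 : c₁ * (4 / c₁ * Real.log k) ≤ c₁ * (k : ℝ) ^ s := by gcongr
      have h5 : c₁ * (4 / c₁ * Real.log k) = 4 * Real.log k := by field_simp
      nlinarith
    · exact zero_le
  -- This is where `β₀ < β₁` enters: `effDim β n ≤ y^s₁` with `s₁ < s`, and the surplus `y^(s - s₁)`
  -- dominates `log n`.
  have hmain : C * (effDim β n * Real.log n) - c₁ / 2 * y ^ s ≤ -Real.log n := by
    have h1 : effDim β n ≤ y ^ s₁ := by
      have := effDim_le hβ₁' hβ (n := n) (by rw [← hydef]; exact hy1)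
      rwa [← hydef, ← hs₁] at this
    have h2 : 2 / c₁ * (C + 1) * Real.log n ≤ y ^ (s - s₁) := by
      refine hexp.trans ?_
      calc (n : ℝ) ^ ((s - s₁) / 2) = ((n : ℝ) ^ (1 / 2 : ℝ)) ^ (s - s₁) := by
            rw [← Real.rpow_mul hn'.le]; congr 1; ring
        _ ≤ y ^ (s - s₁) := Real.rpow_le_rpow (by positivity) hhalf (by linarith)
    have h3 : y ^ s = y ^ (s - s₁) * y ^ s₁ := by rw [← Real.rpow_add hy0]; congr 1; ring
    have h4 : 1 ≤ y ^ s₁ := Real.one_le_rpow hy1 hs₁0.le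
    have h5 : c₁ / 2 * (2 / c₁ * (C + 1) * Real.log n * y ^ s₁) ≤ c₁ / 2 * y ^ s := by
      rw [h3]; gcongr
    have h6 : c₁ / 2 * (2 / c₁ * (C + 1) * Real.log n * y ^ s₁) = (C + 1) * (y ^ s₁ * Real.log n) := by
      field_simp
    have h7 : C * (effDim β n * Real.log n) ≤ C * (y ^ s₁ * Real.log n) := by gcongr
    have h8 : Real.log n ≤ y ^ s₁ * Real.log n := le_mul_of_one_le_left hlog.le h4
    linarith
  calc _ ≤ ENNReal.ofReal (Real.exp (C * (effDim β n * Real.log n))) *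
        ∑' k : ℕ, ENNReal.ofReal (Cπ * Real.exp (-(c₁ / 2 * y ^ s)) * (k : ℝ) ^ (-2 : ℝ)) :=
        mul_le_mul_right (ENNReal.tsum_le_tsum hterm) _
    _ = ENNReal.ofReal (Real.exp (C * (effDim β n * Real.log n) - c₁ / 2 * y ^ s) * (Cπ * Z)) := by
        rw [← ENNReal.ofReal_tsum_of_nonneg (fun k => by positivity) (hZ.mul_left _), tsum_mul_left,
          ← hZdef, ← ENNReal.ofReal_mul (Real.exp_pos _).le, sub_eq_add_neg, Real.exp_add]
        congr 1; ring
    _ ≤ ENNReal.ofReal δ := by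
        refine ENNReal.ofReal_le_ofReal ?_
        calc _ ≤ Real.exp (-Real.log n) * (Cπ * Z) := by gcongr
          _ ≤ Real.exp (-Real.log n) * (δ * n) := by gcongr
          _ = δ := by rw [Real.exp_neg, Real.exp_log hn']; field_simp

/-- The numerator is split by level. Up to `T X` the assumption on the set gives `η`; from there up
to `n / log n` the decay of the marginal likelihoods gives a negligible `η'`; beyond, the likelihood
ratio is controlled only in mean, by the hyperprior tail. The denominator is bounded below by a
single level near `X`, at the additional cost of its hyperprior weight. -/
lemma posteriorControl_hier {v : ℝ≥0} (hv : v ≠ 0) {g : ℝ → ℝ} (hg : IsSieveDensity g)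
    {β₀ β₁ β₂ L : ℝ} (proj : Prop) (hβ₀ : 0 ≤ β₀) (hβ₁ : β₀ < β₁) (hβ : β₁ ≤ β₂) (hL : 0 < L)
    (hproj : proj ∨ 1 / 2 < β₁) {π : ℕ → ℝ} (hπ : IsHyperPrior β₀ π) :
    PosteriorControl v proj L β₁ β₂ fun n x => posteriorProb v n (hierPrior g π) x := by
  have hβ₁' : 0 < β₁ := by linarith
  -- The value `ε = 1` is an arbitrary admissible choice: here the set of levels serves only to
  -- locate one good level.
  obtain ⟨C₁, hC₁, hbd⟩ := exists_marginal_bounds hv hg proj hβ₁' hβ hL hproj one_pos le_rfl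
  obtain ⟨c, hc, hπk⟩ := hπ.exists_le hβ₁' hβ
  have ha := decayConst_pos hv
  obtain ⟨C, hCdef⟩ : ∃ C : ℝ, C = C₁ + c := ⟨_, rfl⟩
  have hC : 0 < C := by linarith
  refine ⟨(C + 1) / decayConst v, C, by positivity, hC, fun δ hδ => ?_⟩
  have hlin : Tendsto (fun n : ℕ => δ * (n : ℝ)) atTop atTop :=
    tendsto_natCast_atTop_atTop.const_mul_atTop hδ
  filter_upwards [hbd, hπk, eventually_measure_compl_goodEvent_le v hv (noiseConst_pos hv)
    (ENNReal.ofReal_pos.2 hδ).ne', eventually_le_effDim hβ₁' hβ 1,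
    tendsto_log_natCast.eventually_gt_atTop 1, hπ.eventually_tail_le hβ₀ hβ₁ hC hδ,
    hlin.eventually_ge_atTop 2, eventually_gt_atTop 0]
    with n hbd hπk hgood hX1 hlog htail hlin hn β hβm θ hθ B η hη hB hηδ
  have hn' : (0 : ℝ) < n := by exact_mod_cast hn
  obtain ⟨θ₀, hθ₀⟩ : ∃ θ₀ : ℕ → ℝ, θ₀ = truth proj n θ := ⟨_, rfl⟩
  have hbd := hbd β hβm θ hθ
  rw [← hθ₀] at hB hbd ⊢
  have hX := hX1 β hβm
  have hπk := hπk β hβm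
  have htail := htail β hβm.1
  obtain ⟨X, hXdef⟩ : ∃ X : ℝ, X = effDim β n := ⟨_, rfl⟩
  rw [← hXdef] at hX hηδ htail hB hπk hbd
  have hXl : Real.log n ≤ X * Real.log n := le_mul_of_one_le_left (by linarith) hX
  obtain ⟨η', hη'⟩ : ∃ η' : ℝ, η' = 2 * Real.exp (-((C + 1) * (X * Real.log n))) := ⟨_, rfl⟩
  have hη'0 : 0 ≤ η' := by rw [hη']; positivity
  have hη'δ : η' * Real.exp (C * (X * Real.log n)) ≤ δ := by
    have e : η' * Real.exp (C * (X * Real.log n)) = 2 * Real.exp (-(X * Real.log n)) := by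
      rw [hη', mul_assoc, ← Real.exp_add]; congr 2; ring
    rw [e]
    calc 2 * Real.exp (-(X * Real.log n)) ≤ 2 * Real.exp (-Real.log n) := by
          gcongr
      _ = 2 / n := by rw [Real.exp_neg, Real.exp_log hn']; rfl
      _ ≤ δ := by rw [div_le_iff₀ hn']; linarith
  set tail : ℕ → (Fin n → ℝ) → ℝ≥0∞ := fun k x =>
    if (n : ℝ) < k * Real.log n then marginal v n (sievePrior g k) x / lik v n x θ₀ else 0 with htl
  set W : (Fin n → ℝ) → ℝ≥0∞ := fun x => ∑' k, ENNReal.ofReal (π k) * tail k x with hW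
  set E := ENNReal.ofReal (Real.exp (C * (X * Real.log n)))
  have htm : ∀ k, Measurable (tail k) := fun k => by
    by_cases hk : (n : ℝ) < k * Real.log n
    · simp only [htl, if_pos hk]
      refine (measurable_marginal v hg n k).div ?_
      unfold lik gaussianPDF gaussianPDFReal
      fun_prop
    · simp only [htl, if_neg hk]
      exact measurable_const
  have hnum : ∀ x ∈ goodEvent v (noiseConst v) n θ₀,
      ∫⁻ θ' in B, lik v n x θ' ∂(hierPrior g π)
        ≤ lik v n x θ₀ * (ENNReal.ofReal (η + η') + W x) := by
    intro x hx
    rw [setLIntegral_hierPrior]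
    calc _ ≤ ∑' k, (ENNReal.ofReal (π k) * (lik v n x θ₀ * ENNReal.ofReal (η + η'))
          + lik v n x θ₀ * (ENNReal.ofReal (π k) * tail k x)) := by
          refine ENNReal.tsum_le_tsum fun k => ?_
          by_cases hk2 : k < 2
          · rw [hπ.support k hk2]; simp
          push Not at hk2
          have e : ENNReal.ofReal (π k) * (lik v n x θ₀ * ENNReal.ofReal (η + η'))
              + lik v n x θ₀ * (ENNReal.ofReal (π k) * tail k x)
              = ENNReal.ofReal (π k) * (lik v n x θ₀ * (ENNReal.ofReal (η + η') + tail k x)) := by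
            ring
          rw [e]
          refine mul_le_mul_right ?_ _
          have := hg.isProbabilityMeasure_sievePrior k
          by_cases hkn : (n : ℝ) < k * Real.log n
          · simp only [htl, if_pos hkn]
            calc _ ≤ marginal v n (sievePrior g k) x := setLIntegral_le_lintegral _ _
              _ = lik v n x θ₀ * (marginal v n (sievePrior g k) x / lik v n x θ₀) :=
                (ENNReal.mul_div_cancel (lik_pos v hv n x θ₀) (lik_ne_top v n x θ₀)).symm
              _ ≤ _ := mul_le_mul_right le_add_self _
          · refine le_trans ?_ (mul_le_mul_right le_self_add _)
            by_cases hkT : (k : ℝ) ≤ (C + 1) / decayConst v * X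
            · refine (setLIntegral_sievePrior_le g k fun u hu => hB x hx k hk2 hkT u hu).trans
                ((mul_le_of_le_one_right' prob_le_one).trans ?_)
              exact mul_le_mul_right (ENNReal.ofReal_le_ofReal (by linarith)) _
            · refine (setLIntegral_le_lintegral _ _).trans
                (((hbd x hx).2 k hk2 (not_lt.1 hkn)).trans ?_)
              refine mul_le_mul_right (ENNReal.ofReal_le_ofReal ?_) _
              have h1 : 2 * Real.exp (-(decayConst v * (k * Real.log n))) ≤ η' := by
                rw [hη']
                refine mul_le_mul_of_nonneg_left (Real.exp_le_exp.2 (neg_le_neg ?_)) two_pos.le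
                rw [not_le, div_mul_eq_mul_div, div_lt_iff₀ ha] at hkT
                nlinarith
              linarith
      _ = _ := by
          rw [ENNReal.tsum_add, ENNReal.tsum_mul_right, ENNReal.tsum_mul_left, hπ.tsum_ofReal,
            one_mul, mul_add]
  have hden : ∀ x ∈ goodEvent v (noiseConst v) n θ₀,
      lik v n x θ₀ * ENNReal.ofReal (Real.exp (-(C * (X * Real.log n))))
        ≤ marginal v n (hierPrior g π) x := by
    intro x hx
    obtain ⟨k, hkl, hXk, hkX, hlow⟩ := (hbd x hx).1
    have hkn := (lt_of_mul_log_le hlog (by have := hkl.1; omega)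
      (levels_mul_log_le le_rfl (by linarith) hkl)).le
    refine le_trans ?_ (le_marginal_hierPrior v n g π x k)
    have h1 := hπk k hXk hkX hkn
    calc lik v n x θ₀ * ENNReal.ofReal (Real.exp (-(C * (X * Real.log n))))
        = ENNReal.ofReal (Real.exp (-(c * (X * Real.log n)))) * (lik v n x θ₀ *
            ENNReal.ofReal (Real.exp (-(C₁ * (X * Real.log n))))) := by
          rw [mul_left_comm (ENNReal.ofReal (Real.exp (-(c * (X * Real.log n))))) (lik v n x θ₀),
            ← ENNReal.ofReal_mul (Real.exp_pos _).le, ← Real.exp_add, hCdef]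
          congr 3; ring
      _ ≤ _ := mul_le_mul' (ENNReal.ofReal_le_ofReal h1) hlow
  have hpost : ∀ x ∈ goodEvent v (noiseConst v) n θ₀,
      posteriorProb v n (hierPrior g π) x B ≤ (ENNReal.ofReal (η + η') + W x) * E := by
    intro x hx
    refine (ENNReal.div_le_div (hnum x hx) (hden x hx)).trans_eq ?_
    rw [lik_mul_div_lik_mul hv]
  have hWint : ∫⁻ x, W x ∂(dataLaw v n θ₀)
      = ∑' k : ℕ, (if (n : ℝ) < k * Real.log n then ENNReal.ofReal (π k) else 0) := by
    rw [hW, lintegral_tsum fun k => ((htm k).const_mul _).aemeasurable]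
    congr 1
    ext k
    rw [lintegral_const_mul _ (htm k)]
    by_cases hk : (n : ℝ) < k * Real.log n
    · simp only [htl, if_pos hk]
      rw [lintegral_marginal_div_lik hv hg, mul_one]
    · simp only [htl, if_neg hk]
      simp
  calc ∫⁻ x, posteriorProb v n (hierPrior g π) x B ∂(dataLaw v n θ₀)
      ≤ dataLaw v n θ₀ (goodEvent v (noiseConst v) n θ₀)ᶜ
        + ∫⁻ x, (ENNReal.ofReal (η + η') + W x) * E ∂(dataLaw v n θ₀) :=
        lintegral_le_measure_compl_add _ (measurableSet_goodEvent _ _ _ _)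
          (fun x => posteriorProb_le_one _ _ _ _ _) hpost
    _ ≤ ENNReal.ofReal δ + (ENNReal.ofReal (2 * δ) + ENNReal.ofReal δ) := by
        refine add_le_add (hgood θ₀) ?_
        rw [lintegral_mul_const' _ _ ENNReal.ofReal_ne_top, lintegral_add_left measurable_const,
          hWint, lintegral_const, measure_univ, mul_one, add_mul, mul_comm (tsum _)]
        refine add_le_add ?_ htail
        rw [← ENNReal.ofReal_mul (by positivity)]
        exact ENNReal.ofReal_le_ofReal (by linarith)
    _ = ENNReal.ofReal (4 * δ) := by
        rw [← ENNReal.ofReal_add (by positivity) hδ.le, ← ENNReal.ofReal_add hδ.le (by positivity)]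
        congr 1; ring

/-! ### Contraction and sharpness -/

lemma exists_ofReal_four_mul_le {r : ℝ≥0∞} (hr : 0 < r) :
    ∃ δ : ℝ, 0 < δ ∧ ENNReal.ofReal (4 * δ) ≤ r := by
  obtain ⟨q, hq0, hqr⟩ := ENNReal.lt_iff_exists_nnreal_btwn.1 hr
  have hq0' : (0 : ℝ) < q := by exact_mod_cast hq0
  refine ⟨q / 4, by positivity, ?_⟩
  rw [show 4 * ((q : ℝ) / 4) = q by ring, ENNReal.ofReal_coe_nnreal]
  exact hqr.le

/-- Outside the ball of radius `M · rate` the likelihood ratio is at most `η = exp(-M² X log n /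
(16v))` on all sieves with `k ≤ T X`. As `M → ∞` this eventually beats `exp(C X log n)` with a
factor `1/n` to spare. -/
lemma PosteriorControl.tendsto_contraction {v : ℝ≥0} (hv : v ≠ 0) {proj : Prop} {L β₁ β₂ : ℝ}
    {post : (n : ℕ) → (Fin n → ℝ) → Set (ℕ → ℝ) → ℝ≥0∞}
    (h : PosteriorControl v proj L β₁ β₂ post) (hβ₁ : 0 < β₁) (hβ : β₁ ≤ β₂) (hL : 0 < L)
    (hproj : proj ∨ 1 / 2 < β₁) {M : ℕ → ℝ} (hM : Tendsto M atTop atTop) :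
    Tendsto (fun n => ⨆ β ∈ Set.Ioo β₁ β₂, ⨆ θ₀ ∈ hyperrect β L ∪ sobolev β L,
      ∫⁻ x, post n x {θ | M n * rate β n ≤ funDist (truth proj n θ₀) θ}
        ∂(dataLaw v n (truth proj n θ₀))) atTop (𝓝 0) := by
  have hv' : (0 : ℝ) < v := by positivity
  obtain ⟨A, -, hreg⟩ := exists_isRegular_truth proj hβ₁ hL hproj
  obtain ⟨T, C, hT, hC, hctrl⟩ := h
  rw [ENNReal.tendsto_nhds_zero]
  intro r hr
  obtain ⟨δ, hδ, hδr⟩ := exists_ofReal_four_mul_le hr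
  have hlin : Tendsto (fun n : ℕ => δ * (n : ℝ)) atTop atTop :=
    tendsto_natCast_atTop_atTop.const_mul_atTop hδ
  filter_upwards [hctrl δ hδ, hM.eventually_ge_atTop 1, hM.eventually_ge_atTop (4 * A ^ 2),
    hM.eventually_ge_atTop T, hM.eventually_ge_atTop (16 * v * (C + 1)),
    tendsto_log_natCast.eventually_gt_atTop 1, eventually_ge_atTop 2,
    eventually_le_effDim hβ₁ hβ 1, eventually_mul_effDim_le hβ₁ one_pos T,
    hlin.eventually_ge_atTop 1]
    with n hctrl hM1 hMA hMT hMC hlog hn hX1 hTX hlin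
  have hn' : (0 : ℝ) < n := by exact_mod_cast (by omega : 0 < n)
  refine iSup₂_le fun β hβm => iSup₂_le fun θ hθ => le_trans ?_ hδr
  have hβc : β ∈ Set.Icc β₁ β₂ := ⟨hβm.1.le, hβm.2.le⟩
  have hr := hreg n hn β hβm.1.le θ hθ
  have hX := hX1 β hβc
  have hTX := hTX β hβm.1.le
  have hrate := nat_mul_rate_sq (hβ₁.trans hβm.1) (n := n) (by linarith)
  have hρ := rate_nonneg β n
  have hctrl := hctrl β hβc θ hθ
  obtain ⟨X, hXdef⟩ : ∃ X : ℝ, X = effDim β n := ⟨_, rfl⟩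
  rw [← hXdef] at hX hTX hrate hctrl
  have hXl : Real.log n ≤ X * Real.log n := le_mul_of_one_le_left (by linarith) hX
  have hMM : M n ≤ M n ^ 2 := by nlinarith
  have hR : n * (M n * rate β n) ^ 2 = M n ^ 2 * (X * Real.log n) := by rw [← hrate]; ring
  refine hctrl _ (Real.exp (-(n * (M n * rate β n) ^ 2 / (16 * v)))) (Real.exp_pos _).le ?_ ?_
  · intro x hx k hk hkT u hu
    rw [Set.mem_ofPred_eq, hr.funDist_eq] at hu
    have hk0 : (0 : ℝ) < k := by exact_mod_cast (by omega : 0 < k)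
    have hkn : k * Real.log n ≤ n := by
      have := hkT.trans hTX
      rw [one_mul, le_div_iff₀ (by linarith)] at this
      exact this
    refine lik_le_exp_neg hv hr (lt_of_mul_log_le hlog (by omega) hkn) (by positivity) ?_ ?_ u hu
    · rw [hR]; nlinarith
    · rw [hR]
      have h1 := hx k hk
      have h2 := mul_noiseConst_le hv
      have h3 : 0 < k * Real.log n := by positivity
      have h4 : k * Real.log n ≤ T * X * Real.log n := by gcongr
      have h5 : T * (X * Real.log n) ≤ M n ^ 2 * (X * Real.log n) :=
        mul_le_mul_of_nonneg_right (hMT.trans hMM) (by linarith)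
      have h6 : 64 * (v * noiseConst v) * (k * Real.log n) ≤ 1 * (k * Real.log n) := by gcongr
      linarith
  · rw [hR, ← Real.exp_add]
    have h1 : (C + 1) * (X * Real.log n) ≤ M n ^ 2 * (X * Real.log n) / (16 * v) := by
      rw [le_div_iff₀ (by positivity)]
      have := mul_le_mul_of_nonneg_right (hMC.trans hMM) (by linarith : 0 ≤ X * Real.log n)
      linarith
    calc _ ≤ Real.exp (-Real.log n) := Real.exp_le_exp.2 (by linarith)
      _ = 1 / n := by rw [Real.exp_neg, Real.exp_log hn', one_div]
      _ ≤ δ := by rw [div_le_iff₀ hn']; exact hlin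

/-- A sequence on the boundary of the hyperrectangle, whose approximation errors are as large as
possible. -/
def extremalSeq (β L : ℝ) : ℕ → ℝ := fun j => √L * ((j : ℝ) + 1) ^ (-(β + 1 / 2))

lemma extremalSeq_sq {β L : ℝ} (hL : 0 < L) (j : ℕ) :
    extremalSeq β L j ^ 2 = L * ((j : ℝ) + 1) ^ (-(2 * β + 1)) := by
  rw [extremalSeq, mul_pow, Real.sq_sqrt hL.le, ← Real.rpow_mul_natCast (by positivity)]
  congr 2; push_cast; ring

lemma extremalSeq_mem {β L : ℝ} (hL : 0 < L) : extremalSeq β L ∈ hyperrect β L := fun j => by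
  rw [extremalSeq_sq hL, mul_left_comm, ← Real.rpow_add (by positivity)]
  simp

/-- Only the coordinates `k, …, 2k - 1` are used. There the sieve element vanishes and each squared
coefficient is at least `L (2k)^(-(2β+1))`. The condition `2k < n` keeps them untouched by the
projection. -/
lemma le_seqDist_extremalSeq_sq {β L : ℝ} (hβ : 0 < β) (hL : 0 < L) (proj : Prop) {n k : ℕ}
    (hk : 1 ≤ k) (hkn : 2 * k < n) (hs : Summable fun j => |truth proj n (extremalSeq β L) j|)
    (u : Fin k → ℝ) :
    L * 2 ^ (-(2 * β + 1)) * (k : ℝ) ^ (-(2 * β))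
      ≤ seqDist (extendZero k u) (truth proj n (extremalSeq β L)) ^ 2 := by
  have hk0 : (0 : ℝ) < k := by exact_mod_cast hk
  have hsq := summable_sq_of_summable_abs (summable_abs_sub (summable_abs_extendZero u) hs)
  rw [seqDist, Real.sq_sqrt (tsum_nonneg fun _ => sq_nonneg _)]
  refine le_trans ?_ (hsq.sum_le_tsum (Finset.Ico k (2 * k)) fun j _ => sq_nonneg _)
  have hterm : ∀ j ∈ Finset.Ico k (2 * k), L * (2 * (k : ℝ)) ^ (-(2 * β + 1))
      ≤ (extendZero k u - truth proj n (extremalSeq β L)) j ^ 2 := fun j hj => by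
    obtain ⟨hj1, hj2⟩ := Finset.mem_Ico.1 hj
    have ht : truth proj n (extremalSeq β L) j = extremalSeq β L j := by
      rw [truth, if_neg]; rintro ⟨-, h⟩; omega
    rw [Pi.sub_apply, extendZero_of_le u hj1, ht, zero_sub, neg_sq, extremalSeq_sq hL]
    refine mul_le_mul_of_nonneg_left (Real.rpow_le_rpow_of_nonpos (by positivity) ?_
      (by linarith)) hL.le
    exact_mod_cast (by omega : j + 1 ≤ 2 * k)
  refine le_trans (le_of_eq ?_) (Finset.card_nsmul_le_sum _ _ _ hterm)
  rw [Nat.card_Ico, show 2 * k - k = k by omega, nsmul_eq_mul,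
    Real.mul_rpow (by norm_num) hk0.le, show -(2 * β + 1) = -(2 * β) + -1 by ring,
    Real.rpow_add hk0, Real.rpow_neg_one]
  field_simp

/-- For `k ≤ T X` the squared approximation error of the extremal sequence is at least `q · rate²`
for a fixed `q > 0`. Once `d² < q` the ball contains no point of these sieves, so the control
applies with `η = 0`. -/
lemma PosteriorControl.tendsto_sharpness {v : ℝ≥0} {proj : Prop} {L β : ℝ}
    {post : (n : ℕ) → (Fin n → ℝ) → Set (ℕ → ℝ) → ℝ≥0∞}
    (h : PosteriorControl v proj L β β post) (hβ : 0 < β) (hL : 0 < L)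
    (hproj : proj ∨ 1 / 2 < β) {d : ℕ → ℝ} (hd : Tendsto d atTop (𝓝 0)) :
    Tendsto (fun n => ∫⁻ x, post n x
      {θ | funDist (truth proj n (extremalSeq β L)) θ ≤ d n * rate β n}
        ∂(dataLaw v n (truth proj n (extremalSeq β L)))) atTop (𝓝 0) := by
  obtain ⟨A, -, hreg⟩ := exists_isRegular_truth proj hβ hL hproj
  obtain ⟨T, C, hT, hC, hctrl⟩ := h
  obtain ⟨q, hq⟩ : ∃ q : ℝ, q = L * 2 ^ (-(2 * β + 1)) * T ^ (-(2 * β)) := ⟨_, rfl⟩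
  have hq0 : 0 < q := by rw [hq]; positivity
  rw [ENNReal.tendsto_nhds_zero]
  intro r hr
  obtain ⟨δ, hδ, hδr⟩ := exists_ofReal_four_mul_le hr
  filter_upwards [hctrl δ hδ, (hd.pow 2).eventually_lt_const (by simpa using hq0 : (0 : ℝ) ^ 2 < q),
    tendsto_log_natCast.eventually_gt_atTop 2, eventually_ge_atTop 2,
    eventually_le_effDim hβ le_rfl 1, eventually_mul_effDim_le hβ one_pos T]
    with n hctrl hdq hlog hn hX1 hTX
  have hn' : (0 : ℝ) < n := by exact_mod_cast (by omega : 0 < n)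
  have hβc : β ∈ Set.Icc β β := ⟨le_rfl, le_rfl⟩
  have hmem : extremalSeq β L ∈ hyperrect β L ∪ sobolev β L := Or.inl (extremalSeq_mem hL)
  have hr := hreg n hn β le_rfl _ hmem
  have hX := hX1 β hβc
  refine (hctrl β hβc _ hmem _ 0 le_rfl ?_ (by simpa using hδ.le)).trans hδr
  intro x hx k hk hkT u hu
  exfalso
  have hk0 : (0 : ℝ) < k := by exact_mod_cast (by omega : 0 < k)
  have hkn : 2 * k < n := by
    have := hkT.trans (hTX β le_rfl)
    rw [one_mul, le_div_iff₀ (by linarith)] at this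
    have : (2 : ℝ) * k < n := by nlinarith
    exact_mod_cast this
  rw [Set.mem_ofPred_eq, hr.funDist_eq] at hu
  have h1 := le_seqDist_extremalSeq_sq hβ hL proj (by omega : 1 ≤ k) hkn hr.summable u
  have h2 : T ^ (-(2 * β)) * rate β n ^ 2 ≤ (k : ℝ) ^ (-(2 * β)) := by
    rw [← effDim_rpow hβ, ← Real.mul_rpow hT.le (by linarith)]
    exact Real.rpow_le_rpow_of_nonpos hk0 hkT (by linarith)
  have h3 : q * rate β n ^ 2 ≤ d n ^ 2 * rate β n ^ 2 := by
    calc q * rate β n ^ 2 = L * 2 ^ (-(2 * β + 1)) * (T ^ (-(2 * β)) * rate β n ^ 2) := by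
          rw [hq]; ring
      _ ≤ L * 2 ^ (-(2 * β + 1)) * (k : ℝ) ^ (-(2 * β)) := by gcongr
      _ ≤ _ := h1
      _ ≤ (d n * rate β n) ^ 2 := pow_le_pow_left₀ (Real.sqrt_nonneg _) hu 2
      _ = _ := mul_pow _ _ _
  have h4 : 0 < rate β n ^ 2 := by
    have := nat_mul_rate_sq hβ (n := n) (by linarith)
    have h5 : 0 < effDim β n * Real.log n := by nlinarith
    rw [← this] at h5
    exact pos_of_mul_pos_right h5 hn'.le
  nlinarith

end

end SieveRegression
theorem proposition3p1 (v : ℝ≥0) (hv : v ≠ 0) (g : ℝ → ℝ) (hg : IsSieveDensity g) :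
    ∃ ε₀ : ℝ, 0 < ε₀ ∧ ∀ ε : ℝ, 0 < ε → ε ≤ ε₀ →
    ∀ khat : (n : ℕ) → (Fin n → ℝ) → ℕ, IsMMLE v g ε khat →
    ∀ (proj : Prop) (L : ℝ), 0 < L →
      -- the MMLE belongs to the oracle set with probability tending to one
      (∀ β : ℝ, 0 < β → (proj ∨ 1 / 2 < β) →
        ∀ θ₀ ∈ hyperrect β L ∪ sobolev β L, ∀ K : ℝ, 0 < K →
        ∀ e : ℕ → ℕ → ℝ, (∀ n, IsLevelRate g ε K n (truth proj n θ₀) (e n)) →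
        ∀ M m : ℕ → ℝ, Tendsto M atTop atTop → Tendsto m atTop atTop →
          Tendsto (fun n => dataLaw v n (truth proj n θ₀)
            {x | khat n x ∈ oracleSet ε (M n) (m n) n (e n)}) atTop (𝓝 1)) ∧
      -- contraction of the empirical and the hierarchical posterior, uniformly over the classes
      (∀ β₁ β₂ : ℝ, 0 < β₁ → β₁ ≤ β₂ → (proj ∨ 1 / 2 < β₁) →
        ∀ M : ℕ → ℝ, Tendsto M atTop atTop →
          Tendsto (fun n => ⨆ β ∈ Set.Ioo β₁ β₂, ⨆ θ₀ ∈ hyperrect β L ∪ sobolev β L,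
            ∫⁻ x, posteriorProb v n (sievePrior g (khat n x)) x
              {θ | M n * rate β n ≤ funDist (truth proj n θ₀) θ}
              ∂(dataLaw v n (truth proj n θ₀))) atTop (𝓝 0) ∧
          ∀ (β₀ : ℝ) (π : ℕ → ℝ), 0 ≤ β₀ → β₀ < β₁ → IsHyperPrior β₀ π →
            Tendsto (fun n => ⨆ β ∈ Set.Ioo β₁ β₂, ⨆ θ₀ ∈ hyperrect β L ∪ sobolev β L,
              ∫⁻ x, posteriorProb v n (hierPrior g π) x
                {θ | M n * rate β n ≤ funDist (truth proj n θ₀) θ}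
                ∂(dataLaw v n (truth proj n θ₀))) atTop (𝓝 0)) ∧
      -- sharpness of the rate for some true parameter
      (∀ β : ℝ, 0 < β → (proj ∨ 1 / 2 < β) →
        ∃ θ₀ ∈ hyperrect β L ∪ sobolev β L, ∀ δ : ℕ → ℝ, Tendsto δ atTop (𝓝 0) →
          Tendsto (fun n => ∫⁻ x, posteriorProb v n (sievePrior g (khat n x)) x
            {θ | funDist (truth proj n θ₀) θ ≤ δ n * rate β n}
            ∂(dataLaw v n (truth proj n θ₀))) atTop (𝓝 0) ∧
          ∀ (β₀ : ℝ) (π : ℕ → ℝ), 0 ≤ β₀ → β₀ < β → IsHyperPrior β₀ π →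
            Tendsto (fun n => ∫⁻ x, posteriorProb v n (hierPrior g π) x
              {θ | funDist (truth proj n θ₀) θ ≤ δ n * rate β n}
              ∂(dataLaw v n (truth proj n θ₀))) atTop (𝓝 0)) := by
  -- The value `1` suffices, since the levels need only satisfy `k log n ≤ n`; the constants of the
  -- noise event are adapted to `v` and `K` instead.
  refine ⟨1, one_pos, fun ε hε0 hε khat hk proj L hL => ⟨?_, ?_, ?_⟩⟩
  · intro β hβ hproj θ₀ hθ₀ K hK e he M m hM _
    obtain ⟨A, -, hreg⟩ := exists_isRegular_truth proj hβ hL hproj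
    exact tendsto_mmle_mem_oracleSet hv hg hε0 hε hk
      ((eventually_ge_atTop 2).mono fun n hn => hreg n hn β le_rfl θ₀ hθ₀) hK he hM
  · intro β₁ β₂ hβ₁ hβ hproj M hM
    refine ⟨(posteriorControl_mmle hv hg proj hβ₁ hβ hL hproj hε0 hε hk).tendsto_contraction
      hv hβ₁ hβ hL hproj hM, fun β₀ π hβ₀ hlt hπ => ?_⟩
    exact (posteriorControl_hier hv hg proj hβ₀ hlt hβ hL hproj hπ).tendsto_contraction
      hv hβ₁ hβ hL hproj hM
  · intro β hβ hproj
    refine ⟨extremalSeq β L, Or.inl (extremalSeq_mem hL), fun d hd => ⟨?_, ?_⟩⟩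
    · exact (posteriorControl_mmle hv hg proj hβ le_rfl hL hproj hε0 hε hk).tendsto_sharpness
        hβ hL hproj hd
    · intro β₀ π hβ₀ hlt hπ
      exact (posteriorControl_hier hv hg proj hβ₀ hlt le_rfl hL hproj hπ).tendsto_sharpness
        hβ hL hproj hd
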